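/- **Conventions.** A graph has vertices, arcs, an origin map $o$ and an involution $a\mapsto\overline a$ on arcs ($\overline a=a$ is allowed); $t(a)=o(\overline a)$. A tree is a nonempty connected graph without loops, multiple edges or cycles. $\mathrm{Sym}(X)$ carries the permutation topology (basic open sets: permutations with prescribed values on a finite set), and $\mathrm{Aut}(T)\le \mathrm{Sym}(VT)$ the subspace topology. The P-closure $H^{P}$ of $H\le\mathrm{Aut}(T)$ is the group of all $g\in\mathrm{Aut}(T)$ that agree with some element of $H$ on each finite set of vertices contained in a ball of radius $1$; $H$ is P-closed if $H=H^{P}$. A local action diagram $(\Gamma,(X_a),(G(v)))$ consists of a connected graph $\Gamma$, nonempty sets $X_a$ ($a\in A\Gamma$), and for each $v\in V\Gamma$ a closed subgroup $G(v)$ of $\mathrm{Sym}(X_v)$, $X_v=\bigsqcup_{o(a)=v}X_a$, with orbits the $X_a$. Isomorphisms are graph isomorphisms together with colour bijections $X_v\to X'_{\theta(v)}$ that carry $X_a$ onto $X'_{\theta(a)}$ and conjugate $G(v)$ to $G'(\theta(v))$. Let a group $G$ act on a tree $T$; assume the action is faithful or $T$ has at least one arc. Its diagram $\Delta=(\Gamma,(X_a),(G(v)))$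 has $\Gamma=G\backslash T$; choosing a representative $v^*\in VT$ of each $v\in V\Gamma$, $X_a$ is the set of arcs in $o^{-1}(v^*)$ over $a$ (for $o(a)=v$), and $G(v)$ is the permutation group of $X_v=o^{-1}(v^*)$ induced by the closure in $\mathrm{Aut}(T)$ of (the image of) the stabilizer of $v^*$. (It need not be closed; "the local action diagram" of the action is $\overline\Delta=(\Gamma,(X_a),(\overline{G(v)}))$.) Let $G^+$ be the subgroup of $G$ generated by all arc stabilizers, and $G(v)^+$ the subgroup of $G(v)$ generated by point stabilizers. Two actions are called isomorphic if there are a group isomorphism and a graph isomorphism that intertwine them. **Theorem.** The graph $G^+\backslash T$ is a tree, and $G/G^+$ acts on it faithfully, freely on arcs, and as a P-closed group. Up to isomorphism of actions, $(G^+\backslash T,G/G^+)$ depends only on the isomorphism class of $(\Gamma,(X_a),(\overline{G(v)}))$. It is unchanged if $G$ is replaced with its P-closure $L=G^{P}$ in $\mathrm{Aut}(T)$: the maps $G^+x\mapsto L^+x$ and $gG^+\mapsto gL^+$ are well-defined and form an isomorphism of actions. Moreover: (i) Let $\Delta^*=(\Gamma,(X_a^*),(G^*(v)))$, where $X_a^*$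 is the set of $G(v)^+$-orbits on $X_a$ ($v=o(a)$) and $G^*(v)$ is the permutation group induced by $G(v)$ on the $G(v)^+$-orbits in $X_v$. Then $\Delta^*$ is a local action diagram, the kernel of $G(v)\to G^*(v)$ is $G(v)^+$, so that $G^*(v)=G(v)/G(v)^+$, and $G^*(v)$ acts regularly on each $X_a^*$. Replacing all $G(v)$ by $\overline{G(v)}$ does not change $\Delta^*$ up to an isomorphism that is the identity on $\Gamma$. The diagram of $(G^+\backslash T,G/G^+)$ is isomorphic to $\Delta^*$ via the natural identification of $(G/G^+)\backslash(G^+\backslash T)$ with $\Gamma$; and every P-closed group of automorphisms of a tree whose local action diagram is isomorphic to $\Delta^*$ is, as an action, isomorphic to $(G^+\backslash T,G/G^+)$. (ii) Let $T^i$ be obtained from $T$ by adding a midpoint to each edge $\{a,\overline a\}$ with $\overline a\in Ga$; define $(G^+\backslash T)^i$ in the same way with respect to $G/G^+$. Let $\Gamma^i$ be obtained from $\Gamma$ by replacing each loop $a=\overline a$ by one edge from $o(a)$ to a new vertex $v_a$. Then $G\backslash T^i$ is naturally $\Gamma^i$. Let $\mathcal G$ be the graph of groups over $\Gamma^i$ with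 vertex group $G^*(v)$ at $v\in V\Gamma$, vertex group $C_2$ at each new vertex $v_a$, and trivial edge groups. Then $\Gamma^i$ has a maximal subtree, and for every maximal subtree $S$ the action of $G/G^+$ on $(G^+\backslash T)^i$ is isomorphic to the action of the fundamental group $\pi_1(\mathcal G,S)$ on its Bass–Serre tree, via an isomorphism compatible with the projections of both trees to $\Gamma^i$. -/

import Mathlib

universe u v u' v' w w' x

open Equiv (Perm)

namespace TreeAction

set_option linter.checkUnivs false

/-! ## Graphs, trees, homomorphisms -/

/-- A graph in the sense of Serre, except that an arc may be its own reverse. -/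
structure RGraph where
  V : Type u
  A : Type v
  o : A → V
  rev : A → A
  rev_rev : ∀ a, rev (rev a) = a

theorem Perm.apply_inv' {X : Type u} (f : Perm X) (p : X) : f (f⁻¹ p) = p :=
  f.apply_symm_apply p

theorem Perm.inv_apply' {X : Type u} (f : Perm X) (p : X) : f⁻¹ (f p) = p :=
  f.symm_apply_apply p

namespace RGraph

/-- The terminal vertex of an arc. -/
def t (Y : RGraph.{u, v}) (a : Y.A) : Y.V := Y.o (Y.rev a)

/-- The adjacency relation between distinct vertices. -/
def toSimple (Y : RGraph.{u, v}) : SimpleGraph Y.V where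
  Adj x y := x ≠ y ∧ ∃ a, Y.o a = x ∧ Y.t a = y
  symm := ⟨by
    rintro x y ⟨h, a, ha, hb⟩
    exact ⟨h.symm, Y.rev a, hb, by rw [t, Y.rev_rev, ha]⟩⟩
  loopless := ⟨fun x h => h.1 rfl⟩

/-- A graph is connected if it is nonempty and any two vertices are joined by a path. -/
def IsConnected (Y : RGraph.{u, v}) : Prop := Y.toSimple.Connected

/-- A tree: a simple connected nonempty graph without cycles. -/
structure IsTree (Y : RGraph.{u, v}) : Prop where
  arc_ext : ∀ a b, Y.o a = Y.o b → Y.t a = Y.t b → a = b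
  no_loop : ∀ a, Y.o a ≠ Y.t a
  tree : Y.toSimple.IsTree

/-- Graph homomorphisms. -/
@[ext]
structure Hom (Y : RGraph.{u, v}) (Z : RGraph.{u', v'}) where
  V : Y.V → Z.V
  A : Y.A → Z.A
  map_o : ∀ a, V (Y.o a) = Z.o (A a)
  map_rev : ∀ a, A (Y.rev a) = Z.rev (A a)

/-- Graph isomorphisms. -/
@[ext]
structure Iso (Y : RGraph.{u, v}) (Z : RGraph.{u', v'}) where
  V : Y.V ≃ Z.V
  A : Y.A ≃ Z.A
  map_o : ∀ a, V (Y.o a) = Z.o (A a)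
  map_rev : ∀ a, A (Y.rev a) = Z.rev (A a)

/-- The underlying homomorphism of an isomorphism. -/
def Iso.toHom {Y : RGraph.{u, v}} {Z : RGraph.{u', v'}} (f : Iso Y Z) : Hom Y Z :=
  ⟨f.V, f.A, f.map_o, f.map_rev⟩

/-- The automorphisms of a graph. -/
abbrev Aut (Y : RGraph.{u, v}) := Iso Y Y

instance (Y : RGraph.{u, v}) : Group (Aut Y) where
  mul f g := ⟨f.V * g.V, f.A * g.A, fun a => by simp [f.map_o, g.map_o],
    fun a => by simp [f.map_rev, g.map_rev]⟩
  one := ⟨1, 1, fun _ => rfl, fun _ => rfl⟩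
  inv f := ⟨f.V⁻¹, f.A⁻¹,
    fun a => by rw [Equiv.Perm.inv_eq_iff_eq, f.map_o, Perm.apply_inv'],
    fun a => by rw [Equiv.Perm.inv_eq_iff_eq, f.map_rev, Perm.apply_inv']⟩
  mul_assoc _ _ _ := rfl
  one_mul _ := rfl
  mul_one _ := rfl
  inv_mul_cancel f := Iso.ext (inv_mul_cancel f.V) (inv_mul_cancel f.A)

/-- The permutation of the vertices induced by an automorphism. -/
def toPermV (Y : RGraph.{u, v}) : Aut Y →* Perm Y.V where
  toFun f := f.V
  map_one' := rfl
  map_mul' _ _ := rfl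

@[simp] theorem Aut.one_V {Y : RGraph.{u, v}} (p : Y.V) : (1 : Aut Y).V p = p := rfl
@[simp] theorem Aut.one_A {Y : RGraph.{u, v}} (p : Y.A) : (1 : Aut Y).A p = p := rfl
@[simp] theorem Aut.mul_V {Y : RGraph.{u, v}} (f g : Aut Y) (p : Y.V) :
    (f * g).V p = f.V (g.V p) := rfl
@[simp] theorem Aut.mul_A {Y : RGraph.{u, v}} (f g : Aut Y) (p : Y.A) :
    (f * g).A p = f.A (g.A p) := rfl

theorem Iso.map_t {Y : RGraph.{u, v}} {Z : RGraph.{u', v'}} (f : Iso Y Z) (a : Y.A) :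
    f.V (Y.t a) = Z.t (f.A a) := by rw [t, t, f.map_o, f.map_rev]

end RGraph

open RGraph

/-! ## The permutation topology and closures -/

/-- The permutation topology on `Sym(X)`, generated by the cosets of point stabilizers. -/
abbrev permTopology (X : Type u) : TopologicalSpace (Perm X) :=
  TopologicalSpace.generateFrom {S | ∃ p q : X, S = {g : Perm X | g p = q}}

/-- The closure of a permutation group in the permutation topology (see `coe_permClosure`). -/
def permClosure {X : Type u} (H : Subgroup (Perm X)) : Subgroup (Perm X) where
  carrier := {g | ∀ F : Finset X, ∃ h ∈ H, ∀ p ∈ F, h p = g p}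
  one_mem' F := ⟨1, H.one_mem, fun _ _ => rfl⟩
  mul_mem' {f g} hf hg F := by
    classical
    obtain ⟨k, hk, hkF⟩ := hg F
    obtain ⟨l, hl, hlF⟩ := hf (F.image g)
    refine ⟨l * k, H.mul_mem hl hk, fun p hp => ?_⟩
    rw [Equiv.Perm.mul_apply, Equiv.Perm.mul_apply, hkF p hp,
      hlF _ (Finset.mem_image_of_mem g hp)]
  inv_mem' {g} hg F := by
    classical
    obtain ⟨k, hk, hkF⟩ := hg (F.image ⇑(g⁻¹))
    refine ⟨k⁻¹, H.inv_mem hk, fun p hp => ?_⟩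
    have := hkF _ (Finset.mem_image_of_mem _ hp)
    rw [Perm.apply_inv'] at this
    rw [Equiv.Perm.inv_eq_iff_eq, this]

theorem coe_permClosure {X : Type u} (H : Subgroup (Perm X)) :
    (permClosure H : Set (Perm X)) = @closure _ (permTopology X) (H : Set (Perm X)) := by
  let _ := permTopology X
  ext g
  constructor
  · intro hg
    have key : ∀ U : Set (Perm X), IsOpen U → g ∈ U →
        ∃ F : Finset X, ∀ h : Perm X, (∀ p ∈ F, h p = g p) → h ∈ U := by
      classical
      intro U hU
      induction hU with
      | basic U hU =>
        obtain ⟨p, q, rfl⟩ := hU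
        intro hgU
        exact ⟨{p}, fun h hh => (hh p (Finset.mem_singleton_self p)).trans hgU⟩
      | univ => exact fun _ => ⟨∅, fun _ _ => trivial⟩
      | inter U W _ _ hU hW =>
        rintro ⟨h1, h2⟩
        obtain ⟨F, hF⟩ := hU h1
        obtain ⟨E, hE⟩ := hW h2
        exact ⟨F ∪ E, fun h hh => ⟨hF h fun p hp => hh p (Finset.mem_union_left _ hp),
          hE h fun p hp => hh p (Finset.mem_union_right _ hp)⟩⟩
      | sUnion 𝒰 _ ih =>
        rintro ⟨U, hU, hgU⟩
        obtain ⟨F, hF⟩ := ih U hU hgU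
        exact ⟨F, fun h hh => ⟨U, hU, hF h hh⟩⟩
    rw [mem_closure_iff]
    intro U hU hgU
    obtain ⟨F, hF⟩ := key U hU hgU
    obtain ⟨h, hh, hhF⟩ := hg F
    exact ⟨h, hF h hhF, hh⟩
  · intro hg F
    have ho : IsOpen (⋂ p ∈ F, {h : Perm X | h p = g p}) :=
      isOpen_biInter_finset fun p _ => TopologicalSpace.isOpen_generateFrom_of_mem ⟨p, g p, rfl⟩
    obtain ⟨h, h1, h2⟩ := mem_closure_iff.1 hg _ ho (by simp)
    exact ⟨h, h2, by simpa using h1⟩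

/-- The closure of a group of automorphisms, where `Aut(Y)` carries the subspace topology
from the permutation topology on `Sym(VY)`. -/
def autClosure {Y : RGraph.{u, v}} (H : Subgroup (Aut Y)) : Subgroup (Aut Y) :=
  (permClosure (H.map (toPermV Y))).comap (toPermV Y)

/-- The P-closure (that is, the P₁-closure) of a group of automorphisms: all automorphisms that,
on every finite set of vertices at distance at most `1` from some vertex, agree with an element
of the group. -/
def pClosure {Y : RGraph.{u, v}} (H : Subgroup (Aut Y)) : Subgroup (Aut Y) where
  carrier := {g | ∀ (p : Y.V) (F : Finset Y.V), (∀ q ∈ F, q = p ∨ Y.toSimple.Adj p q) →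
    ∃ h ∈ H, ∀ q ∈ F, h.V q = g.V q}
  one_mem' _ _ _ := ⟨1, H.one_mem, fun _ _ => rfl⟩
  mul_mem' {f g} hf hg p F hF := by
    classical
    obtain ⟨k, hk, hkF⟩ := hg p F hF
    obtain ⟨l, hl, hlF⟩ := hf (g.V p) (F.image g.V) (by
      intro q hq
      obtain ⟨r, hr, rfl⟩ := Finset.mem_image.1 hq
      rcases hF r hr with rfl | ⟨hn, a, ha, hb⟩
      · exact Or.inl rfl
      · exact Or.inr ⟨fun h => hn (g.V.injective h), g.A a, by rw [← g.map_o, ha],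
          by rw [← g.map_t, hb]⟩)
    refine ⟨l * k, H.mul_mem hl hk, fun q hq => ?_⟩
    rw [Aut.mul_V, Aut.mul_V, hkF q hq, hlF _ (Finset.mem_image_of_mem g.V hq)]
  inv_mem' {g} hg p F hF := by
    classical
    obtain ⟨k, hk, hkF⟩ := hg ((g⁻¹).V p) (F.image (g⁻¹).V) (by
      intro q hq
      obtain ⟨r, hr, rfl⟩ := Finset.mem_image.1 hq
      rcases hF r hr with rfl | ⟨hn, a, ha, hb⟩
      · exact Or.inl rfl
      · exact Or.inr ⟨fun h => hn ((g⁻¹).V.injective h), (g⁻¹).A a, by rw [← (g⁻¹).map_o, ha],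
          by rw [← (g⁻¹).map_t, hb]⟩)
    refine ⟨k⁻¹, H.inv_mem hk, fun q hq => ?_⟩
    have h1 := hkF _ (Finset.mem_image_of_mem _ hq)
    have h2 : g.V ((g⁻¹).V q) = q := Perm.apply_inv' g.V q
    rw [h2] at h1
    have h3 : (k⁻¹).V (k.V ((g⁻¹).V q)) = (g⁻¹).V q := Perm.inv_apply' k.V _
    rw [h1] at h3
    exact h3

theorem le_pClosure {Y : RGraph.{u, v}} (H : Subgroup (Aut Y)) : H ≤ pClosure H :=
  fun g hg _ _ _ => ⟨g, hg, fun _ _ => rfl⟩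

/-- A group of automorphisms is P-closed if it equals its P-closure. -/
def IsPClosed {Y : RGraph.{u, v}} (H : Subgroup (Aut Y)) : Prop := pClosure H = H

/-! ## Actions, quotient graphs and the group `G⁺` -/

section Actions

variable {G : Type w} [Group G] {T : RGraph.{u, v}}

/-- The orbit relation on vertices. -/
def vSetoid (ρ : G →* Aut T) : Setoid T.V where
  r p q := ∃ g, (ρ g).V p = q
  iseqv := ⟨fun p => ⟨1, by simp⟩,
    by rintro p _ ⟨g, rfl⟩; exact ⟨g⁻¹, by rw [← Aut.mul_V, ← map_mul]; simp⟩,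
    by rintro p _ _ ⟨g, rfl⟩ ⟨h, rfl⟩; exact ⟨h * g, by simp⟩⟩

/-- The orbit relation on arcs. -/
def aSetoid (ρ : G →* Aut T) : Setoid T.A where
  r p q := ∃ g, (ρ g).A p = q
  iseqv := ⟨fun p => ⟨1, by simp⟩,
    by rintro p _ ⟨g, rfl⟩; exact ⟨g⁻¹, by rw [← Aut.mul_A, ← map_mul]; simp⟩,
    by rintro p _ _ ⟨g, rfl⟩ ⟨h, rfl⟩; exact ⟨h * g, by simp⟩⟩

/-- The quotient graph `G \ T`. -/
def quot (ρ : G →* Aut T) : RGraph.{u, v} where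
  V := Quotient (vSetoid ρ)
  A := Quotient (aSetoid ρ)
  o := Quotient.map T.o (by rintro a _ ⟨g, rfl⟩; exact ⟨g, (ρ g).map_o a⟩)
  rev := Quotient.map T.rev (by rintro a _ ⟨g, rfl⟩; exact ⟨g, (ρ g).map_rev a⟩)
  rev_rev := by
    rintro ⟨a⟩
    exact congrArg (Quotient.mk (aSetoid ρ)) (T.rev_rev a)

/-- The quotient map `T → G \ T`. -/
def quotMap (ρ : G →* Aut T) : Hom T (quot ρ) where
  V := Quotient.mk (vSetoid ρ)
  A := Quotient.mk (aSetoid ρ)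
  map_o _ := rfl
  map_rev _ := rfl

/-- `G⁺`, the subgroup generated by the arc stabilizers. -/
def plus (ρ : G →* Aut T) : Subgroup G :=
  Subgroup.closure {g | ∃ a, (ρ g).A a = a}

instance plus_normal (ρ : G →* Aut T) : (plus ρ).Normal := by
  have h : {g | ∃ a, (ρ g).A a = a} = Group.conjugatesOfSet {g | ∃ a, (ρ g).A a = a} := by
    refine Set.Subset.antisymm Group.subset_conjugatesOfSet ?_
    intro k hk
    obtain ⟨g, ⟨a, ha⟩, hc⟩ := Group.mem_conjugatesOfSet_iff.1 hk
    obtain ⟨c, rfl⟩ := isConj_iff.1 hc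
    refine ⟨(ρ c).A a, ?_⟩
    rw [← Aut.mul_A, ← map_mul, inv_mul_cancel_right, map_mul, Aut.mul_A, ha]
  rw [plus, h]
  exact Subgroup.normalClosure_normal

/-- The quotient graph `G⁺ \ T`. -/
abbrev plusQuot (ρ : G →* Aut T) : RGraph.{u, v} := quot (ρ.comp (plus ρ).subtype)

/-- The quotient map `T → G⁺ \ T`. -/
abbrev plusMap (ρ : G →* Aut T) : Hom T (plusQuot ρ) := quotMap (ρ.comp (plus ρ).subtype)

/-- The action of `G` on `G⁺ \ T`. -/
def preQuotientAction (ρ : G →* Aut T) : G →* Aut (plusQuot ρ) := by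
  have hV : ∀ (g : G) (p q : T.V), (vSetoid (ρ.comp (plus ρ).subtype)).r p q →
      (vSetoid (ρ.comp (plus ρ).subtype)).r ((ρ g).V p) ((ρ g).V q) := by
    rintro g p _ ⟨⟨k, hk⟩, rfl⟩
    exact ⟨⟨g * k * g⁻¹, (plus_normal ρ).conj_mem k hk g⟩, by simp [← Aut.mul_V, ← map_mul]⟩
  have hA : ∀ (g : G) (p q : T.A), (aSetoid (ρ.comp (plus ρ).subtype)).r p q →
      (aSetoid (ρ.comp (plus ρ).subtype)).r ((ρ g).A p) ((ρ g).A q) := by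
    rintro g p _ ⟨⟨k, hk⟩, rfl⟩
    exact ⟨⟨g * k * g⁻¹, (plus_normal ρ).conj_mem k hk g⟩, by simp [← Aut.mul_A, ← map_mul]⟩
  refine
    { toFun := fun g =>
        { V :=
            { toFun := Quotient.map (ρ g).V (hV g)
              invFun := Quotient.map (ρ g⁻¹).V (hV g⁻¹)
              left_inv := ?_
              right_inv := ?_ }
          A :=
            { toFun := Quotient.map (ρ g).A (hA g)
              invFun := Quotient.map (ρ g⁻¹).A (hA g⁻¹)
              left_inv := ?_
              right_inv := ?_ }
          map_o := ?_
          map_rev := ?_ }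
      map_one' := ?_
      map_mul' := ?_ }
  · rintro ⟨p⟩; exact congrArg (Quotient.mk _) (by rw [← Aut.mul_V, ← map_mul]; simp)
  · rintro ⟨p⟩; exact congrArg (Quotient.mk _) (by rw [← Aut.mul_V, ← map_mul]; simp)
  · rintro ⟨p⟩; exact congrArg (Quotient.mk _) (by rw [← Aut.mul_A, ← map_mul]; simp)
  · rintro ⟨p⟩; exact congrArg (Quotient.mk _) (by rw [← Aut.mul_A, ← map_mul]; simp)
  · rintro ⟨a⟩; exact congrArg (Quotient.mk _) ((ρ g).map_o a)
  · rintro ⟨a⟩; exact congrArg (Quotient.mk _) ((ρ g).map_rev a)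
  · apply Iso.ext
    · ext ⟨p⟩; exact congrArg (Quotient.mk _) (by simp)
    · ext ⟨p⟩; exact congrArg (Quotient.mk _) (by simp)
  · intro g h
    apply Iso.ext
    · ext ⟨p⟩; exact congrArg (Quotient.mk _) (by simp)
    · ext ⟨p⟩; exact congrArg (Quotient.mk _) (by simp)

/-- The quotient action of `G / G⁺` on `G⁺ \ T`. -/
def quotientAction (ρ : G →* Aut T) : G ⧸ plus ρ →* Aut (plusQuot ρ) :=
  QuotientGroup.lift (plus ρ) (preQuotientAction ρ) (by
    intro g hg
    apply Iso.ext
    · ext ⟨p⟩; exact (Quotient.sound (s := vSetoid (ρ.comp (plus ρ).subtype)) ⟨⟨g, hg⟩, rfl⟩ : _ = _).symm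
    · ext ⟨p⟩; exact (Quotient.sound (s := aSetoid (ρ.comp (plus ρ).subtype)) ⟨⟨g, hg⟩, rfl⟩ : _ = _).symm)

/-- The natural map `G⁺ \ T → G \ T`. -/
def plusToQuot (ρ : G →* Aut T) : Hom (plusQuot ρ) (quot ρ) where
  V := Quotient.map id (by rintro p _ ⟨g, rfl⟩; exact ⟨g, rfl⟩)
  A := Quotient.map id (by rintro p _ ⟨g, rfl⟩; exact ⟨g, rfl⟩)
  map_o := by rintro ⟨a⟩; rfl
  map_rev := by rintro ⟨a⟩; rfl

/-- The action is free on arcs. -/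
def FreeOnArcs (ρ : G →* Aut T) : Prop := ∀ g a, (ρ g).A a = a → g = 1

/-- Isomorphism (conjugacy) of group actions on graphs. -/
structure ActionIso {G' : Type w'} [Group G'] {T' : RGraph.{u', v'}}
    (ρ : G →* Aut T) (ρ' : G' →* Aut T') where
  group : G ≃* G'
  graph : Iso T T'
  map_V : ∀ g p, graph.V ((ρ g).V p) = (ρ' (group g)).V (graph.V p)
  map_A : ∀ g a, graph.A ((ρ g).A a) = (ρ' (group g)).A (graph.A a)

theorem quot_connected (ρ : G →* Aut T) (hT : T.IsConnected) : (quot ρ).IsConnected := by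
  have hT' : T.toSimple.Connected := hT
  have hn : Nonempty (quot ρ).V := hT'.nonempty.map (quotMap ρ).V
  have hr : ∀ p q : T.V, T.toSimple.Reachable p q →
      (quot ρ).toSimple.Reachable ((quotMap ρ).V p) ((quotMap ρ).V q) := by
    rintro p q ⟨W⟩
    induction W with
    | nil => exact SimpleGraph.Reachable.refl _
    | @cons a b c h W ih =>
      refine SimpleGraph.Reachable.trans ?_ ih
      by_cases hab : (quotMap ρ).V a = (quotMap ρ).V b
      · rw [hab]
      · obtain ⟨_, e, rfl, rfl⟩ := h
        exact SimpleGraph.Adj.reachable ⟨hab, (quotMap ρ).A e, rfl, rfl⟩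
  exact ⟨by rintro ⟨p⟩ ⟨q⟩; exact hr p q (hT'.preconnected p q)⟩

end Actions

/-! ## Permutation groups modulo point stabilizers -/

section Perm

variable {X : Type u}

/-- `H⁺`, the subgroup of a permutation group `H` generated by point stabilizers. -/
def permPlus (H : Subgroup (Perm X)) : Subgroup H :=
  Subgroup.closure {g | ∃ p, (g : Perm X) p = p}

instance permPlus_normal (H : Subgroup (Perm X)) : (permPlus H).Normal := by
  have h : {g : H | ∃ p, (g : Perm X) p = p} =
      Group.conjugatesOfSet {g : H | ∃ p, (g : Perm X) p = p} := by
    refine Set.Subset.antisymm Group.subset_conjugatesOfSet ?_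
    intro k hk
    obtain ⟨g, ⟨a, ha⟩, hc⟩ := Group.mem_conjugatesOfSet_iff.1 hk
    obtain ⟨c, rfl⟩ := isConj_iff.1 hc
    exact ⟨(c : Perm X) a, by simp [ha]⟩
  rw [permPlus, h]
  exact Subgroup.normalClosure_normal

/-- The orbit relation of `H⁺`. -/
def permPlusSetoid (H : Subgroup (Perm X)) : Setoid X where
  r p q := ∃ h ∈ permPlus H, (h : Perm X) p = q
  iseqv := ⟨fun p => ⟨1, one_mem _, rfl⟩,
    by rintro p _ ⟨g, hg, rfl⟩; exact ⟨g⁻¹, inv_mem hg, by simp⟩,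
    by rintro p _ _ ⟨g, hg, rfl⟩ ⟨h, hh, rfl⟩; exact ⟨h * g, mul_mem hh hg, by simp⟩⟩

/-- The action of `H` on the set of orbits of `H⁺`. -/
def permStarHom (H : Subgroup (Perm X)) : H →* Perm (Quotient (permPlusSetoid H)) := by
  have hs : ∀ (g : H) (p q : X), (permPlusSetoid H).r p q →
      (permPlusSetoid H).r ((g : Perm X) p) ((g : Perm X) q) := by
    rintro g p _ ⟨h, hh, rfl⟩
    exact ⟨g * h * g⁻¹, (permPlus_normal H).conj_mem h hh g, by simp⟩
  refine
    { toFun := fun g =>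
        { toFun := Quotient.map (g : Perm X) (hs g)
          invFun := Quotient.map ((g⁻¹ : H) : Perm X) (hs g⁻¹)
          left_inv := ?_
          right_inv := ?_ }
      map_one' := ?_
      map_mul' := ?_ }
  · rintro ⟨p⟩; exact congrArg (Quotient.mk _) (by simp)
  · rintro ⟨p⟩; exact congrArg (Quotient.mk _) (by simp)
  · ext ⟨p⟩; rfl
  · intro g h; ext ⟨p⟩; rfl

end Perm

/-! ## Local action diagrams -/

/-- The data of a local action diagram: a connected graph `Γ`; for each vertex `v`, the disjoint
union `X v` of the nonempty colour sets `X_a` (`o(a) = v`), recorded through the map `arc` whose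
fibre over `a` is `X_a`; and for each vertex `v` a group `G v ≤ Sym(X v)` whose orbits are the
colour sets `X_a`. It is a local action diagram if moreover it satisfies `IsClosed` below; this is
kept separate in order to speak about groups `G v` and about their closures. -/
structure Diagram where
  Γ : RGraph.{u, v}
  connected : Γ.IsConnected
  X : Γ.V → Type w
  arc : ∀ p, X p → Γ.A
  o_arc : ∀ p c, Γ.o (arc p c) = p
  exists_colour : ∀ a, ∃ c, arc (Γ.o a) c = a
  G : ∀ p, Subgroup (Perm (X p))
  orbit : ∀ p c d, (∃ g ∈ G p, g c = d) ↔ arc p c = arc p d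

/-- All local actions are closed in the permutation topology. -/
def Diagram.IsClosed (D : Diagram.{u, v, w}) : Prop :=
  ∀ p, @_root_.IsClosed _ (permTopology (D.X p)) (D.G p : Set (Perm (D.X p)))

/-- Isomorphisms of diagrams. -/
structure DiagramIso (D : Diagram.{u, v, w}) (E : Diagram.{u', v', w'}) where
  graph : Iso D.Γ E.Γ
  colour : ∀ p, D.X p ≃ E.X (graph.V p)
  map_arc : ∀ p c, E.arc _ (colour p c) = graph.A (D.arc p c)
  map_group : ∀ p (σ : Perm (D.X p)), σ ∈ D.G p ↔ (colour p).permCongr σ ∈ E.G (graph.V p)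

/-- The diagram in which every local action is replaced by its closure. -/
def Diagram.closure (D : Diagram.{u, v, w}) : Diagram.{u, v, w} where
  Γ := D.Γ
  connected := D.connected
  X := D.X
  arc := D.arc
  o_arc := D.o_arc
  exists_colour := D.exists_colour
  G p := permClosure (D.G p)
  orbit p c d := by
    rw [← D.orbit]
    constructor
    · rintro ⟨g, hg, rfl⟩
      obtain ⟨h, hh, hF⟩ := hg {c}
      exact ⟨h, hh, hF c (Finset.mem_singleton_self c)⟩
    · rintro ⟨g, hg, rfl⟩
      exact ⟨g, fun F => ⟨g, hg, fun _ _ => rfl⟩, rfl⟩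

/-- The diagram `Δ*`: the same graph, with `X_a` replaced by the set of orbits of `G(v)⁺` on `X_a`,
and `G(v)` by the permutation group it induces on the orbits of `G(v)⁺`. -/
def Diagram.star (D : Diagram.{u, v, w}) : Diagram.{u, v, w} where
  Γ := D.Γ
  connected := D.connected
  X p := Quotient (permPlusSetoid (D.G p))
  arc p := Quotient.lift (D.arc p) (by
    rintro c _ ⟨h, _, rfl⟩
    exact (D.orbit p _ _).1 ⟨h, h.2, rfl⟩)
  o_arc := by
    rintro p ⟨c⟩
    exact D.o_arc p c
  exists_colour a := by
    obtain ⟨c, hc⟩ := D.exists_colour a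
    exact ⟨Quotient.mk _ c, hc⟩
  G p := (permStarHom (D.G p)).range
  orbit := by
    rintro p ⟨c⟩ ⟨d⟩
    refine Iff.trans ?_ (D.orbit p c d)
    constructor
    · rintro ⟨_, ⟨g, rfl⟩, h⟩
      obtain ⟨k, _, hk⟩ := Quotient.exact (s := permPlusSetoid (D.G p)) h
      exact ⟨k * g, (k * g).2, hk⟩
    · rintro ⟨g, hg, rfl⟩
      exact ⟨_, ⟨⟨g, hg⟩, rfl⟩, rfl⟩

section Associated

variable {G : Type w} [Group G] {T : RGraph.{u, v}}

/-- The stabilizer of a vertex. -/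
def vStab (ρ : G →* Aut T) (p : T.V) : Subgroup G where
  carrier := {g | (ρ g).V p = p}
  one_mem' := by simp
  mul_mem' {g h} hg hh := by
    have hg' : (ρ g).V p = p := hg
    have hh' : (ρ h).V p = p := hh
    simp [hg', hh']
  inv_mem' {g} hg := by
    have hg' : (ρ g).V p = p := hg
    have h : (ρ g⁻¹).V ((ρ g).V p) = p := by rw [← Aut.mul_V, ← map_mul]; simp
    rw [hg'] at h
    exact h

/-- The group of permutations of `o⁻¹(p)` induced by a group `H` of automorphisms: all
permutations of `o⁻¹(p)` that are the restriction of an element of `H` fixing `p`. -/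
def starPerm (H : Subgroup (Aut T)) (p : T.V) : Subgroup (Perm {b : T.A // T.o b = p}) where
  carrier := {σ | ∃ g ∈ H, g.V p = p ∧ ∀ b : {b : T.A // T.o b = p}, g.A b = (σ b : T.A)}
  one_mem' := ⟨1, H.one_mem, rfl, fun _ => rfl⟩
  mul_mem' := by
    rintro σ τ ⟨g, hg, hp, hσ⟩ ⟨h, hh, hq, hτ⟩
    exact ⟨g * h, H.mul_mem hg hh, by simp [hp, hq], fun b => by simp [hσ, hτ]⟩
  inv_mem' := by
    rintro σ ⟨g, hg, hp, hσ⟩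
    refine ⟨g⁻¹, H.inv_mem hg, ?_, fun b => ?_⟩
    · exact Equiv.Perm.inv_eq_iff_eq.2 hp.symm
    · refine Equiv.Perm.inv_eq_iff_eq.2 ?_
      rw [hσ]; simp

/-- The local action diagram associated to an action on a tree and to a choice `s` of a
representative `v* = s v` of each vertex `v` of `G \ T`: the set `X_v` is `o⁻¹(v*)`, partitioned
by the quotient map, and `G(v)` is the permutation group induced on it by the closure of the
stabilizer of `v*`. -/
def assocDiagram (hT : T.IsTree) (ρ : G →* Aut T) (s : (quot ρ).V → T.V)
    (hs : ∀ p, (quotMap ρ).V (s p) = p) : Diagram.{u, v, v} where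
  Γ := quot ρ
  connected := quot_connected ρ hT.tree.connected
  X p := {b : T.A // T.o b = s p}
  arc p b := (quotMap ρ).A b.1
  o_arc p b := by rw [← (quotMap ρ).map_o, b.2, hs]
  exists_colour := by
    rintro ⟨a⟩
    obtain ⟨g, hg⟩ := Quotient.exact (s := vSetoid ρ) (hs ((quotMap ρ).V (T.o a))).symm
    exact ⟨⟨(ρ g).A a, by rw [← (ρ g).map_o]; exact hg⟩,
      (Quotient.sound (s := aSetoid ρ) ⟨g, rfl⟩ : _ = _).symm⟩
  G p := starPerm (autClosure ((vStab ρ (s p)).map ρ)) (s p)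
  orbit := by
    classical
    rintro p ⟨b, hb⟩ ⟨c, hc⟩
    constructor
    · rintro ⟨σ, ⟨g, hg, hp, hσ⟩, h⟩
      have h1 : g.A b = c := by rw [hσ ⟨b, hb⟩, h]
      obtain ⟨_, ⟨_, ⟨k, hk, rfl⟩, rfl⟩, hF⟩ := hg {T.o b, T.t b}
      have h2 : (ρ k).V (T.o b) = g.V (T.o b) := hF _ (by simp)
      have h3 : (ρ k).V (T.t b) = g.V (T.t b) := hF _ (by simp)
      refine Quotient.sound (s := aSetoid ρ) ⟨k, hT.arc_ext _ _ ?_ ?_⟩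
      · rw [← (ρ k).map_o, h2, g.map_o, h1]
      · rw [← (ρ k).map_t, h3, g.map_t, h1]
    · intro h
      obtain ⟨k, hk⟩ := Quotient.exact (s := aSetoid ρ) h
      have hk' : (ρ k).A b = c := hk
      have hp : (ρ k).V (s p) = s p := by
        rw [← hb, (ρ k).map_o, hk', hc, hb]
      have hq : (ρ k)⁻¹.V (s p) = s p := Equiv.Perm.inv_eq_iff_eq.2 hp.symm
      refine ⟨(ρ k).A.subtypeEquiv (fun a => ?_), ⟨ρ k, ?_, hp, fun _ => rfl⟩, Subtype.ext hk'⟩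
      · rw [← (ρ k).map_o]
        constructor
        · intro h; rw [h, hp]
        · intro h; exact (ρ k).V.injective (h.trans hp.symm)
      · exact fun F => ⟨_, ⟨_, ⟨k, hp, rfl⟩, rfl⟩, fun _ _ => rfl⟩

end Associated

/-! ## Reversal-free subdivision -/

section Subdivision

/-- The relation `b ∈ {a, ā}` on a reversal-invariant set of arcs. -/
def revSetoid (Y : RGraph.{u, v}) (R : Set Y.A) : Setoid R where
  r a b := (b : Y.A) = a ∨ (b : Y.A) = Y.rev a
  iseqv := ⟨fun _ => Or.inl rfl,
    by rintro a b (h | h)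
       · exact Or.inl h.symm
       · exact Or.inr (by rw [h, Y.rev_rev]),
    by rintro a b c (h | h) (k | k)
       · exact Or.inl (k.trans h)
       · exact Or.inr (by rw [k, h])
       · exact Or.inr (by rw [k, h])
       · exact Or.inl (by rw [k, h, Y.rev_rev])⟩

/-- The graph obtained from `Y` by adding a midpoint to every edge `{a, ā}` with `a` in the
reversal-invariant set `R`. For `a ∈ R`, the arc `(a, false)` goes from `o(a)` to the midpoint of
`{a, ā}`, and `(a, true)` is its reverse. If `a = ā`, this replaces the loop `a` by one edge. -/
def subdiv (Y : RGraph.{u, v}) (R : Set Y.A) (hR : ∀ a ∈ R, Y.rev a ∈ R) :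
    RGraph.{max u v, v} where
  V := Y.V ⊕ Quotient (revSetoid Y R)
  A := {a // a ∉ R} ⊕ (R × Bool)
  o := Sum.elim (fun a => Sum.inl (Y.o a))
    (fun c => if c.2 then Sum.inr (Quotient.mk _ c.1) else Sum.inl (Y.o c.1))
  rev := Sum.map (fun a => ⟨Y.rev a, fun h => a.2 (Y.rev_rev a ▸ hR _ h)⟩) (fun c => (c.1, !c.2))
  rev_rev := by
    rintro (a | c)
    · exact congrArg Sum.inl (Subtype.ext (Y.rev_rev a))
    · simp

/-- The homomorphism of subdivisions induced by a homomorphism. -/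
def subdivHom {Y : RGraph.{u, v}} {Z : RGraph.{u', v'}} {R : Set Y.A} {S : Set Z.A}
    (hR : ∀ a ∈ R, Y.rev a ∈ R) (hS : ∀ a ∈ S, Z.rev a ∈ S)
    (f : Hom Y Z) (hf : ∀ a, f.A a ∈ S ↔ a ∈ R) : Hom (subdiv Y R hR) (subdiv Z S hS) where
  V := Sum.map f.V (Quotient.map (fun a => ⟨f.A a, (hf a).2 a.2⟩) (by
    rintro a b (h | h)
    · exact Or.inl (congrArg f.A h)
    · exact Or.inr ((congrArg f.A h).trans (f.map_rev a))))
  A := Sum.map (fun a => ⟨f.A a, fun h => a.2 ((hf a).1 h)⟩)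
    (fun c => (⟨f.A c.1, (hf c.1).2 c.1.2⟩, c.2))
  map_o := by
    rintro (a | ⟨c, _ | _⟩)
    · exact congrArg Sum.inl (f.map_o a)
    · exact congrArg Sum.inl (f.map_o c)
    · rfl
  map_rev := by
    rintro (a | c)
    · exact congrArg Sum.inl (Subtype.ext (f.map_rev a))
    · rfl

/-- The arcs `a` with `a = ā`. -/
def selfRev (Y : RGraph.{u, v}) : Set Y.A := {a | Y.rev a = a}

/-- The reversal-free subdivision `Γⁱ` of a graph: every arc `a = ā` is subdivided. -/
abbrev graphSubdiv (Y : RGraph.{u, v}) : RGraph.{max u v, v} :=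
  subdiv Y (selfRev Y) (fun a ha => congrArg Y.rev (ha : Y.rev a = a))

variable {G : Type w} [Group G] {T : RGraph.{u, v}}

/-- The arcs `a` such that `ā` lies in the orbit of `a`. -/
def reversed (ρ : G →* Aut T) : Set T.A := {a | ∃ g, (ρ g).A a = T.rev a}

theorem reversed_rev (ρ : G →* Aut T) : ∀ a ∈ reversed ρ, T.rev a ∈ reversed ρ := by
  rintro a ⟨g, hg⟩
  exact ⟨g, by rw [(ρ g).map_rev, hg]⟩

theorem reversed_iff (ρ : G →* Aut T) (g : G) (a : T.A) :
    (ρ g).A a ∈ reversed ρ ↔ a ∈ reversed ρ := by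
  have key : ∀ (h : G) (b : T.A), b ∈ reversed ρ → (ρ h).A b ∈ reversed ρ := by
    rintro h b ⟨k, hk⟩
    refine ⟨h * k * h⁻¹, ?_⟩
    rw [← Aut.mul_A, ← map_mul, inv_mul_cancel_right, map_mul, Aut.mul_A, hk, (ρ h).map_rev]
  refine ⟨fun h => ?_, key g a⟩
  have := key g⁻¹ _ h
  rwa [← Aut.mul_A, ← map_mul, inv_mul_cancel, map_one] at this

/-- The reversal-free subdivision `Tⁱ` of an action `(T, G)`. -/
abbrev actSubdiv (ρ : G →* Aut T) : RGraph.{max u v, v} := subdiv T (reversed ρ) (reversed_rev ρ)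

/-- The action of `G` on the reversal-free subdivision. -/
def subdivAction (ρ : G →* Aut T) : G →* Aut (actSubdiv ρ) := by
  let F : G → Hom (actSubdiv ρ) (actSubdiv ρ) := fun g =>
    subdivHom (reversed_rev ρ) (reversed_rev ρ) (ρ g).toHom (reversed_iff ρ g)
  have hM : ∀ g h a, (ρ (g * h)).A a = (ρ g).A ((ρ h).A a) := fun g h a => by simp
  have hO : ∀ a, (ρ 1).A a = a := fun a => by simp
  have hV : ∀ g h p, (F (g * h)).V p = (F g).V ((F h).V p) := by
    rintro g h (p | a)
    · exact congrArg Sum.inl (by simp [Iso.toHom])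
    · induction a using Quotient.inductionOn with
      | _ a =>
        exact congrArg (fun z => Sum.inr (Quotient.mk (revSetoid T (reversed ρ)) z))
          (Subtype.ext (hM g h a))
  have hA : ∀ g h p, (F (g * h)).A p = (F g).A ((F h).A p) := by
    rintro g h (p | ⟨a, b⟩)
    · exact congrArg Sum.inl (Subtype.ext (hM g h p))
    · exact congrArg (fun z : reversed ρ => Sum.inr (z, b)) (Subtype.ext (hM g h a))
  have hV1 : ∀ p, (F 1).V p = p := by
    rintro (p | a)
    · exact congrArg Sum.inl (by simp [Iso.toHom])
    · induction a using Quotient.inductionOn with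
      | _ a =>
        exact congrArg (fun z => Sum.inr (Quotient.mk (revSetoid T (reversed ρ)) z))
          (Subtype.ext (hO a))
  have hA1 : ∀ p, (F 1).A p = p := by
    rintro (p | ⟨a, b⟩)
    · exact congrArg Sum.inl (Subtype.ext (hO p))
    · exact congrArg (fun z : reversed ρ => Sum.inr (z, b))
        (Subtype.ext (hO a))
  exact
    { toFun := fun g =>
        { V := ⟨(F g).V, (F g⁻¹).V, fun p => by rw [← hV, inv_mul_cancel, hV1],
            fun p => by rw [← hV, mul_inv_cancel, hV1]⟩
          A := ⟨(F g).A, (F g⁻¹).A, fun p => by rw [← hA, inv_mul_cancel, hA1],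
            fun p => by rw [← hA, mul_inv_cancel, hA1]⟩
          map_o := (F g).map_o
          map_rev := (F g).map_rev }
      map_one' := Iso.ext (Equiv.ext hV1) (Equiv.ext hA1)
      map_mul' := fun g h => Iso.ext (Equiv.ext (hV g h)) (Equiv.ext (hA g h)) }

theorem quotMap_selfRev (ρ : G →* Aut T) (a : T.A) :
    (quotMap ρ).A a ∈ selfRev (quot ρ) ↔ a ∈ reversed ρ :=
  ⟨fun h => Quotient.exact (s := aSetoid ρ) (Eq.symm h),
    fun h => (Quotient.sound (s := aSetoid ρ) h : _ = _).symm⟩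

theorem plusToQuot_selfRev (ρ : G →* Aut T) (a : (plusQuot ρ).A) :
    (plusToQuot ρ).A a ∈ selfRev (quot ρ) ↔ a ∈ reversed (quotientAction ρ) := by
  induction a using Quotient.inductionOn with
  | _ a =>
    refine (quotMap_selfRev ρ a).trans ?_
    constructor
    · rintro ⟨g, hg⟩
      exact ⟨(g : G ⧸ plus ρ), congrArg (Quotient.mk _) hg⟩
    · rintro ⟨q, hq⟩
      induction q using QuotientGroup.induction_on with
      | _ g =>
        obtain ⟨k, hk⟩ := Quotient.exact (s := aSetoid (ρ.comp (plus ρ).subtype)) hq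
        exact ⟨k * g, by rw [map_mul, Aut.mul_A]; exact hk⟩

/-- The quotient map `T → Γ = G \ T` on subdivisions, `Tⁱ → Γⁱ`. -/
def subdivQuotMap (ρ : G →* Aut T) : Hom (actSubdiv ρ) (graphSubdiv (quot ρ)) :=
  subdivHom (reversed_rev ρ) _ (quotMap ρ) (quotMap_selfRev ρ)

/-- The natural map `G⁺ \ T → Γ = G \ T` on subdivisions, `(G⁺ \ T)ⁱ → Γⁱ`. -/
def subdivPlusToQuot (ρ : G →* Aut T) :
    Hom (actSubdiv (quotientAction ρ)) (graphSubdiv (quot ρ)) :=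
  subdivHom (reversed_rev (quotientAction ρ)) _ (plusToQuot ρ) (plusToQuot_selfRev ρ)

end Subdivision

/-! ## Graphs of groups -/

/-- The geometric edges `{a, ā}` of a graph. -/
def RGraph.Edge (Y : RGraph.{u, v}) : Type v := Quotient (revSetoid Y Set.univ)

/-- The edge `{a, ā}`. -/
def RGraph.edge (Y : RGraph.{u, v}) (a : Y.A) : Y.Edge := Quotient.mk _ ⟨a, trivial⟩

theorem RGraph.edge_rev (Y : RGraph.{u, v}) (a : Y.A) : Y.edge (Y.rev a) = Y.edge a :=
  Quotient.sound (s := revSetoid Y Set.univ) (Or.inr (Y.rev_rev a).symm)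

/-- A graph of groups: vertex groups, edge groups (one for each geometric edge `e`) and, for each
arc `a` of the edge `e`, an embedding of the group of `e` into the group of the vertex `o(a)`;
its embedding into the group of `t(a) = o(ā)` is the one that belongs to the arc `ā`. -/
structure GraphOfGroups (Y : RGraph.{u, v}) where
  rev_ne : ∀ a, Y.rev a ≠ a
  vertexGroup : Y.V → Type w
  edgeGroup : Y.Edge → Type w'
  [vertexInst : ∀ p, Group (vertexGroup p)]
  [edgeInst : ∀ e, Group (edgeGroup e)]
  emb : ∀ (e : Y.Edge) (a : Y.A), Y.edge a = e → (edgeGroup e →* vertexGroup (Y.o a))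
  emb_injective : ∀ e a h, Function.Injective (emb e a h)

attribute [instance] GraphOfGroups.vertexInst GraphOfGroups.edgeInst

/-- `S` is the set of arcs of a maximal subtree of `Y` (which then contains all vertices). -/
def IsMaximalSubtree (Y : RGraph.{u, v}) (S : Set Y.A) : Prop :=
  ∃ hS : ∀ a ∈ S, Y.rev a ∈ S,
    RGraph.IsTree ⟨Y.V, S, fun a => Y.o a, fun a => ⟨Y.rev a, hS a a.2⟩,
      fun a => Subtype.ext (Y.rev_rev a)⟩

namespace GraphOfGroups

variable {Y : RGraph.{u, v}} (𝒢 : GraphOfGroups.{u, v, w, w'} Y) (S : Set Y.A)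

/-- The free product of the vertex groups and of the free group on letters `s_a`, `a` an arc. -/
abbrev FreeProd := Monoid.Coprod (Monoid.CoprodI 𝒢.vertexGroup) (FreeGroup Y.A)

/-- The inclusion of a vertex group. -/
def preVertex (p : Y.V) : 𝒢.vertexGroup p →* 𝒢.FreeProd :=
  Monoid.Coprod.inl.comp Monoid.CoprodI.of

/-- The letter `s_a`. -/
def preLetter (a : Y.A) : 𝒢.FreeProd := Monoid.Coprod.inr (FreeGroup.of a)

/-- The relators of the fundamental group: `s_a τ_a(g) s_ā τ_ā(g)⁻¹` for `g` in the group of the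
edge `{a, ā}` (where `τ_a` embeds it into the group of `t(a)`), `s_a s_ā`, and `s_a` for `a ∈ S`. -/
def relators : Set 𝒢.FreeProd :=
  {z | ∃ (a : Y.A) (g : 𝒢.edgeGroup (Y.edge a)),
      z = 𝒢.preLetter a * 𝒢.preVertex _ (𝒢.emb _ (Y.rev a) (Y.edge_rev a) g) *
        𝒢.preLetter (Y.rev a) * (𝒢.preVertex _ (𝒢.emb _ a rfl g))⁻¹} ∪
  {z | ∃ a, z = 𝒢.preLetter a * 𝒢.preLetter (Y.rev a)} ∪
  {z | ∃ a ∈ S, z = 𝒢.preLetter a}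

/-- The fundamental group of a graph of groups with respect to a maximal subtree. -/
abbrev Pi1 := 𝒢.FreeProd ⧸ Subgroup.normalClosure (𝒢.relators S)

/-- The map from a vertex group to the fundamental group. -/
def vertexHom (p : Y.V) : 𝒢.vertexGroup p →* 𝒢.Pi1 S :=
  (QuotientGroup.mk' _).comp (𝒢.preVertex p)

/-- The image of `s_a` in the fundamental group. -/
def letter (a : Y.A) : 𝒢.Pi1 S := QuotientGroup.mk' _ (𝒢.preLetter a)

/-- The image of the edge group of `{a, ā}` inside the image of the vertex group of `o(a)`. -/
def edgeSub (a : Y.A) : Subgroup (𝒢.Pi1 S) :=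
  ((𝒢.vertexHom S (Y.o a)).comp (𝒢.emb _ a rfl)).range

theorem letter_mul_rev (a : Y.A) : 𝒢.letter S a * 𝒢.letter S (Y.rev a) = 1 := by
  rw [letter, letter, ← map_mul]
  exact (QuotientGroup.eq_one_iff _).2
    (Subgroup.subset_normalClosure (Or.inl (Or.inr ⟨a, rfl⟩)))

theorem letter_rel (a : Y.A) (g : 𝒢.edgeGroup (Y.edge a)) :
    𝒢.letter S a * 𝒢.vertexHom S _ (𝒢.emb _ (Y.rev a) (Y.edge_rev a) g) *
      𝒢.letter S (Y.rev a) = 𝒢.vertexHom S _ (𝒢.emb _ a rfl g) := by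
  rw [← mul_inv_eq_one]
  exact (QuotientGroup.eq_one_iff _).2
    (Subgroup.subset_normalClosure (Or.inl (Or.inl ⟨a, g, rfl⟩)))

theorem mem_edgeSub (e : Y.Edge) (a : Y.A) (h : Y.edge a = e) (g : 𝒢.edgeGroup e) :
    𝒢.vertexHom S _ (𝒢.emb e a h g) ∈ 𝒢.edgeSub S a := by
  subst h
  exact ⟨g, rfl⟩

theorem mk_arc_congr {a b : Y.A} (h : a = b) (z : 𝒢.Pi1 S) :
    (⟨a, (z : 𝒢.Pi1 S ⧸ 𝒢.edgeSub S a)⟩ : Σ a, 𝒢.Pi1 S ⧸ 𝒢.edgeSub S a) =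
      ⟨b, (z : 𝒢.Pi1 S ⧸ 𝒢.edgeSub S b)⟩ := by
  subst h; rfl

/-- The Bass–Serre tree: vertices and arcs are the left cosets of the vertex groups and of the
edge groups. The arc `gE_a` over `a` goes from `gG_{o(a)}` to `g s_a G_{t(a)}`, and its reverse is
`g s_a E_ā` over `ā`. -/
def bassSerre : RGraph.{max u v w, max u v w} where
  V := Σ p, 𝒢.Pi1 S ⧸ (𝒢.vertexHom S p).range
  A := Σ a, 𝒢.Pi1 S ⧸ 𝒢.edgeSub S a
  o c := ⟨Y.o c.1, Quotient.map' id (by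
    intro z y h
    rw [QuotientGroup.leftRel_apply] at h ⊢
    obtain ⟨g, hg⟩ := h
    exact ⟨_, hg⟩) c.2⟩
  rev c := ⟨Y.rev c.1, Quotient.map' (fun z => z * 𝒢.letter S c.1) (by
    intro z y h
    rw [QuotientGroup.leftRel_apply] at h ⊢
    obtain ⟨g, hg⟩ := h
    have h1 : (z * 𝒢.letter S c.1)⁻¹ * (y * 𝒢.letter S c.1) =
        𝒢.vertexHom S _ (𝒢.emb _ (Y.rev c.1) (Y.edge_rev c.1) g) := by
      have h2 := 𝒢.letter_rel S c.1 g
      have h3 : z⁻¹ * y = 𝒢.vertexHom S _ (𝒢.emb _ c.1 rfl g) := hg.symm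
      have h4 : 𝒢.letter S (Y.rev c.1) = (𝒢.letter S c.1)⁻¹ :=
        (inv_eq_of_mul_eq_one_right (𝒢.letter_mul_rev S c.1)).symm
      rw [mul_inv_rev, mul_assoc, ← mul_assoc z⁻¹, h3, ← h2, h4]
      group
    rw [h1]
    exact 𝒢.mem_edgeSub S _ _ _ _) c.2⟩
  rev_rev := by
    rintro ⟨a, ⟨z⟩⟩
    refine (𝒢.mk_arc_congr S (Y.rev_rev a) (z * 𝒢.letter S a * 𝒢.letter S (Y.rev a))).trans ?_
    rw [mul_assoc, letter_mul_rev, mul_one]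
    rfl

/-- The action of the fundamental group on the Bass–Serre tree by left multiplication. -/
def bassSerreAction : 𝒢.Pi1 S →* Aut (𝒢.bassSerre S) where
  toFun g :=
    { V := Equiv.sigmaCongrRight fun _ => MulAction.toPerm g
      A := Equiv.sigmaCongrRight fun _ => MulAction.toPerm g
      map_o := by
        rintro ⟨a, ⟨z⟩⟩
        rfl
      map_rev := by
        rintro ⟨a, ⟨z⟩⟩
        exact congrArg (fun y : 𝒢.Pi1 S =>
          (⟨Y.rev a, (y : 𝒢.Pi1 S ⧸ 𝒢.edgeSub S (Y.rev a))⟩ :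
            Σ a, 𝒢.Pi1 S ⧸ 𝒢.edgeSub S a)) (mul_assoc g z (𝒢.letter S a)).symm }
  map_one' := by
    apply Iso.ext
    · ext ⟨a, z⟩ : 1
      exact congrArg (Sigma.mk a) (one_smul (𝒢.Pi1 S) z : (1 : 𝒢.Pi1 S) • z = z)
    · ext ⟨a, z⟩ : 1
      exact congrArg (Sigma.mk a) (one_smul (𝒢.Pi1 S) z : (1 : 𝒢.Pi1 S) • z = z)
  map_mul' g h := by
    apply Iso.ext
    · ext ⟨a, z⟩ : 1
      exact congrArg (Sigma.mk a) (mul_smul g h z : (g * h) • z = g • h • z)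
    · ext ⟨a, z⟩ : 1
      exact congrArg (Sigma.mk a) (mul_smul g h z : (g * h) • z = g • h • z)

/-- The projection of the Bass–Serre tree to `Y`. -/
def bassSerreProj : Hom (𝒢.bassSerre S) Y where
  V c := c.1
  A c := c.1
  map_o _ := rfl
  map_rev _ := rfl

end GraphOfGroups

/-- The vertex groups of the graph of groups over `Γⁱ` given by a diagram over `Γ`: the group
`G(v)` at a vertex `v` of `Γ`, and the cyclic group of order two at the new vertices. -/
def Diagram.vertexGroup (D : Diagram.{u, v, w}) : (graphSubdiv D.Γ).V → Type w
  | Sum.inl p => D.G p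
  | Sum.inr _ => ULift.{w} (Multiplicative (ZMod 2))

instance (D : Diagram.{u, v, w}) : ∀ p, Group (D.vertexGroup p)
  | Sum.inl p => inferInstanceAs (Group (D.G p))
  | Sum.inr _ => inferInstanceAs (Group (ULift.{w} (Multiplicative (ZMod 2))))

/-- The graph of groups over `Γⁱ` with these vertex groups and with trivial edge groups. -/
def Diagram.graphOfGroups (D : Diagram.{u, v, w}) :
    GraphOfGroups.{max u v, v, w, 0} (graphSubdiv D.Γ) where
  rev_ne := by
    rintro (a | ⟨c, _ | _⟩) h
    · exact a.2 (congrArg Subtype.val (Sum.inl_injective h))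
    · exact Bool.noConfusion (congrArg Prod.snd (Sum.inr_injective h))
    · exact Bool.noConfusion (congrArg Prod.snd (Sum.inr_injective h))
  vertexGroup := D.vertexGroup
  edgeGroup _ := PUnit
  emb _ _ _ := 1
  emb_injective _ _ _ _ _ _ := rfl

end TreeAction

open TreeAction TreeAction.RGraph

/-!
Write `T₁ = G⁺ \ T` and `K = G / G⁺`. The argument rests on two properties of trees: they are simply
connected, in the sense that data that can be transported along arcs can be chosen coherently at all
vertices (`IsTree.exists_section`), and every covering of a tree by a connected graph is an
isomorphism (`exists_iso_of_covering`).

*The quotient action.* An orbit of edges cuts the vertices of `T` into two classes. An element of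
`G⁺` that fixes an arc preserves the classes if the orbit is one of `G⁺`; hence `G⁺` preserves them,
every edge of `T₁` separates it, and `T₁` is a tree (`plusQuot_isTree`). If `g` fixes an arc of
`T₁`, then some element of `g G⁺` fixes an arc of `T`, so `K` is free on arcs. Freeness implies
P-closedness, as the elements by which a member of the P-closure is approximated at neighbouring
vertices agree on an arc and so are equal (`isPClosed_range_of_free`). The same reasoning shows that
each element of the P-closure of `G` acts on `T₁` as an element of `K`, which gives the invariance
under P-closure (`exists_actionIso_pClosure`).

*The diagram is `Δ*`.* It must be shown that the stabilizer of `v` in `G⁺` acts on `o⁻¹(v)` as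
`G(v)⁺`, not as a larger group. The action of `G` on the quotients of the stars by the groups
`G(v)⁺` is a cocycle `c(g, v)` with values in a permutation group of `X_v*` that is trivial whenever
`g` fixes an arc at `v`. Simple connectedness makes it a coboundary on `G⁺`, so it vanishes on the
vertex stabilizers of `G⁺` (`cocycle_eq_one`), and the diagram of `K` is `Δ*`
(`exists_diagramIso_quotientAction`). Since `G(v)` and its closure have the same orbits of pairs of
points, they have the same `Δ*` (`DiagramIso.exists_star_closure`).

*Rigidity.* Given an isomorphism of diagrams between a faithful action and a faithful action free on
arcs, the colour bijections, conjugated by group elements, give local charts between the two trees.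
A coherent choice of charts is a covering, hence an isomorphism of trees, and freeness makes it
equivariant (`nonempty_actionIso_of_diagramIso`). As the groups of `Δ*` are semiregular, they are
closed, and every faithful action with diagram `Δ*` is free on arcs; this yields the statements of
uniqueness.

*Bass–Serre theory.* Let a group act on a tree freely on arcs, with quotient `Y`. Lift a maximal
subtree `S` of `Y` and choose elements that translate the ends of the remaining arcs. This defines a
homomorphism from the fundamental group of the graph of vertex stabilizers over `Y` and an
equivariant map from its Bass–Serre graph to the tree. The map is a covering by a connected graph,
hence an isomorphism (`exists_actionIso_bassSerre`). Part (ii) is the case of the reversal-free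
subdivision of `T₁`, on which `K` is free on arcs as well; its vertex stabilizers are the groups
`G*(v)` at old vertices (`exists_hom_stabilizer`) and have order two at midpoints
(`exists_hom_stabilizer_midpoint`).
-/

universe u₁ v₁ w₁ u₂ v₂ w₂ u₃ v₃ w₃

/-! ### Trees and connected graphs -/

namespace TreeAction

namespace RGraph

theorem o_rev (Y : RGraph.{u, v}) (a : Y.A) : Y.o (Y.rev a) = Y.t a := rfl

@[simp] theorem t_rev (Y : RGraph.{u, v}) (a : Y.A) : Y.t (Y.rev a) = Y.o a := by
  rw [t, Y.rev_rev]

theorem Hom.map_t {Y : RGraph.{u, v}} {Z : RGraph.{u', v'}} (f : Hom Y Z) (a : Y.A) :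
    f.V (Y.t a) = Z.t (f.A a) := by rw [t, t, f.map_o, f.map_rev]

theorem reachable_o_t (Y : RGraph.{u, v}) (a : Y.A) :
    Y.toSimple.Reachable (Y.o a) (Y.t a) := by
  by_cases h : Y.o a = Y.t a
  · rw [h]
  · exact SimpleGraph.Adj.reachable ⟨h, a, rfl, rfl⟩

theorem IsConnected.arc_induction {Y : RGraph.{u, v}} (hY : Y.IsConnected) {Q : Y.V → Prop}
    {p : Y.V} (h0 : Q p) (step : ∀ a, Q (Y.o a) → Q (Y.t a)) (q : Y.V) : Q q := by
  obtain ⟨W⟩ := (show Y.toSimple.Connected from hY).preconnected p q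
  induction W with
  | nil => exact h0
  | cons h W ih =>
    obtain ⟨_, a, rfl, rfl⟩ := h
    exact ih (step a h0)

theorem IsConnected.subsingleton {Y : RGraph.{u, v}} [IsEmpty Y.A]
    (hY : Y.IsConnected) (p q : Y.V) : p = q :=
  (hY.arc_induction (Q := fun q => p = q) (p := p) rfl (fun a => isEmptyElim a) q)

/-- In a connected graph with an arc, every vertex is the origin of an arc. -/
theorem IsConnected.exists_arc {Y : RGraph.{u, v}} [h : Nonempty Y.A]
    (hY : Y.IsConnected) (p : Y.V) : ∃ a, Y.o a = p := by
  obtain ⟨a⟩ := h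
  exact hY.arc_induction (Q := fun p => ∃ a, Y.o a = p) (p := Y.o a) ⟨a, rfl⟩
    (fun a _ => ⟨Y.rev a, rfl⟩) p

theorem IsTree.isConnected {Y : RGraph.{u, v}} (hY : Y.IsTree) : Y.IsConnected :=
  hY.tree.connected

theorem IsTree.rev_ne {Y : RGraph.{u, v}} (hY : Y.IsTree) (a : Y.A) : Y.rev a ≠ a :=
  fun h => hY.no_loop a (by rw [t, h])

theorem IsTree.adj {Y : RGraph.{u, v}} (hY : Y.IsTree) (a : Y.A) :
    Y.toSimple.Adj (Y.o a) (Y.t a) := ⟨hY.no_loop a, a, rfl, rfl⟩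

theorem IsTree.dist_cases {Y : RGraph.{u, v}} (hY : Y.IsTree) (r : Y.V) (a : Y.A) :
    Y.toSimple.dist r (Y.o a) = Y.toSimple.dist r (Y.t a) + 1 ∨
      Y.toSimple.dist r (Y.t a) = Y.toSimple.dist r (Y.o a) + 1 :=
  hY.tree.dist_eq_dist_add_one_of_adj r (hY.adj a)

/-- At most one arc at a vertex of a tree leads towards a given vertex `r`. -/
theorem IsTree.eq_of_dist {Y : RGraph.{u, v}} (hY : Y.IsTree) (r : Y.V) {a b : Y.A}
    (hab : Y.o a = Y.o b) (ha : Y.toSimple.dist r (Y.o a) = Y.toSimple.dist r (Y.t a) + 1)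
    (hb : Y.toSimple.dist r (Y.o b) = Y.toSimple.dist r (Y.t b) + 1) : a = b := by
  refine hY.arc_ext a b hab ?_
  have key : ∀ c, Y.o c = Y.o a → Y.toSimple.dist r (Y.o c) = Y.toSimple.dist r (Y.t c) + 1 →
      ∃ W : Y.toSimple.Walk (Y.o a) r, W.IsPath ∧ W.snd = Y.t c := by
    intro c hc h
    obtain ⟨W, hW⟩ := hY.tree.connected.exists_walk_length_eq_dist (Y.t c) r
    refine ⟨SimpleGraph.Walk.cons (hc ▸ hY.adj c) W, ?_, by simp⟩
    apply SimpleGraph.Walk.isPath_of_length_eq_dist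
    rw [SimpleGraph.Walk.length_cons, hW, SimpleGraph.dist_comm, ← h, hc, SimpleGraph.dist_comm]
  obtain ⟨W, hW, h1⟩ := key a rfl ha
  obtain ⟨W', hW', h2⟩ := key b hab.symm hb
  rw [← h1, ← h2, (hY.tree.existsUnique_path _ _).unique hW hW']

theorem IsConnected.exists_arc_dist {Y : RGraph.{u, v}} (hY : Y.IsConnected) (r p : Y.V)
    (h : p ≠ r) : ∃ a, Y.t a = p ∧ Y.toSimple.dist r p = Y.toSimple.dist r (Y.o a) + 1 := by
  have hY' : Y.toSimple.Connected := hY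
  obtain ⟨W, hW⟩ := hY'.exists_walk_length_eq_dist p r
  cases W with
  | nil => exact absurd rfl h
  | @cons _ q _ hq W =>
    obtain ⟨a, rfl, rfl⟩ := hq.2
    refine ⟨Y.rev a, Y.t_rev a, ?_⟩
    rw [SimpleGraph.Walk.length_cons, SimpleGraph.dist_comm] at hW
    have h1 := SimpleGraph.dist_le W
    have h2 := hY'.dist_triangle (u := r) (v := Y.t a) (w := Y.o a)
    have h3 : Y.toSimple.dist (Y.t a) (Y.o a) ≤ 1 := by
      rw [SimpleGraph.dist_comm]
      exact SimpleGraph.dist_le (SimpleGraph.Walk.cons hq SimpleGraph.Walk.nil)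
    rw [SimpleGraph.dist_comm] at h1
    rw [o_rev]
    omega

/-- Trees are simply connected: local data that can be transported along every arc can be chosen
coherently on all of the tree. Here `P p x` says that `x` is an admissible value at the vertex
`p`, and `R a x y` that the values `x` at `o a` and `y` at `t a` correspond to each other. -/
theorem IsTree.exists_section {Y : RGraph.{u, v}} (hY : Y.IsTree) {X : Type x}
    (P : Y.V → X → Prop) (R : Y.A → X → X → Prop)
    (hR : ∀ a x y, R a x y → R (Y.rev a) y x)
    (hP : ∀ a x, P (Y.o a) x → ∃ y, P (Y.t a) y ∧ R a x y)
    {r : Y.V} {x₀ : X} (h0 : P r x₀) :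
    ∃ F : Y.V → X, F r = x₀ ∧ (∀ p, P p (F p)) ∧ ∀ a, R a (F (Y.o a)) (F (Y.t a)) := by
  classical
  have hpar : ∀ p, ∃ a : Option Y.A, p ≠ r → ∃ b, a = some b ∧ Y.t b = p ∧
      Y.toSimple.dist r p = Y.toSimple.dist r (Y.o b) + 1 := by
    intro p
    by_cases h : p = r
    · exact ⟨none, fun h' => absurd h h'⟩
    · obtain ⟨b, hb⟩ := hY.isConnected.exists_arc_dist r p h
      exact ⟨some b, fun _ => ⟨b, rfl, hb⟩⟩
  choose par hpar using hpar
  have hnext : ∀ a x, ∃ y, P (Y.o a) x → P (Y.t a) y ∧ R a x y := by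
    intro a x
    by_cases h : P (Y.o a) x
    · obtain ⟨y, hy⟩ := hP a x h
      exact ⟨y, fun _ => hy⟩
    · exact ⟨x, fun h' => absurd h' h⟩
  choose next hnext using hnext
  let F' : ℕ → Y.V → X := fun n => Nat.rec (fun _ => x₀)
    (fun _ f p => match par p with
      | none => x₀
      | some b => next b (f (Y.o b))) n
  let F : Y.V → X := fun p => F' (Y.toSimple.dist r p) p
  have hF0 : F r = x₀ := by
    show F' (Y.toSimple.dist r r) r = x₀
    rw [SimpleGraph.dist_self]
    rfl
  -- the value at `t b` is transported along `b` if `b` leads away from `r`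
  have hFs : ∀ b, Y.toSimple.dist r (Y.t b) = Y.toSimple.dist r (Y.o b) + 1 →
      F (Y.t b) = next b (F (Y.o b)) := by
    intro b hb
    have hne : Y.t b ≠ r := by
      intro h
      rw [h, SimpleGraph.dist_self] at hb
      omega
    obtain ⟨c, hc, h1, h2⟩ := hpar _ hne
    have hcb : c = b := by
      have : Y.rev c = Y.rev b := hY.eq_of_dist r (by rw [o_rev, o_rev, h1])
        (by rw [o_rev, t_rev, h1, h2]) (by rw [o_rev, t_rev, hb])
      rw [← Y.rev_rev c, this, Y.rev_rev]
    subst hcb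
    show F' (Y.toSimple.dist r (Y.t c)) (Y.t c) = next c (F' (Y.toSimple.dist r (Y.o c)) (Y.o c))
    rw [hb]
    show (match par (Y.t c) with
      | none => x₀
      | some b => next b (F' (Y.toSimple.dist r (Y.o c)) (Y.o b))) = _
    rw [hc]
  have hFP : ∀ n p, Y.toSimple.dist r p = n → P p (F p) := by
    intro n
    induction n with
    | zero =>
      intro p hp
      rw [hY.tree.connected.dist_eq_zero_iff] at hp
      subst hp
      rw [hF0]
      exact h0
    | succ n ih =>
      intro p hp
      have hne : p ≠ r := by
        rintro rfl
        rw [SimpleGraph.dist_self] at hp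
        omega
      obtain ⟨b, rfl, hb⟩ := hY.isConnected.exists_arc_dist r p hne
      rw [hFs b hb]
      exact (hnext b _ (ih _ (by omega))).1
  refine ⟨F, hF0, fun p => hFP _ p rfl, fun a => ?_⟩
  rcases hY.dist_cases r a with h | h
  · have h1 := hFs (Y.rev a) (by rw [t_rev, o_rev, h])
    have h2 := (hnext (Y.rev a) _ (hFP _ _ rfl)).2
    rw [← h1] at h2
    have h3 := hR _ _ _ h2
    rwa [Y.rev_rev, t_rev, o_rev] at h3
  · rw [hFs a h]
    exact (hnext a _ (hFP _ _ rfl)).2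

/-- For every reversal-invariant set `E` of arcs of a tree there is a two-colouring of the vertices
such that the arcs joining vertices of different colours are those in `E`. -/
theorem IsTree.exists_cut {Y : RGraph.{u, v}} (hY : Y.IsTree) (E : Set Y.A)
    (hE : ∀ a ∈ E, Y.rev a ∈ E) :
    ∃ φ : Y.V → Bool, ∀ b, φ (Y.o b) ≠ φ (Y.t b) ↔ b ∈ E := by
  classical
  obtain ⟨r⟩ := hY.tree.connected.nonempty
  have hE' : ∀ a, Y.rev a ∈ E ↔ a ∈ E :=
    fun a => ⟨fun h => by have := hE _ h; rwa [Y.rev_rev] at this, hE a⟩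
  obtain ⟨F, -, -, hF⟩ := hY.exists_section (fun _ (_ : Bool) => True)
    (fun a x y => x ≠ y ↔ a ∈ E) (fun a x y h => by rw [hE', ← h, ne_comm])
    (fun a x _ => by
      by_cases h : a ∈ E
      · exact ⟨!x, trivial, by simp [h]⟩
      · exact ⟨x, trivial, by simp [h]⟩) (r := r) (x₀ := true) trivial
  exact ⟨F, hF⟩

/-- A connected graph is a tree if each of its edges separates it. -/
theorem isTree_of_cut {Y : RGraph.{u, v}} (hY : Y.IsConnected)
    (h : ∀ a, ∃ φ : Y.V → Bool, φ (Y.o a) ≠ φ (Y.t a) ∧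
      ∀ b, φ (Y.o b) ≠ φ (Y.t b) → b = a ∨ b = Y.rev a) : Y.IsTree where
  arc_ext a b h1 h2 := by
    obtain ⟨φ, h3, h4⟩ := h a
    rcases h4 b (by rwa [← h1, ← h2]) with h5 | h5
    · exact h5.symm
    · refine absurd ?_ h3
      rw [h1, h5, o_rev]
  no_loop a h' := by
    obtain ⟨φ, h3, h4⟩ := h a
    exact h3 (congrArg φ h')
  tree := by
    refine ⟨hY, ?_⟩
    rw [SimpleGraph.isAcyclic_iff_forall_adj_isBridge]
    rintro p q ⟨hne, a, rfl, rfl⟩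
    obtain ⟨φ, h3, h4⟩ := h a
    rw [SimpleGraph.isBridge_iff]
    rintro ⟨W⟩
    have key : ∀ {p q : Y.V}
        (W : (Y.toSimple.deleteEdges {s(Y.o a, Y.t a)}).Walk p q), φ p = φ q := by
      intro p q W
      induction W with
      | nil => rfl
      | cons h W ih =>
        rw [← ih]
        by_contra hne
        rw [SimpleGraph.deleteEdges_adj] at h
        obtain ⟨⟨_, b, rfl, rfl⟩, h⟩ := h
        refine h ?_
        rcases h4 b hne with rfl | rfl
        · simp
        · rw [o_rev, t_rev, Sym2.eq_swap]
          simp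
    exact h3 (key W)

/-- A covering of a tree by a connected graph is an isomorphism. -/
theorem exists_iso_of_covering {Y : RGraph.{u, v}} {Z : RGraph.{u', v'}} (hY : Y.IsConnected)
    (hZ : Z.IsTree) (f : Hom Y Z)
    (hinj : ∀ a b, Y.o a = Y.o b → f.A a = f.A b → a = b)
    (hsurj : ∀ p d, Z.o d = f.V p → ∃ a, Y.o a = p ∧ f.A a = d) :
    ∃ e : Iso Y Z, (∀ p, e.V p = f.V p) ∧ ∀ a, e.A a = f.A a := by
  have hY' : Y.toSimple.Connected := hY
  obtain ⟨r₀⟩ := hY'.nonempty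
  -- a locally injective map preserves distances, as reduced paths in a tree are geodesics
  have hdist : ∀ r n p, Y.toSimple.dist r p = n → Z.toSimple.dist (f.V r) (f.V p) = n := by
    intro r n
    induction n using Nat.strong_induction_on with
    | _ n ih =>
    intro p hp
    by_cases hne : p = r
    · subst hne
      rw [SimpleGraph.dist_self] at hp ⊢
      exact hp
    obtain ⟨a, rfl, ha⟩ := hY.exists_arc_dist r p hne
    have h1 := ih _ (by omega) (Y.o a) rfl
    rw [f.map_t]
    rw [f.map_o] at h1
    rcases hZ.dist_cases (f.V r) (f.A a) with h | h
    · -- otherwise `a` backtracks along the last arc of a geodesic to `o a`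
      have hne' : Y.o a ≠ r := by
        intro h'
        rw [← f.map_o, h', SimpleGraph.dist_self] at h
        omega
      obtain ⟨b, hb, hb'⟩ := hY.exists_arc_dist r _ hne'
      have h2 := ih _ (by omega) (Y.o b) rfl
      rw [f.map_o] at h2
      have h3 : f.A a = f.A (Y.rev b) := by
        have h4 : Z.o (f.A a) = Z.o (f.A (Y.rev b)) := by rw [← f.map_o, ← f.map_o, o_rev, hb]
        refine hZ.eq_of_dist (f.V r) h4 h ?_
        rw [← h4, f.map_rev, t_rev]
        omega
      have h5 := hinj a (Y.rev b) (by rw [o_rev, hb]) h3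
      rw [h5, t_rev] at ha hp
      omega
    · omega
  have hVinj : Function.Injective f.V := by
    intro p q h
    have := hdist p _ q rfl
    rw [h, SimpleGraph.dist_self] at this
    exact hY'.dist_eq_zero_iff.1 this.symm
  have hVsurj : Function.Surjective f.V :=
    hZ.isConnected.arc_induction (Q := fun z => ∃ p, f.V p = z) (p := f.V r₀) ⟨r₀, rfl⟩ (by
      rintro d ⟨p, hp⟩
      obtain ⟨a, -, rfl⟩ := hsurj p d hp.symm
      exact ⟨Y.t a, f.map_t a⟩)
  have hAinj : Function.Injective f.A := fun a b h =>
    hinj a b (hVinj (by rw [f.map_o, f.map_o, h])) h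
  have hAsurj : Function.Surjective f.A := fun d => by
    obtain ⟨p, hp⟩ := hVsurj (Z.o d)
    obtain ⟨a, -, ha⟩ := hsurj p d hp.symm
    exact ⟨a, ha⟩
  exact ⟨⟨Equiv.ofBijective _ ⟨hVinj, hVsurj⟩, Equiv.ofBijective _ ⟨hAinj, hAsurj⟩,
    f.map_o, f.map_rev⟩, fun _ => rfl, fun _ => rfl⟩

end RGraph

end TreeAction

/-! ### Quotients by groups generated by arc stabilizers -/

namespace TreeAction

/-- A property of arcs that is preserved by reversal and by passing to arcs with the same origin
holds for all arcs of a connected graph if it holds for one. -/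
theorem RGraph.IsConnected.forall_arc {Y : RGraph.{u, v}} (hY : Y.IsConnected) {Q : Y.A → Prop}
    {a₀ : Y.A} (h0 : Q a₀) (hrev : ∀ a, Q a → Q (Y.rev a))
    (hstar : ∀ a b, Y.o a = Y.o b → Q a → Q b) (a : Y.A) : Q a :=
  hY.arc_induction (Q := fun p => ∀ a, Y.o a = p → Q a) (p := Y.o a₀)
    (fun a h => hstar a₀ a h.symm h0)
    (fun b hb a h => hstar (Y.rev b) a (by rw [o_rev, h]) (hrev b (hb b rfl))) _ a rfl

theorem RGraph.Iso.ext_of_arcs {Y : RGraph.{u, v}} {Z : RGraph.{u', v'}} (hY : Y.IsConnected)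
    {f g : Iso Y Z} (h : ∀ a, f.A a = g.A a) : f = g := by
  refine Iso.ext (Equiv.ext fun p => ?_) (Equiv.ext h)
  rcases isEmpty_or_nonempty Y.A with h' | h'
  · apply f.V.symm.injective
    exact hY.subsingleton _ _
  · obtain ⟨a, rfl⟩ := hY.exists_arc p
    rw [f.map_o, g.map_o, h]

variable {G : Type w} [Group G] {T : RGraph.{u, v}}

theorem map_inv_V (ρ : G →* Aut T) (g : G) (p : T.V) : (ρ g⁻¹).V ((ρ g).V p) = p := by
  rw [← Aut.mul_V, ← map_mul]; simp

theorem map_inv_V_eq (ρ : G →* Aut T) {g : G} {p q : T.V} (h : (ρ g).V p = q) :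
    (ρ g⁻¹).V q = p := by rw [← h, map_inv_V]

theorem map_inv_A (ρ : G →* Aut T) (g : G) (a : T.A) : (ρ g⁻¹).A ((ρ g).A a) = a := by
  rw [← Aut.mul_A, ← map_mul]; simp

theorem map_V_inv (ρ : G →* Aut T) (g : G) (p : T.V) : (ρ g).V ((ρ g⁻¹).V p) = p := by
  rw [← Aut.mul_V, ← map_mul]; simp

theorem map_A_inv (ρ : G →* Aut T) (g : G) (a : T.A) : (ρ g).A ((ρ g⁻¹).A a) = a := by
  rw [← Aut.mul_A, ← map_mul]; simp

theorem quotMap_V_eq (ρ : G →* Aut T) {p q : T.V} :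
    (quotMap ρ).V p = (quotMap ρ).V q ↔ ∃ g, (ρ g).V p = q :=
  ⟨fun h => Quotient.exact (s := vSetoid ρ) h, fun h => Quotient.sound (s := vSetoid ρ) h⟩

theorem quotMap_A_eq (ρ : G →* Aut T) {a b : T.A} :
    (quotMap ρ).A a = (quotMap ρ).A b ↔ ∃ g, (ρ g).A a = b :=
  ⟨fun h => Quotient.exact (s := aSetoid ρ) h, fun h => Quotient.sound (s := aSetoid ρ) h⟩

theorem quotMap_V_surjective (ρ : G →* Aut T) : Function.Surjective (quotMap ρ).V :=
  Quotient.mk_surjective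

theorem quotMap_A_surjective (ρ : G →* Aut T) : Function.Surjective (quotMap ρ).A :=
  Quotient.mk_surjective

theorem quotMap_V_map (ρ : G →* Aut T) (g : G) (p : T.V) :
    (quotMap ρ).V ((ρ g).V p) = (quotMap ρ).V p :=
  ((quotMap_V_eq ρ).2 ⟨g, rfl⟩).symm

theorem quotMap_A_map (ρ : G →* Aut T) (g : G) (a : T.A) :
    (quotMap ρ).A ((ρ g).A a) = (quotMap ρ).A a :=
  ((quotMap_A_eq ρ).2 ⟨g, rfl⟩).symm

theorem plusMap_V_eq (ρ : G →* Aut T) {p q : T.V} :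
    (plusMap ρ).V p = (plusMap ρ).V q ↔ ∃ k ∈ plus ρ, (ρ k).V p = q :=
  (quotMap_V_eq _).trans ⟨fun ⟨k, h⟩ => ⟨k, k.2, h⟩, fun ⟨k, hk, h⟩ => ⟨⟨k, hk⟩, h⟩⟩

theorem plusMap_A_eq (ρ : G →* Aut T) {a b : T.A} :
    (plusMap ρ).A a = (plusMap ρ).A b ↔ ∃ k ∈ plus ρ, (ρ k).A a = b :=
  (quotMap_A_eq _).trans ⟨fun ⟨k, h⟩ => ⟨k, k.2, h⟩, fun ⟨k, hk, h⟩ => ⟨⟨k, hk⟩, h⟩⟩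

theorem mem_plus_of_fix (ρ : G →* Aut T) {g : G} {a : T.A} (h : (ρ g).A a = a) : g ∈ plus ρ :=
  Subgroup.subset_closure ⟨a, h⟩

theorem quotientAction_V (ρ : G →* Aut T) (g : G) (p : T.V) :
    (quotientAction ρ (QuotientGroup.mk g)).V ((plusMap ρ).V p) = (plusMap ρ).V ((ρ g).V p) := rfl

theorem quotientAction_A (ρ : G →* Aut T) (g : G) (a : T.A) :
    (quotientAction ρ (QuotientGroup.mk g)).A ((plusMap ρ).A a) = (plusMap ρ).A ((ρ g).A a) := rfl

/-- The edges in a `G⁺`-orbit cut the vertices of a tree into two colour classes. An element of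
`G⁺` that fixes an arc preserves the colour of a vertex, hence both classes, so that all of `G⁺`
preserves them and every edge of the quotient graph separates it. -/
theorem plusQuot_isTree (hT : T.IsTree) (ρ : G →* Aut T) : (plusQuot ρ).IsTree := by
  refine isTree_of_cut (quot_connected _ hT.isConnected) fun ā => ?_
  obtain ⟨a, rfl⟩ := quotMap_A_surjective _ ā
  let E : Set T.A := {b | (plusMap ρ).A b = (plusMap ρ).A a ∨
    (plusMap ρ).A b = (plusQuot ρ).rev ((plusMap ρ).A a)}
  have hE : ∀ b ∈ E, T.rev b ∈ E := by
    rintro b (hb | hb)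
    · exact Or.inr (by rw [(plusMap ρ).map_rev, hb])
    · exact Or.inl (by rw [(plusMap ρ).map_rev, hb, (plusQuot ρ).rev_rev])
  obtain ⟨φ, hφ⟩ := hT.exists_cut E hE
  have hinv : ∀ k ∈ plus ρ, ∀ p, φ ((ρ k).V p) = φ p := by
    intro k hk
    induction hk using Subgroup.closure_induction with
    | mem k hk =>
      obtain ⟨c, hc⟩ := hk
      refine hT.isConnected.arc_induction (p := T.o c) (by rw [(ρ k).map_o, hc]) fun b hb => ?_
      have h1 := hφ b
      have h2 : _ ↔ b ∈ E := (hφ ((ρ k).A b)).trans (by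
        have : (plusMap ρ).A ((ρ k).A b) = (plusMap ρ).A b :=
          ((plusMap_A_eq ρ).2 ⟨k, mem_plus_of_fix ρ hc, rfl⟩).symm
        show _ ∨ _ ↔ _ ∨ _
        rw [this])
      rw [← (ρ k).map_o, ← (ρ k).map_t, hb, ← h1] at h2
      revert h2
      cases φ (T.o b) <;> cases φ (T.t b) <;> cases φ ((ρ k).V (T.t b)) <;> simp
    | one => simp
    | mul g h _ _ hg hh => intro p; rw [map_mul, Aut.mul_V, hg, hh]
    | inv g _ hg => intro p; rw [← hg, map_V_inv]
  refine ⟨Quotient.lift φ (by rintro p _ ⟨k, rfl⟩; exact (hinv k k.2 p).symm), ?_, ?_⟩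
  · exact (hφ a).2 (Or.inl rfl)
  · intro c hb
    obtain ⟨b, rfl⟩ := quotMap_A_surjective _ c
    exact (hφ b).1 hb

theorem quotientAction_free (ρ : G →* Aut T) : FreeOnArcs (quotientAction ρ) := by
  intro x ā h
  obtain ⟨g, rfl⟩ := QuotientGroup.mk_surjective x
  obtain ⟨a, rfl⟩ := quotMap_A_surjective _ ā
  obtain ⟨k, hk, h⟩ := (plusMap_A_eq ρ).1 h
  rw [← Aut.mul_A, ← map_mul] at h
  exact (QuotientGroup.eq_one_iff g).2 (((plus ρ).mul_mem_cancel_left hk).1 (mem_plus_of_fix ρ h))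

theorem quotientAction_injective (hT : T.IsConnected) (ρ : G →* Aut T)
    (hρ : Function.Injective ρ ∨ Nonempty T.A) : Function.Injective (quotientAction ρ) := by
  rcases isEmpty_or_nonempty T.A with h' | ⟨⟨a⟩⟩
  · rcases hρ with hρ | ⟨⟨a⟩⟩
    · intro x y _
      obtain ⟨g, rfl⟩ := QuotientGroup.mk_surjective x
      obtain ⟨h, rfl⟩ := QuotientGroup.mk_surjective y
      exact congrArg _ (hρ (Iso.ext_of_arcs hT fun a => isEmptyElim a))
    · exact isEmptyElim a
  · rw [injective_iff_map_eq_one]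
    intro x hx
    exact quotientAction_free ρ x ((plusMap ρ).A a) (by rw [hx]; rfl)

/-- An element of the P-closure agrees on any two arcs with the same origin with an element of the
group. -/
theorem exists_of_mem_pClosure (hT : T.IsTree) {H : Subgroup (Aut T)} {g : Aut T}
    (hg : g ∈ pClosure H) {a b : T.A} (hab : T.o a = T.o b) :
    ∃ h ∈ H, h.A a = g.A a ∧ h.A b = g.A b := by
  classical
  obtain ⟨h, hh, hF⟩ := hg (T.o a) {T.o a, T.t a, T.t b} (by
    intro q hq
    simp only [Finset.mem_insert, Finset.mem_singleton] at hq
    rcases hq with rfl | rfl | rfl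
    · exact Or.inl rfl
    · exact Or.inr (hT.adj a)
    · exact Or.inr (hab ▸ hT.adj b))
  refine ⟨h, hh, hT.arc_ext _ _ ?_ ?_, hT.arc_ext _ _ ?_ ?_⟩
  · rw [← h.map_o, ← g.map_o]; exact hF _ (by simp)
  · rw [← h.map_t, ← g.map_t]; exact hF _ (by simp)
  · rw [← h.map_o, ← g.map_o, ← hab]; exact hF _ (by simp)
  · rw [← h.map_t, ← g.map_t]; exact hF _ (by simp)

theorem eq_of_free {ρ : G →* Aut T} (hfree : FreeOnArcs ρ) {g h : G} {a : T.A}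
    (hgh : (ρ g).A a = (ρ h).A a) : g = h := by
  rw [← inv_mul_eq_one]
  exact hfree _ a (by rw [map_mul, Aut.mul_A, ← hgh, map_inv_A])

/-- A group that acts freely on arcs is P-closed: the elements that agree locally with an element
of the P-closure are all equal. -/
theorem isPClosed_range_of_free (hT : T.IsTree) {ρ : G →* Aut T} (hfree : FreeOnArcs ρ) :
    IsPClosed ρ.range := by
  refine le_antisymm (fun g hg => ?_) (le_pClosure _)
  rcases isEmpty_or_nonempty T.A with h' | ⟨⟨a₀⟩⟩
  · exact ⟨1, Iso.ext_of_arcs hT.isConnected fun a => isEmptyElim a⟩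
  · obtain ⟨_, ⟨h, rfl⟩, h0, -⟩ := exists_of_mem_pClosure hT hg (rfl : T.o a₀ = T.o a₀)
    refine ⟨h, Iso.ext_of_arcs hT.isConnected
      (hT.isConnected.forall_arc (Q := fun a => (ρ h).A a = g.A a) h0 ?_ ?_)⟩
    · intro a ha
      rw [(ρ h).map_rev, g.map_rev, ha]
    · intro a b hab ha
      obtain ⟨_, ⟨k, rfl⟩, h1, h2⟩ := exists_of_mem_pClosure hT hg hab
      rw [← h2, eq_of_free hfree (ha.trans h1.symm)]

/-! ### Passing to the P-closure -/

/-- Every element of the P-closure acts on `G⁺ \ T` as an element of `G`. -/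
theorem exists_coset_of_mem_pClosure (hT : T.IsTree) (ρ : G →* Aut T) {l : Aut T}
    (hl : l ∈ pClosure ρ.range) :
    ∃ g : G, ∀ a, (plusMap ρ).A (l.A a) = (plusMap ρ).A ((ρ g).A a) := by
  rcases isEmpty_or_nonempty T.A with h' | ⟨⟨a₀⟩⟩
  · exact ⟨1, fun a => isEmptyElim a⟩
  · obtain ⟨_, ⟨g, rfl⟩, h0, -⟩ := exists_of_mem_pClosure hT hl (rfl : T.o a₀ = T.o a₀)
    refine ⟨g, hT.isConnected.forall_arc
      (Q := fun a => (plusMap ρ).A (l.A a) = (plusMap ρ).A ((ρ g).A a)) (by rw [h0]) ?_ ?_⟩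
    · intro a ha
      rw [l.map_rev, (ρ g).map_rev, (plusMap ρ).map_rev, (plusMap ρ).map_rev, ha]
    · intro a b hab ha
      obtain ⟨_, ⟨k, rfl⟩, h1, h2⟩ := exists_of_mem_pClosure hT hl hab
      rw [← h1, ← quotientAction_A, ← quotientAction_A] at ha
      rw [← h2, ← quotientAction_A, eq_of_free (quotientAction_free ρ) ha, quotientAction_A]

theorem map_mem_plus_pClosure (ρ : G →* Aut T) {k : G} (hk : k ∈ plus ρ) :
    (⟨ρ k, le_pClosure ρ.range ⟨k, rfl⟩⟩ : pClosure ρ.range) ∈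
      plus (pClosure ρ.range).subtype := by
  induction hk using Subgroup.closure_induction with
  | mem k hk =>
    obtain ⟨a, ha⟩ := hk
    exact mem_plus_of_fix (a := a) _ ha
  | one => convert one_mem (plus (pClosure ρ.range).subtype); simp
  | mul g h _ _ hg hh => convert mul_mem hg hh; simp
  | inv g _ hg => convert inv_mem hg; simp

theorem plusMap_A_of_mem_plus_pClosure (hT : T.IsTree) (ρ : G →* Aut T) {l : pClosure ρ.range}
    (hl : l ∈ plus (pClosure ρ.range).subtype) (a : T.A) :
    (plusMap ρ).A ((l : Aut T).A a) = (plusMap ρ).A a := by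
  revert a
  induction hl using Subgroup.closure_induction with
  | mem l hl =>
    obtain ⟨b, hb⟩ := hl
    obtain ⟨g, hg⟩ := exists_coset_of_mem_pClosure hT ρ l.2
    intro a
    have hb' : (l : Aut T).A b = b := hb
    have h1 := hg b
    rw [hb', ← quotientAction_A] at h1
    rw [hg a, ← quotientAction_A, quotientAction_free ρ _ _ h1.symm, map_one, Aut.one_A]
  | one => intro a; rfl
  | mul g h _ _ hg hh => intro a; exact (hg _).trans (hh a)
  | inv g _ hg =>
    intro a
    rw [← hg]
    exact congrArg _ (Perm.apply_inv' (g : Aut T).A a)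

/-- An isomorphism of graphs that intertwines two faithful groups of automorphisms yields an
isomorphism of actions. -/
theorem exists_actionIso {G' : Type w'} [Group G'] {T' : RGraph.{u', v'}}
    {ρ : G →* Aut T} {ρ' : G' →* Aut T'} (hρ : Function.Injective ρ) (hρ' : Function.Injective ρ')
    (hT : T.IsConnected) (f : Iso T T')
    (h1 : ∀ g, ∃ g', ∀ a, f.A ((ρ g).A a) = (ρ' g').A (f.A a))
    (h2 : ∀ g', ∃ g, ∀ a, f.A ((ρ g).A a) = (ρ' g').A (f.A a)) :
    ∃ e : ActionIso ρ ρ', e.graph = f := by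
  have hcomp : ∀ g g', (∀ a, f.A ((ρ g).A a) = (ρ' g').A (f.A a)) →
      ∀ p, f.V ((ρ g).V p) = (ρ' g').V (f.V p) := by
    intro g g' h p
    let F₁ : Iso T T' := ⟨(ρ g).V.trans f.V, (ρ g).A.trans f.A,
      fun a => by simp [f.map_o, (ρ g).map_o], fun a => by simp [f.map_rev, (ρ g).map_rev]⟩
    let F₂ : Iso T T' := ⟨f.V.trans (ρ' g').V, f.A.trans (ρ' g').A,
      fun a => by simp [f.map_o, (ρ' g').map_o], fun a => by simp [f.map_rev, (ρ' g').map_rev]⟩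
    have : F₁ = F₂ := Iso.ext_of_arcs hT h
    exact congrArg (fun F : Iso T T' => F.V p) this
  choose φ hφ using h1
  have hsurj : ∀ {g₁ g₂ : Aut T'}, (∀ a, g₁.A (f.A a) = g₂.A (f.A a)) → g₁ = g₂ := by
    intro g₁ g₂ h
    have hT' : T'.IsConnected := by
      have h3 : T.toSimple.Connected := hT
      have h4 : Nonempty T'.V := h3.nonempty.map f.V
      refine ⟨fun p q => ?_⟩
      have : ∀ q, T'.toSimple.Reachable p (f.V q) :=
        hT.arc_induction (p := f.V.symm p) (by rw [Equiv.apply_symm_apply]) fun a ha =>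
          ha.trans (by rw [f.map_o, f.map_t]; exact reachable_o_t _ _)
      have := this (f.V.symm q)
      rwa [Equiv.apply_symm_apply] at this
    refine Iso.ext_of_arcs hT' fun a => ?_
    have := h (f.A.symm a)
    rwa [Equiv.apply_symm_apply] at this
  have huniq : ∀ g g', (∀ a, f.A ((ρ g).A a) = (ρ' g').A (f.A a)) → φ g = g' := by
    intro g g' h
    exact hρ' (hsurj fun a => by rw [← hφ, h])
  let Φ : G →* G' :=
    { toFun := φ
      map_one' := huniq _ _ fun a => by simp
      map_mul' := fun g h => huniq _ _ fun a => by simp [hφ] }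
  have hbij : Function.Bijective Φ := by
    constructor
    · rw [injective_iff_map_eq_one]
      intro g hg
      refine hρ (Iso.ext_of_arcs hT fun a => f.A.injective ?_)
      have : φ g = 1 := hg
      rw [hφ, this]
      simp
    · intro g'
      obtain ⟨g, hg⟩ := h2 g'
      exact ⟨g, huniq _ _ hg⟩
  exact ⟨⟨MulEquiv.ofBijective Φ hbij, f, fun g => hcomp g _ (hφ g), hφ⟩, rfl⟩

/-- With `L` the P-closure of `G`, the groups `L⁺` and `G⁺` have the same orbits on arcs. -/
theorem plusMap_pClosure_A_eq (hT : T.IsTree) (ρ : G →* Aut T) (a b : T.A) :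
    (plusMap (pClosure ρ.range).subtype).A a = (plusMap (pClosure ρ.range).subtype).A b ↔
      (plusMap ρ).A a = (plusMap ρ).A b := by
  rw [plusMap_A_eq]
  constructor
  · rintro ⟨l, hl, rfl⟩
    exact (plusMap_A_of_mem_plus_pClosure hT ρ hl a).symm
  · rintro h
    obtain ⟨k, hk, rfl⟩ := (plusMap_A_eq ρ).1 h
    exact ⟨_, map_mem_plus_pClosure ρ hk, rfl⟩

theorem plusMap_pClosure_V_eq (hT : T.IsTree) (ρ : G →* Aut T) (p q : T.V) :
    (plusMap (pClosure ρ.range).subtype).V p = (plusMap (pClosure ρ.range).subtype).V q ↔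
      (plusMap ρ).V p = (plusMap ρ).V q := by
  constructor
  · intro h
    rcases isEmpty_or_nonempty T.A with h' | h'
    · rw [hT.isConnected.subsingleton p q]
    · obtain ⟨a, rfl⟩ := hT.isConnected.exists_arc p
      obtain ⟨l, hl, rfl⟩ := (plusMap_V_eq _).1 h
      have h1 := (plusMap_A_of_mem_plus_pClosure hT ρ hl a).symm
      have h2 := congrArg (plusQuot ρ).o h1
      rw [← (plusMap ρ).map_o, ← (plusMap ρ).map_o] at h2
      rw [h2]
      exact congrArg _ ((l : Aut T).map_o a).symm
  · intro h
    obtain ⟨k, hk, rfl⟩ := (plusMap_V_eq ρ).1 h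
    exact (plusMap_V_eq _).2 ⟨_, map_mem_plus_pClosure ρ hk, rfl⟩

theorem exists_actionIso_pClosure (hT : T.IsTree) (ρ : G →* Aut T)
    (hρ : Function.Injective ρ ∨ Nonempty T.A) :
    ∃ e : ActionIso (quotientAction ρ) (quotientAction (pClosure ρ.range).subtype),
      (∀ p, e.graph.V ((plusMap ρ).V p) = (plusMap (pClosure ρ.range).subtype).V p) ∧
      (∀ a, e.graph.A ((plusMap ρ).A a) = (plusMap (pClosure ρ.range).subtype).A a) ∧
      (∀ g : G, e.group (QuotientGroup.mk g) =
        QuotientGroup.mk ⟨ρ g, le_pClosure ρ.range ⟨g, rfl⟩⟩) := by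
  have hρL : Function.Injective (quotientAction (pClosure ρ.range).subtype) :=
    quotientAction_injective hT.isConnected _ (Or.inl (Subgroup.subtype_injective _))
  let f : Iso (plusQuot ρ) (plusQuot (pClosure ρ.range).subtype) :=
    { V := Quotient.congr (Equiv.refl _) fun p q =>
        (Quotient.eq.symm.trans (plusMap_pClosure_V_eq hT ρ p q).symm).trans Quotient.eq
      A := Quotient.congr (Equiv.refl _) fun p q =>
        (Quotient.eq.symm.trans (plusMap_pClosure_A_eq hT ρ p q).symm).trans Quotient.eq
      map_o := by rintro ⟨a⟩; rfl
      map_rev := by rintro ⟨a⟩; rfl }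
  have hf : ∀ (g : G) (a : (plusQuot ρ).A),
      f.A ((quotientAction ρ (QuotientGroup.mk g)).A a) =
        (quotientAction (pClosure ρ.range).subtype
          (QuotientGroup.mk ⟨ρ g, le_pClosure ρ.range ⟨g, rfl⟩⟩)).A (f.A a) := by
    rintro g ⟨a⟩; rfl
  obtain ⟨e, he⟩ := exists_actionIso (quotientAction_injective hT.isConnected ρ hρ) hρL
    (quot_connected _ hT.isConnected) f
    (by
      intro x
      obtain ⟨g, rfl⟩ := QuotientGroup.mk_surjective x
      exact ⟨_, hf g⟩)
    (by
      intro x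
      obtain ⟨l, rfl⟩ := QuotientGroup.mk_surjective x
      obtain ⟨g, hg⟩ := exists_coset_of_mem_pClosure hT ρ l.2
      refine ⟨QuotientGroup.mk g, ?_⟩
      rintro ⟨a⟩
      exact congrArg f.A (hg a).symm)
  refine ⟨e, fun p => by rw [he]; rfl, fun a => by rw [he]; rfl, fun g => ?_⟩
  refine hρL (Iso.ext_of_arcs (quot_connected _ hT.isConnected) fun b => ?_)
  obtain ⟨a, rfl⟩ := f.A.surjective b
  rw [← hf, ← he, e.map_A]

end TreeAction

/-! ### Permutation groups modulo the subgroup generated by point stabilizers -/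

namespace TreeAction

section PermGroups

variable {X : Type u}

theorem mem_permPlus_of_fix {H : Subgroup (Perm X)} {g : H} {x : X} (h : (g : Perm X) x = x) :
    g ∈ permPlus H := Subgroup.subset_closure ⟨x, h⟩

theorem mem_permPlus_of_permStarHom {H : Subgroup (Perm X)} {g : H}
    {c : Quotient (permPlusSetoid H)} (h : permStarHom H g c = c) : g ∈ permPlus H := by
  induction c using Quotient.inductionOn with
  | _ x =>
    obtain ⟨k, hk, hx⟩ := Quotient.exact (s := permPlusSetoid H) h
    exact ((permPlus H).mul_mem_cancel_left hk).1 (mem_permPlus_of_fix (g := k * g) hx)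

theorem permStarHom_eq_one {H : Subgroup (Perm X)} {g : H} (hg : g ∈ permPlus H) :
    permStarHom H g = 1 := by
  ext ⟨x⟩
  exact (Quotient.sound (s := permPlusSetoid H) ⟨g, hg, rfl⟩ : _ = _).symm

theorem ker_permStarHom (H : Subgroup (Perm X)) : (permStarHom H).ker = permPlus H := by
  refine le_antisymm (fun g hg => ?_) fun g hg => permStarHom_eq_one hg
  rcases isEmpty_or_nonempty X with h | ⟨⟨x⟩⟩
  · rw [Subsingleton.elim g 1]
    exact one_mem _
  · refine mem_permPlus_of_permStarHom (c := Quotient.mk _ x) ?_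
    rw [show permStarHom H g = 1 from hg]
    rfl

/-- The group induced on the orbits of `H⁺` is semiregular. -/
theorem permStar_semiregular (H : Subgroup (Perm X)) {σ : Perm (Quotient (permPlusSetoid H))}
    (hσ : σ ∈ (permStarHom H).range) {c : Quotient (permPlusSetoid H)} (hc : σ c = c) :
    σ = 1 := by
  obtain ⟨g, rfl⟩ := hσ
  exact permStarHom_eq_one (mem_permPlus_of_permStarHom hc)

theorem permClosure_eq_of_semiregular {H : Subgroup (Perm X)}
    (hH : ∀ σ ∈ H, ∀ c, σ c = c → σ = 1) : permClosure H = H := by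
  classical
  refine le_antisymm (fun σ hσ => ?_) fun σ hσ F => ⟨σ, hσ, fun _ _ => rfl⟩
  rcases isEmpty_or_nonempty X with h | ⟨⟨x⟩⟩
  · rw [Subsingleton.elim σ 1]
    exact one_mem _
  · obtain ⟨h, hh, h0⟩ := hσ {x}
    have h0 := h0 x (by simp)
    convert hh
    ext y
    obtain ⟨k, hk, h1⟩ := hσ {x, y}
    have hx := h1 x (by simp)
    have hy := h1 y (by simp)
    have : h⁻¹ * k = 1 := hH _ (mul_mem (inv_mem hh) hk) x (by simp [hx, ← h0])
    rw [← hy, inv_mul_eq_one.1 this]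

/-- An element of the closure of `H` acts on the set of orbits of `H⁺` as an element of `H`. -/
theorem exists_of_mem_permClosure {H : Subgroup (Perm X)} {σ : Perm X} (hσ : σ ∈ permClosure H) :
    ∃ h : H, ∀ y, (Quotient.mk (permPlusSetoid H) (σ y)) =
      Quotient.mk (permPlusSetoid H) ((h : Perm X) y) := by
  classical
  rcases isEmpty_or_nonempty X with h | ⟨⟨x⟩⟩
  · exact ⟨1, fun y => isEmptyElim y⟩
  · obtain ⟨h, hh, h0⟩ := hσ {x}
    have h0 := h0 x (by simp)
    refine ⟨⟨h, hh⟩, fun y => ?_⟩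
    obtain ⟨k, hk, h1⟩ := hσ {x, y}
    have hx := h1 x (by simp)
    have hy := h1 y (by simp)
    have h2 : (⟨h, hh⟩ : H)⁻¹ * ⟨k, hk⟩ ∈ permPlus H :=
      mem_permPlus_of_fix (x := x) (by simp [hx, ← h0])
    have h3 := permStarHom_eq_one h2
    rw [map_mul, map_inv, inv_mul_eq_one] at h3
    rw [← hy]
    exact (congrArg (fun τ => τ (Quotient.mk _ y)) h3).symm

theorem permPlusSetoid_permClosure (H : Subgroup (Perm X)) (x y : X) :
    (permPlusSetoid (permClosure H)).r x y ↔ (permPlusSetoid H).r x y := by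
  constructor
  · rintro ⟨σ, hσ, rfl⟩
    have key : ∀ x, Quotient.mk (permPlusSetoid H) ((σ : Perm X) x) =
        Quotient.mk (permPlusSetoid H) x := by
      induction hσ using Subgroup.closure_induction with
      | mem σ hσ =>
        obtain ⟨x, hx⟩ := hσ
        obtain ⟨h, hh⟩ := exists_of_mem_permClosure σ.2
        have h1 := hh x
        rw [hx] at h1
        have h2 := permStarHom_eq_one
          (mem_permPlus_of_permStarHom (g := h) (c := Quotient.mk _ x) h1.symm)
        intro y
        rw [hh]
        exact congrArg (fun τ => τ (Quotient.mk _ y)) h2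
      | one => intro x; rfl
      | mul g h _ _ hg hh => intro x; exact (hg _).trans (hh x)
      | inv g _ hg =>
        intro x
        rw [← hg]
        exact congrArg _ (Perm.apply_inv' (g : Perm X) x)
    exact Quotient.exact (key x).symm
  · rintro ⟨h, hh, rfl⟩
    have hle : H ≤ permClosure H := fun σ hσ F => ⟨σ, hσ, fun _ _ => rfl⟩
    refine ⟨Subgroup.inclusion hle h, ?_, rfl⟩
    have : permPlus H ≤ (permPlus (permClosure H)).comap (Subgroup.inclusion hle) := by
      rw [permPlus, Subgroup.closure_le]
      rintro g ⟨x, hx⟩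
      exact mem_permPlus_of_fix (x := x) hx
    exact this hh

variable {Y : Type v}

theorem permPlusSetoid_congr_of_le {H : Subgroup (Perm X)} {K : Subgroup (Perm Y)} (f : X ≃ Y)
    (hf : ∀ σ ∈ H, f.permCongr σ ∈ K) {x y : X} (h : (permPlusSetoid H).r x y) :
    (permPlusSetoid K).r (f x) (f y) := by
  obtain ⟨h, hh, rfl⟩ := h
  have : ∀ h ∈ permPlus H, (⟨f.permCongr h, hf h h.2⟩ : K) ∈ permPlus K := by
    intro h hh
    induction hh using Subgroup.closure_induction with
    | mem h hh =>
      obtain ⟨x, hx⟩ := hh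
      exact mem_permPlus_of_fix (x := f x) (by simp [hx])
    | one => convert one_mem (permPlus K); ext; simp
    | mul g h _ _ hg hh => convert mul_mem hg hh; ext; simp
    | inv g _ hg =>
      convert inv_mem hg
      ext y
      rfl
  exact ⟨_, this h hh, by simp⟩

theorem permPlusSetoid_congr {H : Subgroup (Perm X)} {K : Subgroup (Perm Y)} (f : X ≃ Y)
    (hf : ∀ σ, σ ∈ H ↔ f.permCongr σ ∈ K) (x y : X) :
    (permPlusSetoid H).r x y ↔ (permPlusSetoid K).r (f x) (f y) := by
  refine ⟨permPlusSetoid_congr_of_le f fun σ => (hf σ).1, fun h => ?_⟩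
  have := permPlusSetoid_congr_of_le f.symm (K := H) (fun σ hσ => (hf _).2 (by
    convert hσ
    ext; simp)) h
  simpa using this

theorem permStarHom_range_congr_of_le {H : Subgroup (Perm X)} {K : Subgroup (Perm Y)} (f : X ≃ Y)
    (hq : ∀ x y, (permPlusSetoid H).r x y ↔ (permPlusSetoid K).r (f x) (f y))
    (hf : ∀ σ ∈ H, f.permCongr σ ∈ K) {σ : Perm (Quotient (permPlusSetoid H))}
    (hσ : σ ∈ (permStarHom H).range) :
    (Quotient.congr f hq).permCongr σ ∈ (permStarHom K).range := by
  obtain ⟨g, rfl⟩ := hσ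
  refine ⟨⟨_, hf g g.2⟩, ?_⟩
  ext ⟨c⟩
  rfl

theorem permStarHom_range_congr {H : Subgroup (Perm X)} {K : Subgroup (Perm Y)} (f : X ≃ Y)
    (hq : ∀ x y, (permPlusSetoid H).r x y ↔ (permPlusSetoid K).r (f x) (f y))
    (hf : ∀ σ, σ ∈ H ↔ f.permCongr σ ∈ K) (σ : Perm (Quotient (permPlusSetoid H))) :
    σ ∈ (permStarHom H).range ↔ (Quotient.congr f hq).permCongr σ ∈ (permStarHom K).range := by
  refine ⟨permStarHom_range_congr_of_le f hq fun σ => (hf σ).1, fun h => ?_⟩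
  have hq' : ∀ x y, (permPlusSetoid K).r x y ↔ (permPlusSetoid H).r (f.symm x) (f.symm y) :=
    fun x y => by rw [hq, f.apply_symm_apply, f.apply_symm_apply]
  have h1 := permStarHom_range_congr_of_le (K := H) f.symm hq'
    (fun σ hσ => (hf _).2 (by convert hσ; ext; simp)) h
  have h2 : Quotient.congr f.symm hq' = (Quotient.congr f hq).symm := by ext ⟨y⟩; rfl
  rw [h2] at h1
  convert h1
  ext c
  simp

end PermGroups

/-! ### Isomorphisms of diagrams -/

namespace RGraph

/-- The identity isomorphism. -/
def Iso.refl (Y : RGraph.{u, v}) : Iso Y Y :=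
  ⟨Equiv.refl _, Equiv.refl _, fun _ => rfl, fun _ => rfl⟩

/-- The inverse isomorphism. -/
def Iso.symm {Y : RGraph.{u, v}} {Z : RGraph.{u', v'}} (f : Iso Y Z) : Iso Z Y where
  V := f.V.symm
  A := f.A.symm
  map_o a := by rw [Equiv.symm_apply_eq, f.map_o, Equiv.apply_symm_apply]
  map_rev a := by rw [Equiv.symm_apply_eq, f.map_rev, Equiv.apply_symm_apply]

/-- The composition of isomorphisms. -/
def Iso.trans {Y : RGraph.{u, v}} {Z : RGraph.{u', v'}} {W : RGraph.{w, w'}} (f : Iso Y Z)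
    (g : Iso Z W) : Iso Y W where
  V := f.V.trans g.V
  A := f.A.trans g.A
  map_o a := by simp [f.map_o, g.map_o]
  map_rev a := by simp [f.map_rev, g.map_rev]

end RGraph

namespace DiagramIso

variable {D : Diagram.{u₁, v₁, w₁}} {E : Diagram.{u₂, v₂, w₂}} {F : Diagram.{u₃, v₃, w₃}}

/-- The composition of isomorphisms of diagrams. -/
def trans (e : DiagramIso D E) (f : DiagramIso E F) : DiagramIso D F where
  graph := e.graph.trans f.graph
  colour p := (e.colour p).trans (f.colour _)
  map_arc p c := (f.map_arc _ _).trans (congrArg _ (e.map_arc p c))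
  map_group p σ := (e.map_group p σ).trans (f.map_group _ _)

/-- The inverse of an isomorphism of diagrams. -/
def symm (e : DiagramIso D E) : DiagramIso E D where
  graph := e.graph.symm
  colour q := (Equiv.cast (congrArg E.X (e.graph.V.apply_symm_apply q).symm)).trans
    (e.colour (e.graph.V.symm q)).symm
  map_arc q c := by
    obtain ⟨p, rfl⟩ := e.graph.V.surjective q
    have key : ∀ (p' : D.Γ.V) (h : p' = p) (h' : E.X (e.graph.V p) = E.X (e.graph.V p')),
        D.arc p' ((e.colour p').symm (Equiv.cast h' c)) =
          e.graph.A.symm (E.arc (e.graph.V p) c) := by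
      rintro p' rfl h'
      rw [Equiv.eq_symm_apply, ← e.map_arc, Equiv.apply_symm_apply]
      rfl
    exact key _ (e.graph.V.symm_apply_apply p) _
  map_group q σ := by
    obtain ⟨p, rfl⟩ := e.graph.V.surjective q
    have key : ∀ (p' : D.Γ.V) (h : p' = p) (h' : E.X (e.graph.V p) = E.X (e.graph.V p')),
        σ ∈ E.G (e.graph.V p) ↔
          ((Equiv.cast h').trans (e.colour p').symm).permCongr σ ∈ D.G p' := by
      rintro p' rfl h'
      rw [e.map_group]
      have : (e.colour p').permCongr (((Equiv.cast h').trans (e.colour p').symm).permCongr σ) =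
          σ := by
        ext; simp
      rw [this]
    exact key _ (e.graph.V.symm_apply_apply p) _

/-- An isomorphism of diagrams induces an isomorphism of the diagrams `Δ*`. -/
def star (e : DiagramIso D E) : DiagramIso D.star E.star where
  graph := e.graph
  colour p := Quotient.congr (e.colour p) (permPlusSetoid_congr _ (e.map_group p))
  map_arc p := by
    rintro ⟨c⟩
    exact e.map_arc p c
  map_group p := permStarHom_range_congr _ _ (e.map_group p)

/-- Closing the local actions does not change `Δ*`. -/
theorem exists_star_closure (D : Diagram.{u₁, v₁, w₁}) :
    ∃ e : DiagramIso D.closure.star D.star,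
      (∀ p, e.graph.V p = p) ∧ (∀ a, e.graph.A a = a) := by
  refine ⟨
    { graph := Iso.refl _
      colour := fun p => Quotient.congr (Equiv.refl _) (permPlusSetoid_permClosure (D.G p))
      map_arc := ?_
      map_group := ?_ }, fun _ => rfl, fun _ => rfl⟩
  · rintro p ⟨c⟩
    rfl
  · intro p σ
    constructor
    · rintro ⟨g, rfl⟩
      obtain ⟨h, hh⟩ := exists_of_mem_permClosure g.2
      refine ⟨h, ?_⟩
      ext ⟨c⟩
      exact (hh c).symm
    · rintro ⟨g, hg⟩
      refine ⟨⟨g.1, fun F => ⟨g.1, g.2, fun _ _ => rfl⟩⟩, ?_⟩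
      ext ⟨c⟩
      have h1 := congrArg (fun τ => τ (Quotient.mk (permPlusSetoid (D.G p)) c)) hg
      exact (congrArg (Quotient.congr (Equiv.refl _)
        (permPlusSetoid_permClosure (D.G p))).symm h1).trans (Equiv.symm_apply_apply _ _)

/-- If the local actions of `D` are closed, an isomorphism from the closure of `D` is
one from `D`. -/
def ofClosure (hD : ∀ p, permClosure (D.G p) = D.G p) (e : DiagramIso D.closure E) :
    DiagramIso D E where
  graph := e.graph
  colour := e.colour
  map_arc := e.map_arc
  map_group p σ :=
    (show σ ∈ D.G p ↔ σ ∈ permClosure (D.G p) by rw [hD]).trans (e.map_group p σ)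

end DiagramIso

end TreeAction

/-! ### Vertex stabilizers in the quotient by arc stabilizers -/

namespace TreeAction

variable {G : Type w} [Group G] {T : RGraph.{u, v}}

/-- A cocycle `c` for the action on the vertices of a tree that is trivial on arc stabilizers is
also trivial on the vertex stabilizers of `G⁺`. The reason is that it becomes the coboundary of a
function `F` when restricted to `G⁺`. -/
theorem cocycle_eq_one (hT : T.IsTree) (ρ : G →* Aut T) {W : Type x} [Group W] (c : G → T.V → W)
    (hmul : ∀ g h p, c (g * h) p = c g ((ρ h).V p) * c h p)
    (hfix : ∀ g a, (ρ g).A a = a → c g (T.o a) = 1)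
    {k : G} (hk : k ∈ plus ρ) {p : T.V} (hp : (ρ k).V p = p) : c k p = 1 := by
  have hone : ∀ p, c 1 p = 1 := fun p => by
    have := hmul 1 1 p
    rw [mul_one, map_one, Aut.one_V] at this
    exact left_eq_mul.1 this
  -- `m a` takes the representative of the orbit of `a` to `a`; as `c` is trivial on arc
  -- stabilizers, the value `u a` does not depend on this choice, and `c` is a coboundary on each orbit of arcs
  have hm : ∀ a, ∃ g, (ρ g).A (Quotient.out ((quotMap ρ).A a)) = a := fun a =>
    (quotMap_A_eq ρ).1 (Quotient.out_eq _)
  choose m hm using hm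
  let u : T.A → W := fun a => (c (m a) (T.o (Quotient.out ((quotMap ρ).A a))))⁻¹
  have hu : ∀ g a, u ((ρ g).A a) = u a * (c g (T.o a))⁻¹ := by
    intro g a
    have h1 := hm ((ρ g).A a)
    have h2 := hm a
    rw [quotMap_A_map] at h1
    show (c (m ((ρ g).A a)) (T.o (Quotient.out ((quotMap ρ).A ((ρ g).A a)))))⁻¹ =
      (c (m a) (T.o (Quotient.out ((quotMap ρ).A a))))⁻¹ * _
    rw [quotMap_A_map]
    generalize Quotient.out ((quotMap ρ).A a) = b at h1 h2 ⊢
    generalize m ((ρ g).A a) = n at h1 ⊢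
    have h3 : (ρ (n⁻¹ * (g * m a))).A b = b := by
      rw [map_mul, map_mul, Aut.mul_A, Aut.mul_A, h2, ← h1, map_inv_A]
    have h4 := hmul n (n⁻¹ * (g * m a)) (T.o b)
    rw [mul_inv_cancel_left, hfix _ _ h3, mul_one, (ρ _).map_o, h3, hmul, (ρ (m a)).map_o, h2] at h4
    rw [← h4, mul_inv_rev]
  -- by the choice of the relation, if `F ((ρ g).V q) = c g q * F q` holds at one end of an arc then
  -- it holds at the other end
  obtain ⟨F, -, -, hF⟩ := hT.exists_section (fun _ (_ : W) => True)
    (fun a x y => u (T.rev a) * y = u a * x)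
    (fun a x y h => by rw [T.rev_rev, h])
    (fun a x _ => ⟨(u (T.rev a))⁻¹ * (u a * x), trivial, by group⟩)
    (r := p) (x₀ := 1) trivial
  have key : ∀ k ∈ plus ρ, ∀ q, F ((ρ k).V q) = c k q * F q := by
    intro k hk
    induction hk using Subgroup.closure_induction with
    | mem g hg =>
      obtain ⟨b, hb⟩ := hg
      refine hT.isConnected.arc_induction (p := T.o b)
        (by rw [(ρ g).map_o, hb, hfix g b hb, one_mul]) fun a ha => ?_
      have h1 := hF ((ρ g).A a)
      rw [← (ρ g).map_rev, hu, hu, ← (ρ g).map_o, ← (ρ g).map_t, ha, mul_assoc, mul_assoc,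
        inv_mul_cancel_left, ← hF a, mul_right_inj, o_rev] at h1
      rw [← h1, mul_inv_cancel_left]
    | one => intro q; simp [hone]
    | mul g h _ _ hg hh => intro q; rw [map_mul, Aut.mul_V, hg, hh, hmul, mul_assoc]
    | inv g _ hg =>
      intro q
      have h1 := hg ((ρ g⁻¹).V q)
      have h2 := hmul g g⁻¹ q
      rw [mul_inv_cancel, hone] at h2
      rw [map_V_inv] at h1
      rw [h1, ← mul_assoc, eq_comm (a := F _)]
      have h3 : c g⁻¹ q * c g ((ρ g⁻¹).V q) = 1 := mul_eq_one_comm.1 h2.symm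
      rw [h3, one_mul]
  have := key k hk p
  rw [hp] at this
  exact right_eq_mul.1 this

/-- The action of a vertex stabilizer on the arcs that start at the vertex. -/
def starHom (ρ : G →* Aut T) (p : T.V) : vStab ρ p →* Perm {b : T.A // T.o b = p} where
  toFun g :=
    { toFun := fun b => ⟨(ρ g).A b, by rw [← (ρ (g : G)).map_o, b.2]; exact g.2⟩
      invFun := fun b => ⟨(ρ (g⁻¹ : vStab ρ p)).A b, by
        rw [← (ρ _).map_o, b.2]; exact (g⁻¹ : vStab ρ p).2⟩
      left_inv := fun b => Subtype.ext (map_inv_A ρ _ _)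
      right_inv := fun b => Subtype.ext (map_A_inv ρ _ _) }
  map_one' := by ext b; simp
  map_mul' g h := by ext b; simp

theorem starHom_apply (ρ : G →* Aut T) {p : T.V} (g : vStab ρ p) (b : {b : T.A // T.o b = p}) :
    (starHom ρ p g b : T.A) = (ρ g).A b := rfl

theorem starHom_mem (ρ : G →* Aut T) {p : T.V} (g : vStab ρ p) :
    starHom ρ p g ∈ starPerm (autClosure ((vStab ρ p).map ρ)) p :=
  ⟨ρ g, fun _ => ⟨_, ⟨_, ⟨g, g.2, rfl⟩, rfl⟩, fun _ _ => rfl⟩, g.2, fun _ => rfl⟩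

/-- The local action at a vertex: the group of permutations of the arcs at the vertex that is
induced by the closure of the stabilizer. -/
abbrev localAction (ρ : G →* Aut T) (p : T.V) : Subgroup (Perm {b : T.A // T.o b = p}) :=
  starPerm (autClosure ((vStab ρ p).map ρ)) p

/-- Elements of the local action agree on any two arcs with an element of the stabilizer. -/
theorem exists_of_mem_localAction (hT : T.IsTree) (ρ : G →* Aut T) {p : T.V}
    {σ : Perm {b : T.A // T.o b = p}} (hσ : σ ∈ localAction ρ p)
    (b c : {b : T.A // T.o b = p}) :
    ∃ g : vStab ρ p, starHom ρ p g b = σ b ∧ starHom ρ p g c = σ c := by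
  classical
  obtain ⟨h, hh, hp, hσ⟩ := hσ
  obtain ⟨_, ⟨_, ⟨g, hg, rfl⟩, rfl⟩, hF⟩ := hh {p, T.t b, T.t c}
  have hF' : ∀ q ∈ ({p, T.t b, T.t c} : Finset T.V), (ρ g).V q = h.V q := hF
  refine ⟨⟨g, hg⟩, Subtype.ext ?_, Subtype.ext ?_⟩
  · rw [starHom_apply, ← hσ]
    refine hT.arc_ext _ _ ?_ ?_
    · rw [← h.map_o, ← (ρ _).map_o, b.2]; exact hF' _ (by simp)
    · rw [← h.map_t, ← (ρ _).map_t]; exact hF' _ (by simp)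
  · rw [starHom_apply, ← hσ]
    refine hT.arc_ext _ _ ?_ ?_
    · rw [← h.map_o, ← (ρ _).map_o, c.2]; exact hF' _ (by simp)
    · rw [← h.map_t, ← (ρ _).map_t]; exact hF' _ (by simp)

/-- If the action is free on arcs, then the local action is induced by the stabilizer. -/
theorem mem_localAction_iff_of_free (hT : T.IsTree) {ρ : G →* Aut T} (hfree : FreeOnArcs ρ)
    {p : T.V} {σ : Perm {b : T.A // T.o b = p}} :
    σ ∈ localAction ρ p ↔ ∃ g, starHom ρ p g = σ := by
  constructor
  · intro hσ
    rcases isEmpty_or_nonempty {b : T.A // T.o b = p} with h | ⟨⟨b⟩⟩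
    · exact ⟨1, Subsingleton.elim _ _⟩
    · obtain ⟨g, hg, -⟩ := exists_of_mem_localAction hT ρ hσ b b
      refine ⟨g, Equiv.ext fun c => ?_⟩
      obtain ⟨h, hb, hc⟩ := exists_of_mem_localAction hT ρ hσ b c
      have : (g : G) = h := eq_of_free hfree (a := b) (congrArg Subtype.val (hg.trans hb.symm))
      rw [← hc, Subtype.ext this]
  · rintro ⟨g, rfl⟩
    exact starHom_mem ρ g

/-- An element of `G⁺` that fixes a vertex `v` acts on the arcs at `v` as an element of
`G(v)⁺`: the elements of `G` that move the vertices in the orbit of `v` yield a cocycle with values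
in the group induced by `G(v)` on the orbits of `G(v)⁺`. -/
theorem starHom_mem_permPlus (hT : T.IsTree) (ρ : G →* Aut T) (v : T.V) {k : vStab ρ v}
    (hk : (k : G) ∈ plus ρ) :
    (⟨starHom ρ v k, starHom_mem ρ k⟩ : localAction ρ v) ∈ permPlus (localAction ρ v) := by
  classical
  let θ : vStab ρ v →* Perm (Quotient (permPlusSetoid (localAction ρ v))) :=
    (permStarHom (localAction ρ v)).comp
      ((starHom ρ v).codRestrict _ (starHom_mem ρ))
  let θ' : G → Perm (Quotient (permPlusSetoid (localAction ρ v))) :=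
    fun g => if h : g ∈ vStab ρ v then θ ⟨g, h⟩ else 1
  have hθ' : ∀ g (hg : g ∈ vStab ρ v), θ' g = θ ⟨g, hg⟩ := fun g hg => dif_pos hg
  have hθmul : ∀ g ∈ vStab ρ v, ∀ h ∈ vStab ρ v, θ' (g * h) = θ' g * θ' h := by
    intro g hg h hh
    rw [hθ' _ hg, hθ' _ hh, hθ' _ (mul_mem hg hh), ← map_mul]
    rfl
  -- `τ q` takes `v` to `q` if `q` lies in the orbit of `v`
  have hτ : ∀ q, ∃ g, (quotMap ρ).V q = (quotMap ρ).V v → (ρ g).V v = q := by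
    intro q
    by_cases h : (quotMap ρ).V q = (quotMap ρ).V v
    · obtain ⟨g, hg⟩ := (quotMap_V_eq ρ).1 h.symm
      exact ⟨g, fun _ => hg⟩
    · exact ⟨1, fun h' => absurd h' h⟩
  choose τ hτ using hτ
  have hτ' : ∀ q, (quotMap ρ).V q = (quotMap ρ).V v → (ρ (τ q)⁻¹).V q = v :=
    fun q hq => map_inv_V_eq ρ (hτ q hq)
  have hmem : ∀ g q, (quotMap ρ).V q = (quotMap ρ).V v →
      (τ ((ρ g).V q))⁻¹ * g * τ q ∈ vStab ρ v := by
    intro g q hq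
    show (ρ _).V v = v
    rw [map_mul, map_mul, Aut.mul_V, Aut.mul_V, hτ q hq]
    exact hτ' _ (by rw [quotMap_V_map, hq])
  let c : G → T.V → Perm (Quotient (permPlusSetoid (localAction ρ v))) := fun g q =>
    if (quotMap ρ).V q = (quotMap ρ).V v then θ' ((τ ((ρ g).V q))⁻¹ * g * τ q) else 1
  have hc := cocycle_eq_one hT ρ c (by
    intro g h q
    by_cases hq : (quotMap ρ).V q = (quotMap ρ).V v
    · have hq' : (quotMap ρ).V ((ρ h).V q) = (quotMap ρ).V v := by rw [quotMap_V_map, hq]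
      simp only [c, hq, hq', if_true]
      rw [← hθmul _ (hmem _ _ hq') _ (hmem _ _ hq)]
      refine congrArg θ' ?_
      rw [map_mul, Aut.mul_V]
      group
    · have hq' : ¬ (quotMap ρ).V ((ρ h).V q) = (quotMap ρ).V v := by rwa [quotMap_V_map]
      simp only [c, hq, hq', if_false, mul_one]) (by
    intro g a ha
    by_cases hq : (quotMap ρ).V (T.o a) = (quotMap ρ).V v
    · have hga : (ρ g).V (T.o a) = T.o a := by rw [(ρ g).map_o, ha]
      have h1 := hmem g _ hq
      simp only [c, hq, if_true, hga] at h1 ⊢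
      rw [hθ' _ h1]
      refine permStarHom_eq_one (mem_permPlus_of_fix
        (x := ⟨(ρ (τ (T.o a))⁻¹).A a, ?_⟩) (Subtype.ext ?_))
      · rw [← (ρ _).map_o]
        exact hτ' _ hq
      · show (ρ ((τ (T.o a))⁻¹ * g * τ (T.o a))).A ((ρ (τ (T.o a))⁻¹).A a) =
          (ρ (τ (T.o a))⁻¹).A a
        rw [map_mul, map_mul, Aut.mul_A, Aut.mul_A, map_A_inv, ha]
    · simp only [c, hq, if_false]) hk (p := v) k.2
  have hk' : (ρ (k : G)).V v = v := k.2
  simp only [c, if_true, hk'] at hc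
  have h1 : τ v ∈ vStab ρ v := hτ _ rfl
  rw [hθmul _ (mul_mem (inv_mem h1) k.2) _ h1, hθmul _ (inv_mem h1) _ k.2, hθ' _ h1,
    hθ' _ (inv_mem h1), hθ' _ k.2] at hc
  have h2 : θ ⟨_, inv_mem h1⟩ = (θ ⟨_, h1⟩)⁻¹ := map_inv θ ⟨_, h1⟩
  rw [h2] at hc
  have h3 : θ k = θ ⟨_, h1⟩ * ((θ ⟨_, h1⟩)⁻¹ * θ k * θ ⟨_, h1⟩) * (θ ⟨_, h1⟩)⁻¹ := by group
  have h4 : θ k = 1 := by rw [h3, hc]; simp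
  rw [← ker_permStarHom]
  exact h4

end TreeAction

/-! ### The local action diagram of the quotient action -/

namespace TreeAction

variable {G : Type w} [Group G] {T : RGraph.{u, v}}

/-- A surjective homomorphism whose fibres are the orbits of an action identifies its target with
the quotient graph. -/
noncomputable def quotIso (ρ : G →* Aut T) {Z : RGraph.{u', v'}} (f : Hom T Z)
    (hV : ∀ p q, f.V p = f.V q ↔ ∃ g, (ρ g).V p = q)
    (hA : ∀ a b, f.A a = f.A b ↔ ∃ g, (ρ g).A a = b)
    (hV' : Function.Surjective f.V) (hA' : Function.Surjective f.A) : Iso (quot ρ) Z where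
  V := Equiv.ofBijective (Quotient.lift f.V fun p q h => (hV p q).2 h)
    ⟨by rintro ⟨p⟩ ⟨q⟩ h; exact Quotient.sound (s := vSetoid ρ) ((hV p q).1 h),
      fun z => by obtain ⟨p, rfl⟩ := hV' z; exact ⟨(quotMap ρ).V p, rfl⟩⟩
  A := Equiv.ofBijective (Quotient.lift f.A fun p q h => (hA p q).2 h)
    ⟨by rintro ⟨p⟩ ⟨q⟩ h; exact Quotient.sound (s := aSetoid ρ) ((hA p q).1 h),
      fun z => by obtain ⟨p, rfl⟩ := hA' z; exact ⟨(quotMap ρ).A p, rfl⟩⟩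
  map_o := by rintro ⟨a⟩; exact f.map_o a
  map_rev := by rintro ⟨a⟩; exact f.map_rev a

theorem plusToQuot_V_eq (ρ : G →* Aut T) (p q : (plusQuot ρ).V) :
    (plusToQuot ρ).V p = (plusToQuot ρ).V q ↔ ∃ x, (quotientAction ρ x).V p = q := by
  obtain ⟨p, rfl⟩ := quotMap_V_surjective _ p
  obtain ⟨q, rfl⟩ := quotMap_V_surjective _ q
  refine (quotMap_V_eq ρ (p := p) (q := q)).trans ⟨?_, ?_⟩
  · rintro ⟨g, rfl⟩
    exact ⟨QuotientGroup.mk g, rfl⟩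
  · rintro ⟨x, hx⟩
    obtain ⟨g, rfl⟩ := QuotientGroup.mk_surjective x
    obtain ⟨k, -, hk⟩ := (plusMap_V_eq ρ (p := (ρ g).V p)).1 hx
    exact ⟨k * g, by rw [map_mul]; exact hk⟩

theorem plusToQuot_A_eq (ρ : G →* Aut T) (a b : (plusQuot ρ).A) :
    (plusToQuot ρ).A a = (plusToQuot ρ).A b ↔ ∃ x, (quotientAction ρ x).A a = b := by
  obtain ⟨a, rfl⟩ := quotMap_A_surjective _ a
  obtain ⟨b, rfl⟩ := quotMap_A_surjective _ b
  refine (quotMap_A_eq ρ (a := a) (b := b)).trans ⟨?_, ?_⟩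
  · rintro ⟨g, rfl⟩
    exact ⟨QuotientGroup.mk g, rfl⟩
  · rintro ⟨x, hx⟩
    obtain ⟨g, rfl⟩ := QuotientGroup.mk_surjective x
    obtain ⟨k, -, hk⟩ := (plusMap_A_eq ρ (a := (ρ g).A a)).1 hx
    exact ⟨k * g, by rw [map_mul]; exact hk⟩

theorem plusToQuot_V_surjective (ρ : G →* Aut T) : Function.Surjective (plusToQuot ρ).V := by
  rintro ⟨p⟩; exact ⟨(plusMap ρ).V p, rfl⟩

theorem plusToQuot_A_surjective (ρ : G →* Aut T) : Function.Surjective (plusToQuot ρ).A := by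
  rintro ⟨p⟩; exact ⟨(plusMap ρ).A p, rfl⟩

/-- The orbits of `G(v)⁺` are the traces of the orbits of `G⁺`. -/
theorem permPlusSetoid_localAction (hT : T.IsTree) (ρ : G →* Aut T) (v : T.V)
    (b c : {b : T.A // T.o b = v}) :
    (permPlusSetoid (localAction ρ v)).r b c ↔
      (plusMap ρ).A b = (plusMap ρ).A c := by
  constructor
  · rintro ⟨σ, hσ, rfl⟩
    have key : ∀ b : {b : T.A // T.o b = v},
        (plusMap ρ).A (σ.1 b : {b : T.A // T.o b = v}) = (plusMap ρ).A b := by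
      induction hσ using Subgroup.closure_induction with
      | mem σ hσ =>
        obtain ⟨x, hx⟩ := hσ
        intro b
        obtain ⟨g, h1, h2⟩ := exists_of_mem_localAction hT ρ σ.2 x b
        have h3 : (g : G) ∈ plus ρ :=
          mem_plus_of_fix ρ (a := x.1) (congrArg Subtype.val (h1.trans hx))
        rw [← h2]
        exact ((plusMap_A_eq ρ).2 ⟨g, h3, rfl⟩).symm
      | one => intro b; rfl
      | mul g h _ _ hg hh => intro b; exact (hg _).trans (hh b)
      | inv g _ hg =>
        intro b
        rw [← hg]
        exact congrArg (fun c : {b : T.A // T.o b = v} => (plusMap ρ).A c)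
          (Perm.apply_inv' (g : Perm {b : T.A // T.o b = v}) b)
    exact (key b).symm
  · intro h
    obtain ⟨k, hk, hbc⟩ := (plusMap_A_eq ρ).1 h
    have hk' : k ∈ vStab ρ v := by
      show (ρ k).V v = v
      rw [← b.2, (ρ k).map_o, hbc, c.2, b.2]
    exact ⟨_, starHom_mem_permPlus hT ρ v (k := ⟨k, hk'⟩) hk, Subtype.ext hbc⟩

/-- The group induced by `G(v)` on the orbits of `G(v)⁺` is induced by the stabilizer of `v*`. -/
theorem mem_star_localAction_iff (hT : T.IsTree) (ρ : G →* Aut T) (v : T.V)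
    (σ : Perm (Quotient (permPlusSetoid (localAction ρ v)))) :
    σ ∈ (permStarHom (localAction ρ v)).range ↔
      ∃ g : vStab ρ v, ∀ b, σ (Quotient.mk _ b) = Quotient.mk _ (starHom ρ v g b) := by
  constructor
  · rintro ⟨τ, rfl⟩
    rcases isEmpty_or_nonempty {b : T.A // T.o b = v} with h | ⟨⟨b⟩⟩
    · exact ⟨1, fun b => (h.false b).elim⟩
    · obtain ⟨g, hg, -⟩ := exists_of_mem_localAction hT ρ τ.2 b b
      refine ⟨g, fun c => ?_⟩
      have h1 : (⟨_, starHom_mem ρ g⟩ : localAction ρ v)⁻¹ * τ ∈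
          permPlus (localAction ρ v) :=
        mem_permPlus_of_fix (x := b)
          (show (starHom ρ v g)⁻¹ ((τ : Perm {b : T.A // T.o b = v}) b) = b by
            rw [← hg]; exact Perm.inv_apply' _ _)
      have h2 := permStarHom_eq_one h1
      rw [map_mul, map_inv, inv_mul_eq_one] at h2
      rw [← h2]
      rfl
  · rintro ⟨g, hg⟩
    refine ⟨⟨_, starHom_mem ρ g⟩, ?_⟩
    ext ⟨b⟩
    exact (hg b).symm

/-- The local action diagram of the quotient action is `Δ*`. -/
theorem exists_diagramIso_quotientAction (hT : T.IsTree) (ρ : G →* Aut T)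
    (s : (quot ρ).V → T.V) (hs : ∀ p, (quotMap ρ).V (s p) = p) (hT₁ : (plusQuot ρ).IsTree)
    (s₁ : (quot (quotientAction ρ)).V → (plusQuot ρ).V)
    (hs₁ : ∀ p, (quotMap (quotientAction ρ)).V (s₁ p) = p) :
    ∃ e : DiagramIso (assocDiagram hT₁ (quotientAction ρ) s₁ hs₁) (assocDiagram hT ρ s hs).star,
      (∀ p, e.graph.V ((quotMap (quotientAction ρ)).V p) = (plusToQuot ρ).V p) ∧
      (∀ a, e.graph.A ((quotMap (quotientAction ρ)).A a) = (plusToQuot ρ).A a) := by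
  let ψ : Iso (quot (quotientAction ρ)) (quot ρ) := quotIso (quotientAction ρ) (plusToQuot ρ)
    (plusToQuot_V_eq ρ) (plusToQuot_A_eq ρ) (plusToQuot_V_surjective ρ) (plusToQuot_A_surjective ρ)
  have hψ : ∀ p, (quotMap ρ).V (s (ψ.V p)) = (plusToQuot ρ).V (s₁ p) := by
    intro p
    rw [hs]
    conv_lhs => rw [← hs₁ p]
    rfl
  have hg : ∀ p, ∃ g, (plusMap ρ).V ((ρ g).V (s (ψ.V p))) = s₁ p := by
    intro p
    obtain ⟨x, hx⟩ := (plusToQuot_V_eq ρ ((plusMap ρ).V (s (ψ.V p))) (s₁ p)).1 (hψ p)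
    obtain ⟨g, rfl⟩ := QuotientGroup.mk_surjective x
    exact ⟨g, hx⟩
  choose g hg using hg
  -- the translation by `g p` takes the orbits on the arcs at `v*` to the arcs at `s₁ p`
  let back : ∀ p, Quotient (permPlusSetoid (localAction ρ (s (ψ.V p)))) →
      {b : (plusQuot ρ).A // (plusQuot ρ).o b = s₁ p} := fun p =>
    Quotient.lift (fun b : {b : T.A // T.o b = s (ψ.V p)} =>
      (⟨(plusMap ρ).A ((ρ (g p)).A b), by
        rw [← (plusMap ρ).map_o, ← (ρ _).map_o, b.2, hg]⟩ :
        {b : (plusQuot ρ).A // (plusQuot ρ).o b = s₁ p})) (by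
      intro b c h
      refine Subtype.ext ?_
      show (plusMap ρ).A ((ρ (g p)).A b) = (plusMap ρ).A ((ρ (g p)).A c)
      rw [← quotientAction_A, ← quotientAction_A,
        (permPlusSetoid_localAction hT ρ _ b c).1 h])
  have hback : ∀ p (b : {b : T.A // T.o b = s (ψ.V p)}),
      (back p (Quotient.mk _ b) : (plusQuot ρ).A) = (plusMap ρ).A ((ρ (g p)).A b) :=
    fun _ _ => rfl
  have hbij : ∀ p, Function.Bijective (back p) := by
    intro p
    constructor
    · rintro ⟨b⟩ ⟨c⟩ h
      refine Quotient.sound (s := permPlusSetoid _)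
        ((permPlusSetoid_localAction hT ρ _ b c).2 ?_)
      have h1 : (plusMap ρ).A ((ρ (g p)).A b) = (plusMap ρ).A ((ρ (g p)).A c) :=
        congrArg Subtype.val h
      rw [← quotientAction_A, ← quotientAction_A] at h1
      exact (quotientAction ρ _).A.injective h1
    · rintro ⟨c, hc⟩
      obtain ⟨a, rfl⟩ := quotMap_A_surjective _ c
      have h1 : (plusMap ρ).V (T.o a) = (plusMap ρ).V ((ρ (g p)).V (s (ψ.V p))) := by
        rw [hg]; exact hc
      obtain ⟨k, hk, hk'⟩ := (plusMap_V_eq ρ).1 h1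
      refine ⟨Quotient.mk _ (⟨(ρ (g p)⁻¹).A ((ρ k).A a), ?_⟩ : {b : T.A // T.o b = s (ψ.V p)}),
        Subtype.ext ?_⟩
      · rw [← (ρ _).map_o, ← (ρ _).map_o, hk', map_inv_V]
      · rw [hback]
        show (plusMap ρ).A ((ρ (g p)).A ((ρ (g p)⁻¹).A ((ρ k).A a))) = (plusMap ρ).A a
        rw [map_A_inv]
        exact ((plusMap_A_eq ρ).2 ⟨k, hk, rfl⟩).symm
  refine ⟨
    { graph := ψ
      colour := fun p => (Equiv.ofBijective (back p) (hbij p)).symm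
      map_arc := ?_
      map_group := ?_ }, fun _ => rfl, fun _ => rfl⟩
  · intro (p : (quot (quotientAction ρ)).V) (c : {b : (plusQuot ρ).A // (plusQuot ρ).o b = s₁ p})
    obtain ⟨q, rfl⟩ := (hbij p).2 c
    show (assocDiagram hT ρ s hs).star.arc (ψ.V p) ((Equiv.ofBijective (back p) (hbij p)).symm
      (Equiv.ofBijective (back p) (hbij p) q)) = _
    rw [Equiv.symm_apply_apply]
    obtain ⟨b⟩ := q
    exact (quotMap_A_map ρ (g p) b.1).symm
  · intro (p : (quot (quotientAction ρ)).V)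
      (σ : Perm {b : (plusQuot ρ).A // (plusQuot ρ).o b = s₁ p})
    refine (mem_localAction_iff_of_free hT₁ (quotientAction_free ρ)).trans
      (Iff.trans ?_ (mem_star_localAction_iff hT ρ _ _).symm)
    have hsymm : ∀ (h : vStab ρ (s (ψ.V p))) (b : {b : T.A // T.o b = s (ψ.V p)}),
        (Equiv.ofBijective (back p) (hbij p)).symm.permCongr σ (Quotient.mk _ b) =
          Quotient.mk _ (starHom ρ _ h b) ↔
        (σ (back p (Quotient.mk _ b)) : (plusQuot ρ).A) =
          (plusMap ρ).A ((ρ (g p)).A ((ρ (h : G)).A b)) := by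
      intro h b
      rw [Equiv.permCongr_apply, Equiv.symm_apply_eq, Subtype.ext_iff]
      rfl
    constructor
    · rintro ⟨⟨x, hx⟩, rfl⟩
      obtain ⟨y, rfl⟩ := QuotientGroup.mk_surjective x
      have hx' : (plusMap ρ).V ((ρ y).V ((ρ (g p)).V (s (ψ.V p)))) =
          (plusMap ρ).V ((ρ (g p)).V (s (ψ.V p))) := by
        rw [hg, ← quotientAction_V, hg]
        exact hx
      obtain ⟨k, hk, hk'⟩ := (plusMap_V_eq ρ).1 hx'
      refine ⟨⟨(g p)⁻¹ * (k * (y * g p)), ?_⟩, fun b => (hsymm _ b).2 ?_⟩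
      · show (ρ ((g p)⁻¹ * (k * (y * g p)))).V (s (ψ.V p)) = s (ψ.V p)
        rw [map_mul, map_mul, map_mul, Aut.mul_V, Aut.mul_V, Aut.mul_V, hk', map_inv_V]
      · rw [starHom_apply, hback, quotientAction_A]
        refine (plusMap_A_eq ρ).2 ⟨k, hk, ?_⟩
        simp only [map_mul, Aut.mul_A, map_A_inv]
    · rintro ⟨h, hh⟩
      have h1 : (ρ (h : G)).V (s (ψ.V p)) = s (ψ.V p) := h.2
      refine ⟨⟨QuotientGroup.mk (g p * h * (g p)⁻¹), ?_⟩, Equiv.ext fun c => ?_⟩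
      · show (quotientAction ρ _).V (s₁ p) = s₁ p
        rw [← hg p, quotientAction_V]
        simp only [map_mul, Aut.mul_V, map_inv_V, h1]
      · obtain ⟨⟨b⟩, rfl⟩ := (hbij p).2 c
        refine Subtype.ext (Eq.trans ?_ ((hsymm h b).1 (hh b)).symm)
        rw [starHom_apply]
        refine (quotientAction_A ρ _ _).trans ?_
        simp only [map_mul, Aut.mul_A, map_inv_A]

end TreeAction

/-! ### Actions that are free on arcs are determined by their diagrams -/

namespace TreeAction

variable {G : Type w} [Group G] {T : RGraph.{u, v}}
variable {G' : Type w'} [Group G'] {T' : RGraph.{u', v'}}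

/-- A faithful action is isomorphic to any faithful action that is free on arcs and has an
isomorphic diagram. A pair `x = (h, h')` gives a chart from the arcs at `h v*` to the arcs at
`h' v'*`, namely the colour bijection at `v` conjugated by `h` and `h'`. As trees are simply
connected, charts at all vertices can be chosen so that they fit together to a covering, which is
then an isomorphism of trees. It is equivariant locally, hence everywhere by freeness. -/
theorem nonempty_actionIso_of_diagramIso (hT : T.IsTree) (hT' : T'.IsTree) {ρ : G →* Aut T}
    {ρ' : G' →* Aut T'} (hρ : Function.Injective ρ) (hρ' : Function.Injective ρ')
    (hfree' : FreeOnArcs ρ')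
    (s : (quot ρ).V → T.V) (hs : ∀ p, (quotMap ρ).V (s p) = p)
    (s' : (quot ρ').V → T'.V) (hs' : ∀ p, (quotMap ρ').V (s' p) = p)
    (e : DiagramIso (assocDiagram hT ρ s hs) (assocDiagram hT' ρ' s' hs')) :
    Nonempty (ActionIso ρ ρ') := by
  let ε : Iso (quot ρ) (quot ρ') := e.graph
  let col : ∀ p : (quot ρ).V, {b : T.A // T.o b = s p} ≃ {b : T'.A // T'.o b = s' (ε.V p)} :=
    e.colour
  have hcol : ∀ p (b : {b : T.A // T.o b = s p}),
      (quotMap ρ').A (col p b) = ε.A ((quotMap ρ).A b) := e.map_arc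
  -- as the second action is free on arcs, local permutations at `s' p` are induced by its elements
  have hgrp : ∀ p (g : vStab ρ (s p)), ∃ g' : vStab ρ' (s' (ε.V p)), ∀ b,
      col p (starHom ρ _ g b) = starHom ρ' _ g' (col p b) := by
    intro p g
    obtain ⟨g', hg'⟩ := (mem_localAction_iff_of_free hT' hfree').1
      ((e.map_group p _).1 (starHom_mem ρ g))
    refine ⟨g', fun b => ?_⟩
    have h1 := congrArg (fun τ => τ (col p b)) hg'
    refine Eq.trans ?_ h1.symm
    show col p _ = col p (starHom ρ (s p) g ((col p).symm (col p b)))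
    rw [Equiv.symm_apply_apply]
  clear_value ε col
  -- `P v x` says that `x` is a chart at `v`, and `C x b b'` that this chart takes `b` to `b'`
  let P : T.V → G × G' → Prop := fun v x => (ρ x.1).V (s ((quotMap ρ).V v)) = v
  let C : G × G' → T.A → T'.A → Prop := fun x b b' =>
    ∃ p, ∃ c : {b : T.A // T.o b = s p}, b = (ρ x.1).A c ∧ b' = (ρ' x.2).A (col p c)
  have hCp : ∀ {g : G} {p} {c : {b : T.A // T.o b = s p}} {b : T.A},
      b = (ρ g).A c → p = (quotMap ρ).V (T.o b) := by
    rintro g p c _ rfl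
    rw [← (ρ g).map_o, quotMap_V_map, c.2, hs]
  have hCex : ∀ {v x b}, P v x → T.o b = v →
      ∃ c : {b : T.A // T.o b = s ((quotMap ρ).V v)}, b = (ρ x.1).A c := by
    intro v x b hx hb
    refine ⟨⟨(ρ x.1⁻¹).A b, ?_⟩, (map_A_inv ρ _ _).symm⟩
    rw [← (ρ _).map_o, hb]
    exact map_inv_V_eq ρ hx
  have hCuniq : ∀ {x b b₁ b₂}, C x b b₁ → C x b b₂ → b₁ = b₂ := by
    rintro x b _ _ ⟨p, c, hc, rfl⟩ ⟨q, d, hd, rfl⟩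
    obtain rfl : p = q := (hCp hc).trans (hCp hd).symm
    rw [Subtype.ext ((ρ x.1).A.injective (hc.symm.trans hd))]
  have hCinj : ∀ {x b₁ b₂ b'}, T.o b₁ = T.o b₂ → C x b₁ b' → C x b₂ b' → b₁ = b₂ := by
    rintro x _ _ b' h ⟨p, c, rfl, hc⟩ ⟨q, d, rfl, hd⟩
    obtain rfl : p = q := by rw [hCp (c := c) rfl, hCp (c := d) rfl, h]
    rw [(col p).injective (Subtype.ext ((ρ' x.2).A.injective (hc.symm.trans hd)))]
  have hCarc : ∀ {x b b'}, C x b b' → (quotMap ρ').A b' = ε.A ((quotMap ρ).A b) := by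
    rintro x _ _ ⟨p, c, rfl, rfl⟩
    rw [quotMap_A_map, quotMap_A_map, hcol]
  have hCo : ∀ {x b b'}, C x b b' →
      T'.o b' = (ρ' x.2).V (s' (ε.V ((quotMap ρ).V (T.o b)))) := by
    rintro x _ _ ⟨p, c, rfl, rfl⟩
    rw [← (ρ' _).map_o, (col p c).2, ← hCp (c := c) rfl]
  obtain ⟨r⟩ := hT.tree.connected.nonempty
  have hPex : ∀ v, ∃ g, (ρ g).V (s ((quotMap ρ).V v)) = v := fun v => (quotMap_V_eq ρ).1 (hs _)
  obtain ⟨k₀, hk₀⟩ := hPex r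
  obtain ⟨F, -, hP, hF⟩ := hT.exists_section P
    (fun a x y => ∃ b', C x a b' ∧ C y (T.rev a) (T'.rev b'))
    (by
      rintro a x y ⟨b', h1, h2⟩
      exact ⟨T'.rev b', h2, by rwa [T.rev_rev, T'.rev_rev]⟩)
    (by
      intro a x hx
      obtain ⟨c, hc⟩ := hCex hx rfl
      obtain ⟨k, hk⟩ := hPex (T.t a)
      obtain ⟨d, hd⟩ := hCex (x := (k, 1)) (b := T.rev a) hk rfl
      have h1 : C x a _ := ⟨_, c, hc, rfl⟩
      have h2 : (quotMap ρ').A (col _ d) =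
          (quotMap ρ').A (T'.rev ((ρ' x.2).A (col _ c))) := by
        rw [(quotMap ρ').map_rev, hCarc h1, ← ε.map_rev, ← (quotMap ρ).map_rev, hcol, hd,
          quotMap_A_map]
      obtain ⟨k', hk'⟩ := (quotMap_A_eq ρ').1 h2
      exact ⟨(k, k'), hk, _, h1, _, d, hd, hk'.symm⟩)
    (r := r) (x₀ := (k₀, 1)) hk₀
  have hf : ∀ a, ∃ b', C (F (T.o a)) a b' := fun a => by
    obtain ⟨c, hc⟩ := hCex (hP (T.o a)) rfl
    exact ⟨_, _, c, hc, rfl⟩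
  choose fA hfA using hf
  let f₀ : Hom T T' :=
    { V := fun v => (ρ' (F v).2).V (s' (ε.V ((quotMap ρ).V v)))
      A := fA
      map_o := fun a => (hCo (hfA a)).symm
      map_rev := fun a => by
        obtain ⟨b', h1, h2⟩ := hF a
        rw [hCuniq (hfA a) h1]
        exact hCuniq (hfA (T.rev a)) h2 }
  obtain ⟨f, -, hfA'⟩ := exists_iso_of_covering hT.isConnected hT' f₀
    (by
      intro a b hab h
      have h1 := hfA a
      rw [hab] at h1
      refine hCinj hab h1 (?_ : C (F (T.o b)) b (fA a))
      rw [show fA a = fA b from h]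
      exact hfA b)
    (by
      intro v d hd
      have hd' : T'.o ((ρ' (F v).2⁻¹).A d) = s' (ε.V ((quotMap ρ).V v)) := by
        rw [← (ρ' _).map_o, hd]
        exact map_inv_V ρ' _ _
      obtain ⟨c, hc⟩ := (col ((quotMap ρ).V v)).surjective ⟨_, hd'⟩
      have ho : T.o ((ρ (F v).1).A c) = v := by
        rw [← (ρ _).map_o, c.2]
        exact hP v
      refine ⟨_, ho, hCuniq (hfA _) ?_⟩
      rw [ho]
      exact ⟨_, c, rfl, by rw [hc, map_A_inv]⟩)
  have hfarc : ∀ a, (quotMap ρ').A (f.A a) = ε.A ((quotMap ρ).A a) := fun a => by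
    rw [hfA']
    exact hCarc (hfA a)
  have hlocal : ∀ g v, ∃ g', ∀ a, T.o a = v → f.A ((ρ g).A a) = (ρ' g').A (f.A a) := by
    intro g v
    have h1 : (ρ (F v).1).V (s ((quotMap ρ).V v)) = v := hP v
    have h2 : (ρ (F ((ρ g).V v)).1).V (s ((quotMap ρ).V v)) = (ρ g).V v := by
      have := hP ((ρ g).V v)
      simp only [P, quotMap_V_map] at this
      exact this
    have hm : (F ((ρ g).V v)).1⁻¹ * (g * (F v).1) ∈ vStab ρ (s ((quotMap ρ).V v)) := by
      show (ρ _).V _ = _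
      rw [map_mul, map_mul, Aut.mul_V, Aut.mul_V, h1]
      exact map_inv_V_eq ρ h2
    obtain ⟨m', hm'⟩ := hgrp _ ⟨_, hm⟩
    refine ⟨(F ((ρ g).V v)).2 * (m' * (F v).2⁻¹), fun a ha => ?_⟩
    obtain ⟨c, hc⟩ := hCex (hP v) ha
    have h3 : f.A a = (ρ' (F v).2).A (col _ c) := by
      rw [hfA']
      exact hCuniq (hfA a) (by rw [ha]; exact ⟨_, c, hc, rfl⟩)
    have h4 : f.A ((ρ g).A a) = (ρ' (F ((ρ g).V v)).2).A (col _ (starHom ρ _ ⟨_, hm⟩ c)) := by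
      rw [hfA']
      refine hCuniq (hfA _) ?_
      rw [← (ρ g).map_o, ha]
      refine ⟨_, _, ?_, rfl⟩
      rw [starHom_apply, hc]
      simp only [map_mul, Aut.mul_A, map_A_inv]
    rw [h4, h3, hm', starHom_apply]
    simp only [map_mul, Aut.mul_A, map_inv_A]
  have hglobal : ∀ g, ∃ g', ∀ a, f.A ((ρ g).A a) = (ρ' g').A (f.A a) := by
    intro g
    rcases isEmpty_or_nonempty T.A with h' | ⟨⟨a₀⟩⟩
    · exact ⟨1, fun a => isEmptyElim a⟩
    · obtain ⟨g', hg'⟩ := hlocal g (T.o a₀)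
      refine ⟨g', hT.isConnected.forall_arc
        (Q := fun a => f.A ((ρ g).A a) = (ρ' g').A (f.A a)) (hg' a₀ rfl) ?_ ?_⟩
      · intro a ha
        rw [(ρ g).map_rev, f.map_rev, f.map_rev, ha, (ρ' g').map_rev]
      · intro a b hab ha
        obtain ⟨g'', hg''⟩ := hlocal g (T.o b)
        rw [hg'' b rfl, eq_of_free hfree' ((hg'' a hab).symm.trans ha)]
  obtain ⟨E, -⟩ := exists_actionIso hρ hρ' hT.isConnected f hglobal (by
    intro g'
    rcases isEmpty_or_nonempty T.A with h' | ⟨⟨a₀⟩⟩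
    · exact ⟨1, fun a => isEmptyElim a⟩
    · obtain ⟨b, hb⟩ := f.A.surjective ((ρ' g').A (f.A a₀))
      have h1 : (quotMap ρ).A a₀ = (quotMap ρ).A b := by
        apply ε.A.injective
        rw [← hfarc, ← hfarc, hb, quotMap_A_map]
      obtain ⟨g, rfl⟩ := (quotMap_A_eq ρ).1 h1
      obtain ⟨g'', hg''⟩ := hglobal g
      refine ⟨g, fun a => ?_⟩
      rw [hg'', eq_of_free hfree' ((hg'' a₀).symm.trans hb)])
  exact ⟨E⟩

end TreeAction

/-! ### Bass–Serre trees of graphs of groups with trivial edge groups -/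

namespace TreeAction

namespace GraphOfGroups

variable {Y : RGraph.{u, v}} (𝒢 : GraphOfGroups.{u, v, w, w'} Y) (S : Set Y.A)

theorem letter_eq_one {a : Y.A} (ha : a ∈ S) : 𝒢.letter S a = 1 :=
  (QuotientGroup.eq_one_iff _).2 (Subgroup.subset_normalClosure (Or.inr ⟨a, ha, rfl⟩))

/-- The fundamental group is generated by the vertex groups and the letters. -/
theorem pi1_eq_top (M : Subgroup (𝒢.Pi1 S)) (hv : ∀ p x, 𝒢.vertexHom S p x ∈ M)
    (hl : ∀ a, 𝒢.letter S a ∈ M) (z : 𝒢.Pi1 S) : z ∈ M := by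
  obtain ⟨z, rfl⟩ := QuotientGroup.mk_surjective z
  induction z using Monoid.Coprod.induction_on with
  | inl z =>
    induction z using Monoid.CoprodI.induction_on with
    | one => rw [map_one]; exact one_mem M
    | of p x => exact hv p x
    | mul x y hx hy => rw [map_mul]; exact mul_mem hx hy
  | inr z =>
    induction z using FreeGroup.induction_on with
    | C1 => rw [map_one]; exact one_mem M
    | of a => exact hl a
    | inv_of a _ => rw [map_inv]; exact inv_mem (hl a)
    | mul x y hx hy => rw [map_mul]; exact mul_mem hx hy
  | mul x y hx hy => exact mul_mem hx hy

theorem bassSerre_isConnected (hS : IsMaximalSubtree Y S) : (𝒢.bassSerre S).IsConnected := by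
  obtain ⟨hS', hS⟩ := hS
  let V : 𝒢.Pi1 S → Y.V → (𝒢.bassSerre S).V := fun z p =>
    ⟨p, (z : 𝒢.Pi1 S ⧸ (𝒢.vertexHom S p).range)⟩
  have hV : ∀ z p x, V (z * 𝒢.vertexHom S p x) p = V z p := fun z p x =>
    congrArg (Sigma.mk p) (QuotientGroup.mk_mul_of_mem z ⟨x, rfl⟩)
  have harc : ∀ z a, (𝒢.bassSerre S).toSimple.Reachable (V z (Y.o a))
      (V (z * 𝒢.letter S a) (Y.t a)) := fun z a =>
    reachable_o_t (𝒢.bassSerre S) (⟨a, (z : 𝒢.Pi1 S ⧸ 𝒢.edgeSub S a)⟩ : (𝒢.bassSerre S).A)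
  have htree : ∀ z p q, (𝒢.bassSerre S).toSimple.Reachable (V z p) (V z q) := by
    intro z p
    refine hS.isConnected.arc_induction (p := p) (SimpleGraph.Reachable.refl _) fun a ha => ?_
    refine SimpleGraph.Reachable.trans ha ?_
    have := harc z a
    rwa [letter_eq_one 𝒢 S a.2, mul_one] at this
  let M : Subgroup (𝒢.Pi1 S) :=
    { carrier := {y | ∀ z p, (𝒢.bassSerre S).toSimple.Reachable (V z p) (V (z * y) p)}
      one_mem' := fun z p => by rw [mul_one]
      mul_mem' := fun {x y} hx hy z p => (hx z p).trans (by rw [← mul_assoc]; exact hy _ p)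
      inv_mem' := fun {x} hx z p => by
        have := hx (z * x⁻¹) p
        rw [inv_mul_cancel_right] at this
        exact this.symm }
  have hM : ∀ z, z ∈ M := pi1_eq_top 𝒢 S M
    (fun p x z q => (htree z q p).trans (by rw [← hV z p x]; exact htree _ p q))
    (fun a z q => (htree z q _).trans ((harc z a).trans (htree _ _ q)))
  have : Nonempty (𝒢.bassSerre S).V := hS.isConnected.nonempty.map (V 1)
  refine ⟨?_⟩
  have key : ∀ z p y q, (𝒢.bassSerre S).toSimple.Reachable (V z p) (V y q) := by
    intro z p y q
    refine (htree z p q).trans ?_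
    have := hM (z⁻¹ * y) z q
    rwa [mul_inv_cancel_left] at this
  rintro ⟨p, z⟩ ⟨q, y⟩
  obtain ⟨z, rfl⟩ := QuotientGroup.mk_surjective z
  obtain ⟨y, rfl⟩ := QuotientGroup.mk_surjective y
  exact key z p y q

end GraphOfGroups

/-- The structure theorem for a group `K` acting on a tree, freely on arcs: it is the fundamental
group of a graph of groups over the quotient graph `Y` with the vertex stabilizers as vertex groups,
and its tree is the Bass–Serre tree. A lift of a maximal subtree of `Y` defines a homomorphism from
the fundamental group and an equivariant covering of the tree by the Bass–Serre graph. -/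
theorem exists_actionIso_bassSerre {K : Type x} [Group K] {Z : RGraph.{u', v'}} (hZ : Z.IsTree)
    (κ : K →* Aut Z) (hfree : FreeOnArcs κ) {Y : RGraph.{u, v}} (q : Hom Z Y)
    (hqV : ∀ z z', q.V z = q.V z' ↔ ∃ k, (κ k).V z = z')
    (hqA : ∀ b b', q.A b = q.A b' ↔ ∃ k, (κ k).A b = b')
    (hqV' : Function.Surjective q.V) (hqA' : Function.Surjective q.A)
    (𝒢 : GraphOfGroups.{u, v, w, w'} Y) (htriv : ∀ e, Subsingleton (𝒢.edgeGroup e))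
    (hstab : ∀ p, ∃ z, q.V z = p ∧ ∃ ι : 𝒢.vertexGroup p →* K,
      Function.Injective ι ∧ ∀ k, (∃ x, ι x = k) ↔ (κ k).V z = z)
    (S : Set Y.A) (hS : IsMaximalSubtree Y S) :
    ∃ e : ActionIso κ (𝒢.bassSerreAction S),
      (∀ z, (𝒢.bassSerreProj S).V (e.graph.V z) = q.V z) ∧
      (∀ b, (𝒢.bassSerreProj S).A (e.graph.A b) = q.A b) := by
  have hconn := GraphOfGroups.bassSerre_isConnected 𝒢 S hS
  obtain ⟨hS', hS⟩ := hS
  have hqVk : ∀ k z, q.V ((κ k).V z) = q.V z := fun k z => ((hqV _ _).2 ⟨k, rfl⟩).symm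
  have hqAk : ∀ k b, q.A ((κ k).A b) = q.A b := fun k b => ((hqA _ _).2 ⟨k, rfl⟩).symm
  -- every arc of `Y` lifts to an arc with a given origin
  have hlift : ∀ a z, q.V z = Y.o a → ∃ b, q.A b = a ∧ Z.o b = z := by
    intro a z hz
    obtain ⟨b, rfl⟩ := hqA' a
    rw [← q.map_o] at hz
    obtain ⟨k, rfl⟩ := (hqV _ _).1 hz.symm
    exact ⟨(κ k).A b, hqAk k b, ((κ k).map_o b).symm⟩
  -- a lift of the maximal subtree
  obtain ⟨r⟩ := hS.isConnected.nonempty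
  obtain ⟨z₀, hz₀⟩ := hqV' r
  obtain ⟨j, -, hj, hjS⟩ := hS.exists_section (fun p z => q.V z = p)
    (fun a z z' => ∃ b, q.A b = a ∧ Z.o b = z ∧ Z.t b = z')
    (by
      rintro a z z' ⟨b, h1, h2, h3⟩
      exact ⟨Z.rev b, by rw [q.map_rev, h1], h3, by rw [t_rev, h2]⟩)
    (by
      rintro a z hz
      obtain ⟨b, h1, h2⟩ := hlift a z hz
      exact ⟨Z.t b, by rw [q.map_t, h1]; rfl, b, h1, h2, rfl⟩) (r := r) hz₀
  -- lifts of all arcs that start in the lifted subtree, and stay in it for the arcs of the subtree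
  have hb : ∀ a, ∃ b, q.A b = a ∧ Z.o b = j (Y.o a) ∧ (a ∈ S → Z.t b = j (Y.t a)) := by
    intro a
    by_cases ha : a ∈ S
    · obtain ⟨b, h1, h2, h3⟩ := hjS ⟨a, ha⟩
      exact ⟨b, h1, h2, fun _ => h3⟩
    · obtain ⟨b, h1, h2⟩ := hlift a _ (hj (Y.o a))
      exact ⟨b, h1, h2, fun h => absurd h ha⟩
  choose b hbq hbo hbS using hb
  -- the image of the letter of `a`
  have hk : ∀ a, ∃ k, (κ k).A (b (Y.rev a)) = Z.rev (b a) := fun a =>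
    (hqA _ _).1 (by rw [hbq, q.map_rev, hbq])
  choose k hk using hk
  have hk1 : ∀ a, k a * k (Y.rev a) = 1 := by
    intro a
    refine hfree _ (b a) ?_
    have h1 := hk (Y.rev a)
    rw [Y.rev_rev] at h1
    rw [map_mul, Aut.mul_A, h1, (κ _).map_rev, hk, Z.rev_rev]
  have hkS : ∀ a ∈ S, k a = 1 := by
    intro a ha
    refine hfree _ (b (Y.rev a)) ((hk a).trans ?_)
    refine hZ.arc_ext _ _ ?_ ?_
    · rw [o_rev, hbS a ha, hbo]; rfl
    · rw [t_rev, hbo, hbS _ (hS' a ha), t_rev]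
  -- conjugation moves the given stabilizers to the vertices of the lifted subtree
  have hι : ∀ p, ∃ ι : 𝒢.vertexGroup p →* K,
      Function.Injective ι ∧ ∀ k, (∃ x, ι x = k) ↔ (κ k).V (j p) = j p := by
    intro p
    obtain ⟨z, hz, ι, h1, h2⟩ := hstab p
    obtain ⟨h, hh⟩ := (hqV z (j p)).1 (by rw [hz, hj])
    refine ⟨(MulAut.conj h).toMonoidHom.comp ι, (MulAut.conj h).injective.comp h1, fun k => ?_⟩
    have h3 : (κ (h⁻¹ * k * h)).V z = z ↔ (κ k).V (j p) = j p := by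
      rw [map_mul, map_mul, Aut.mul_V, Aut.mul_V, hh]
      constructor
      · intro h4
        have h5 := congrArg (κ h).V h4
        rwa [map_V_inv, hh] at h5
      · intro h4
        rw [h4]
        exact map_inv_V_eq κ hh
    rw [← h3, ← h2]
    refine exists_congr fun x => ?_
    show h * ι x * h⁻¹ = k ↔ _
    rw [mul_inv_eq_iff_eq_mul, mul_assoc, eq_inv_mul_iff_mul_eq]
  choose ι hι1 hι2 using hι
  let φ₀ : 𝒢.FreeProd →* K := Monoid.Coprod.lift (Monoid.CoprodI.lift ι) (FreeGroup.lift k)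
  have hφ₀v : ∀ p x, φ₀ (𝒢.preVertex p x) = ι p x := fun p x => by
    simp [φ₀, GraphOfGroups.preVertex]
  have hφ₀l : ∀ a, φ₀ (𝒢.preLetter a) = k a := fun a => by
    simp [φ₀, GraphOfGroups.preLetter]
  have hone : ∀ e a h g, 𝒢.emb e a h g = 1 := fun e a h g => by
    rw [(htriv e).elim g 1, map_one]
  have hker : Subgroup.normalClosure (𝒢.relators S) ≤ φ₀.ker := by
    refine Subgroup.normalClosure_le_normal ?_
    rintro _ ((⟨a, g, rfl⟩ | ⟨a, rfl⟩) | ⟨a, ha, rfl⟩)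
    · show φ₀ _ = 1
      rw [hone, hone]
      simp only [map_mul, map_one, mul_one, inv_one, hφ₀l, hk1]
    · show φ₀ _ = 1
      rw [map_mul, hφ₀l, hφ₀l, hk1]
    · show φ₀ _ = 1
      rw [hφ₀l, hkS a ha]
  let φ : 𝒢.Pi1 S →* K := QuotientGroup.lift _ φ₀ hker
  have hφv : ∀ p x, φ (𝒢.vertexHom S p x) = ι p x := hφ₀v
  have hφl : ∀ a, φ (𝒢.letter S a) = k a := hφ₀l
  have hedge : ∀ a, 𝒢.edgeSub S a = ⊥ := by
    intro a
    rw [eq_bot_iff]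
    rintro _ ⟨g, rfl⟩
    show 𝒢.vertexHom S _ (𝒢.emb _ a rfl g) = 1
    rw [hone, map_one]
  let f : Hom (𝒢.bassSerre S) Z :=
    { V := fun c => Quotient.liftOn' c.2 (fun z => (κ (φ z)).V (j c.1)) (by
        intro z y h
        rw [QuotientGroup.leftRel_apply] at h
        obtain ⟨x, hx⟩ := h
        have h1 : (κ (ι c.1 x)).V (j c.1) = j c.1 := (hι2 _ _).1 ⟨x, rfl⟩
        have h2 : y = z * 𝒢.vertexHom S c.1 x := by rw [hx, mul_inv_cancel_left]
        show (κ (φ z)).V _ = (κ (φ y)).V _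
        rw [h2, map_mul, map_mul, Aut.mul_V, hφv, h1])
      A := fun c => Quotient.liftOn' c.2 (fun z => (κ (φ z)).A (b c.1)) (by
        intro z y h
        rw [QuotientGroup.leftRel_apply, hedge, Subgroup.mem_bot, inv_mul_eq_one] at h
        rw [h])
      map_o := by
        rintro ⟨a, ⟨z⟩⟩
        show (κ (φ z)).V (j (Y.o a)) = Z.o ((κ (φ z)).A (b a))
        rw [← (κ _).map_o, hbo]
      map_rev := by
        rintro ⟨a, ⟨z⟩⟩
        show (κ (φ (z * 𝒢.letter S a))).A (b (Y.rev a)) = Z.rev ((κ (φ z)).A (b a))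
        rw [map_mul, map_mul, Aut.mul_A, hφl, hk, (κ _).map_rev] }
  have hqf : ∀ c, q.V (f.V c) = c.1 := by
    rintro ⟨p, ⟨z⟩⟩
    exact (hqVk _ _).trans (hj p)
  have hqfA : ∀ c, q.A (f.A c) = c.1 := by
    rintro ⟨a, ⟨z⟩⟩
    exact (hqAk _ _).trans (hbq a)
  have hVeq : ∀ p (z y : 𝒢.Pi1 S), (⟨p, (z : 𝒢.Pi1 S ⧸ (𝒢.vertexHom S p).range)⟩ :
      (𝒢.bassSerre S).V) = ⟨p, (y : 𝒢.Pi1 S ⧸ (𝒢.vertexHom S p).range)⟩ →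
      ∃ x, y = z * 𝒢.vertexHom S p x := by
    intro p z y h
    obtain ⟨x, hx⟩ := QuotientGroup.eq.1 (eq_of_heq (Sigma.mk.inj h).2)
    exact ⟨x, by rw [hx, mul_inv_cancel_left]⟩
  obtain ⟨F, hFV, hFA⟩ := exists_iso_of_covering hconn hZ f
    (by
      rintro ⟨a, ⟨z⟩⟩ ⟨a', ⟨y⟩⟩ ho h
      obtain rfl : a = a' := (hqfA _).symm.trans ((congrArg q.A h).trans (hqfA _))
      obtain ⟨x, rfl⟩ := hVeq (Y.o a) z y ho
      have h1 : (κ (φ z)).A (b a) = (κ (φ (z * 𝒢.vertexHom S _ x))).A (b a) := h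
      have h2 := eq_of_free hfree h1
      rw [map_mul, left_eq_mul, hφv] at h2
      rw [hι1 _ (h2.trans (map_one _).symm), map_one, mul_one])
    (by
      rintro ⟨p, ⟨z⟩⟩ d hd
      have hd' : Z.o d = (κ (φ z)).V (j p) := hd
      obtain rfl : p = Y.o (q.A d) := by
        rw [← q.map_o, hd', hqVk, hj]
      obtain ⟨k', hk'⟩ := (hqA ((κ (φ z)).A (b (q.A d))) d).1 (by rw [hqAk, hbq])
      have h1 : (κ ((φ z)⁻¹ * k' * φ z)).V (j (Y.o (q.A d))) = j (Y.o (q.A d)) := by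
        simp only [map_mul, Aut.mul_V]
        refine map_inv_V_eq κ ?_
        rw [← hbo, (κ _).map_o, (κ _).map_o, hk', hd', ← hbo, (κ _).map_o]
      obtain ⟨x, hx⟩ := (hι2 _ _).2 h1
      refine ⟨⟨q.A d, ((z * 𝒢.vertexHom S _ x : 𝒢.Pi1 S) : 𝒢.Pi1 S ⧸ _)⟩, ?_, ?_⟩
      · exact congrArg (Sigma.mk (Y.o (q.A d))) (QuotientGroup.mk_mul_of_mem z ⟨x, rfl⟩)
      · show (κ (φ (z * 𝒢.vertexHom S _ x))).A (b (q.A d)) = d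
        rw [map_mul, hφv, hx, mul_assoc, mul_inv_cancel_left, map_mul, Aut.mul_A, hk'])
  have hequiv : ∀ y c, f.V ((𝒢.bassSerreAction S y).V c) = (κ (φ y)).V (f.V c) := by
    rintro y ⟨p, ⟨z⟩⟩
    show (κ (φ (y * z))).V (j p) = (κ (φ y)).V ((κ (φ z)).V (j p))
    rw [map_mul, map_mul, Aut.mul_V]
  have hequivA : ∀ y c, f.A ((𝒢.bassSerreAction S y).A c) = (κ (φ y)).A (f.A c) := by
    rintro y ⟨a, ⟨z⟩⟩
    show (κ (φ (y * z))).A (b a) = (κ (φ y)).A ((κ (φ z)).A (b a))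
    rw [map_mul, map_mul, Aut.mul_A]
  have hφinj : Function.Injective φ := by
    rw [injective_iff_map_eq_one]
    intro y hy
    have h1 : F.V ⟨r, ((1 : 𝒢.Pi1 S) : 𝒢.Pi1 S ⧸ _)⟩ = F.V ⟨r, (y : 𝒢.Pi1 S ⧸ _)⟩ := by
      refine (hFV _).trans (Eq.trans ?_ (hFV _).symm)
      show (κ (φ 1)).V (j r) = (κ (φ y)).V (j r)
      rw [hy, map_one]
    obtain ⟨x, rfl⟩ := hVeq r 1 y (F.V.injective h1)
    rw [one_mul, hφv] at hy
    rw [hι1 _ (hy.trans (map_one _).symm), map_one, mul_one]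
  have hφsurj : Function.Surjective φ := by
    intro k'
    obtain ⟨⟨p, ⟨z⟩⟩, hc⟩ := F.V.surjective ((κ k').V (j r))
    replace hc := (hFV _).symm.trans hc
    obtain rfl : p = r :=
      (hqf _).symm.trans ((congrArg q.V hc).trans ((hqVk k' (j r)).trans (hj r)))
    have hc' : (κ (φ z)).V (j p) = (κ k').V (j p) := hc
    obtain ⟨x, hx⟩ := (hι2 p ((φ z)⁻¹ * k')).2 (by
      rw [map_mul, Aut.mul_V]
      exact map_inv_V_eq κ hc')
    exact ⟨z * 𝒢.vertexHom S p x, by rw [map_mul, hφv, hx, mul_inv_cancel_left]⟩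
  let Φ : 𝒢.Pi1 S ≃* K := MulEquiv.ofBijective φ ⟨hφinj, hφsurj⟩
  refine ⟨⟨Φ.symm, F.symm, fun g p => ?_, fun g a => ?_⟩, fun z => ?_, fun d => ?_⟩
  · obtain ⟨y, rfl⟩ := Φ.surjective g
    obtain ⟨c, rfl⟩ := F.V.surjective p
    show F.V.symm _ = (𝒢.bassSerreAction S _).V (F.V.symm _)
    rw [Equiv.symm_apply_apply, MulEquiv.symm_apply_apply, Equiv.symm_apply_eq, hFV, hFV, hequiv]
    rfl
  · obtain ⟨y, rfl⟩ := Φ.surjective g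
    obtain ⟨c, rfl⟩ := F.A.surjective a
    show F.A.symm _ = (𝒢.bassSerreAction S _).A (F.A.symm _)
    rw [Equiv.symm_apply_apply, MulEquiv.symm_apply_apply, Equiv.symm_apply_eq, hFA, hFA, hequivA]
    rfl
  · obtain ⟨c, rfl⟩ := F.V.surjective z
    show (F.V.symm (F.V c)).1 = _
    rw [Equiv.symm_apply_apply, hFV, hqf]
  · obtain ⟨c, rfl⟩ := F.A.surjective d
    show (F.A.symm (F.A c)).1 = _
    rw [Equiv.symm_apply_apply, hFA, hqfA]

end TreeAction

/-! ### Reversal-free subdivisions -/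

namespace TreeAction

section Subdivision

variable {Y : RGraph.{u, v}} {R : Set Y.A} {hR : ∀ a ∈ R, Y.rev a ∈ R}

theorem subdiv_isConnected (hY : Y.IsConnected) : (subdiv Y R hR).IsConnected := by
  have hmid : ∀ c : R, (subdiv Y R hR).toSimple.Reachable (Sum.inl (Y.o c))
      (Sum.inr (Quotient.mk _ c)) := fun c =>
    reachable_o_t (subdiv Y R hR) (Sum.inr (c, false))
  have harc : ∀ a, (subdiv Y R hR).toSimple.Reachable (Sum.inl (Y.o a)) (Sum.inl (Y.t a)) := by
    intro a
    by_cases ha : a ∈ R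
    · refine (hmid ⟨a, ha⟩).trans ?_
      have h1 : (Quotient.mk (revSetoid Y R) ⟨a, ha⟩) =
          Quotient.mk (revSetoid Y R) ⟨Y.rev a, hR a ha⟩ :=
        Quotient.sound (s := revSetoid Y R) (Or.inr rfl)
      rw [h1]
      exact (hmid ⟨Y.rev a, hR a ha⟩).symm
    · exact reachable_o_t (subdiv Y R hR) (Sum.inl ⟨a, ha⟩)
  have hinl : ∀ p q, (subdiv Y R hR).toSimple.Reachable (Sum.inl p) (Sum.inl q) := fun p =>
    hY.arc_induction (p := p) (SimpleGraph.Reachable.refl _) fun a h => h.trans (harc a)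
  have hex : ∀ z, ∃ p, (subdiv Y R hR).toSimple.Reachable (Sum.inl p) z := by
    rintro (p | c)
    · exact ⟨p, SimpleGraph.Reachable.refl _⟩
    · induction c using Quotient.inductionOn with
      | _ c => exact ⟨_, hmid c⟩
  have hY' : Y.toSimple.Connected := hY
  have : Nonempty (subdiv Y R hR).V := hY'.nonempty.map Sum.inl
  refine ⟨fun z z' => ?_⟩
  obtain ⟨p, hp⟩ := hex z
  obtain ⟨q, hq⟩ := hex z'
  exact hp.symm.trans ((hinl p q).trans hq)

theorem subdiv_isTree (hY : Y.IsTree) : (subdiv Y R hR).IsTree := by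
  classical
  refine isTree_of_cut (subdiv_isConnected hY.isConnected) ?_
  have hcut : ∀ a, ∃ φ : Y.V → Bool, ∀ b, φ (Y.o b) ≠ φ (Y.t b) ↔ b = a ∨ b = Y.rev a := by
    intro a
    refine hY.exists_cut {b | b = a ∨ b = Y.rev a} ?_
    rintro b (rfl | rfl)
    · exact Or.inr rfl
    · exact Or.inl (Y.rev_rev a)
  rintro (⟨a, ha⟩ | ⟨c, i⟩)
  · obtain ⟨φ, hφ⟩ := hcut a
    have hmid : ∀ b ∈ R, φ (Y.o b) = φ (Y.t b) := by
      intro b hb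
      by_contra h
      rcases (hφ b).1 h with rfl | rfl
      · exact ha hb
      · exact ha (by have := hR _ hb; rwa [Y.rev_rev] at this)
    refine ⟨Sum.elim φ (Quotient.lift (fun b : R => φ (Y.o b)) ?_), ?_, ?_⟩
    · rintro ⟨b, hb⟩ ⟨b', hb'⟩ (h | h)
      · exact congrArg (fun x => φ (Y.o x)) (Eq.symm h)
      · have h' : b' = Y.rev b := h
        subst h'
        exact hmid b hb
    · exact (hφ a).2 (Or.inl rfl)
    · rintro (⟨b, hb⟩ | ⟨b, _ | _⟩) h
      · rcases (hφ b).1 h with h | h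
        · exact Or.inl (congrArg Sum.inl (Subtype.ext h))
        · exact Or.inr (congrArg Sum.inl (Subtype.ext h))
      · exact absurd rfl h
      · exact absurd rfl h
  · obtain ⟨φ, hφ⟩ := hcut c
    have hmid : ∀ b, ¬ (b = c.1 ∨ b = Y.rev c) → φ (Y.o b) = φ (Y.t b) := by
      intro b hb
      by_contra h
      exact hb ((hφ b).1 h)
    have hc := (hφ c).2 (Or.inl rfl)
    have hrev : ∀ b, (Y.rev b = c.1 ∨ Y.rev b = Y.rev c) ↔ (b = c.1 ∨ b = Y.rev c) := by
      intro b
      constructor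
      · rintro (h | h)
        · exact Or.inr (by rw [← h, Y.rev_rev])
        · exact Or.inl (by rw [← Y.rev_rev b, h, Y.rev_rev])
      · rintro (rfl | rfl)
        · exact Or.inr rfl
        · exact Or.inl (Y.rev_rev _)
    -- the midpoint of `{c, rev c}` lies on the side of `t c`
    let μ : R → Bool := fun b => if b.1 = c.1 ∨ b.1 = Y.rev c then φ (Y.t c) else φ (Y.o b)
    refine ⟨Sum.elim φ (Quotient.lift μ ?_), ?_, ?_⟩
    · rintro ⟨b, hb⟩ ⟨b', hb'⟩ (h | h)
      · exact congrArg μ (Subtype.ext (Eq.symm h))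
      · have h' : b' = Y.rev b := h
        subst h'
        show (if b = c.1 ∨ b = Y.rev c then φ (Y.t c) else φ (Y.o b)) =
          if Y.rev b = c.1 ∨ Y.rev b = Y.rev c then φ (Y.t c) else φ (Y.o (Y.rev b))
        simp only [hrev]
        split_ifs with h1
        · rfl
        · exact hmid b h1
    · have h1 : φ (Y.o c) ≠ μ c := by
        show φ (Y.o c) ≠ if c.1 = c.1 ∨ c.1 = Y.rev c then φ (Y.t c) else φ (Y.o c)
        rwa [if_pos (Or.inl rfl)]
      cases i
      · exact h1
      · exact h1.symm
    · have key : ∀ b : R, φ (Y.o b) ≠ μ b → b = c := by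
        intro b hb
        have hb' : φ (Y.o b) ≠ if b.1 = c.1 ∨ b.1 = Y.rev c then φ (Y.t c) else φ (Y.o b) := hb
        split_ifs at hb' with h1
        · rcases h1 with h1 | h1
          · exact Subtype.ext h1
          · rw [h1] at hb'
            exact absurd rfl hb'
        · exact absurd rfl hb'
      rintro (⟨b, hb⟩ | ⟨b, j⟩) h
      · have h' : b = c.1 ∨ b = Y.rev c := (hφ b).1 h
        rcases h' with rfl | rfl
        · exact absurd c.2 hb
        · exact absurd (hR _ c.2) hb
      · have hbc : b = c := by
          cases j
          · exact key b h
          · exact key b (Ne.symm h)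
        subst hbc
        cases i <;> cases j
        · exact Or.inl rfl
        · exact Or.inr rfl
        · exact Or.inr rfl
        · exact Or.inl rfl

end Subdivision

theorem exists_isMaximalSubtree {Y : RGraph.{u, v}} (hY : Y.IsConnected) :
    ∃ S, IsMaximalSubtree Y S := by
  have hY' : Y.toSimple.Connected := hY
  obtain ⟨F, hF, hFT⟩ := hY'.exists_isTree_le
  -- one geometric edge is chosen between any two vertices that are adjacent in the spanning tree
  have hpick : ∀ d : F.edgeSet, ∃ a : Y.A, s(Y.o a, Y.t a) = d := by
    rintro ⟨d, hd⟩
    induction d using Sym2.ind with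
    | _ p q =>
      obtain ⟨-, a, rfl, rfl⟩ := hF hd
      exact ⟨a, rfl⟩
  choose pick hpick using hpick
  let S : Set Y.A := {a | ∃ d, a = pick d ∨ a = Y.rev (pick d)}
  have hS : ∀ a ∈ S, Y.rev a ∈ S := by
    rintro _ ⟨d, rfl | rfl⟩
    · exact ⟨d, Or.inr rfl⟩
    · exact ⟨d, Or.inl (Y.rev_rev _)⟩
  have hSd : ∀ a d, (a = pick d ∨ a = Y.rev (pick d)) → s(Y.o a, Y.t a) = d := by
    rintro a d (rfl | rfl)
    · exact hpick d
    · rw [o_rev, t_rev, Sym2.eq_swap, hpick]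
  have hne : ∀ a ∈ S, F.Adj (Y.o a) (Y.t a) := by
    rintro a ⟨d, hd⟩
    have h1 := d.2
    rw [← hSd a d hd] at h1
    exact h1
  refine ⟨S, hS, ?_, ?_, ?_⟩
  · rintro ⟨a, ha⟩ ⟨b, hb⟩ (h1 : Y.o a = Y.o b) (h2 : Y.t a = Y.t b)
    refine Subtype.ext (?_ : a = b)
    have hab := (hne a ha).ne
    obtain ⟨d, hd⟩ := ha
    obtain ⟨d', hd'⟩ := hb
    obtain rfl : d = d' := by
      apply Subtype.ext
      rw [← hSd a d hd, ← hSd b d' hd', h1, h2]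
    rcases hd with rfl | rfl <;> rcases hd' with rfl | rfl
    · rfl
    · exact absurd h1 (by rwa [o_rev])
    · rw [o_rev] at h1
      rw [o_rev, t_rev, h1] at hab
      exact absurd rfl hab
    · rfl
  · rintro ⟨a, ha⟩ h
    exact (hne a ha).ne h
  · convert hFT
    ext p q
    constructor
    · rintro ⟨-, ⟨a, ha⟩, rfl, rfl⟩
      exact hne a ha
    · intro h
      refine ⟨h.ne, ?_⟩
      have h1 := hpick ⟨s(p, q), h⟩
      have h2 : s(Y.o (pick ⟨s(p, q), h⟩), Y.t (pick ⟨s(p, q), h⟩)) = s(p, q) := h1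
      rw [Sym2.eq_iff] at h2
      rcases h2 with ⟨h3, h4⟩ | ⟨h3, h4⟩
      · exact ⟨⟨_, _, Or.inl rfl⟩, h3, h4⟩
      · exact ⟨⟨_, _, Or.inr rfl⟩, h4, (Y.t_rev _).trans h3⟩

section SubdivAction

variable {K : Type w} [Group K] {Z : RGraph.{u, v}} (κ : K →* Aut Z)

theorem subdivAction_free (hfree : FreeOnArcs κ) : FreeOnArcs (subdivAction κ) := by
  rintro k (a | ⟨c, i⟩) h
  · exact hfree k a (congrArg Subtype.val (Sum.inl_injective h))
  · exact hfree k c (congrArg (fun z => (Prod.fst z).1) (Sum.inr_injective h))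

variable {Γ : RGraph.{u', v'}} (f : Hom Z Γ) (hf : ∀ a, f.A a ∈ selfRev Γ ↔ a ∈ reversed κ)

/-- The homomorphism from the reversal-free subdivision of an action to that of the quotient. -/
abbrev subdivProj : Hom (actSubdiv κ) (graphSubdiv Γ) := subdivHom (reversed_rev κ) _ f hf

theorem subdivProj_V_eq (hV : ∀ p q, f.V p = f.V q ↔ ∃ k, (κ k).V p = q)
    (hA : ∀ a b, f.A a = f.A b ↔ ∃ k, (κ k).A a = b) (p q : (actSubdiv κ).V) :
    (subdivProj κ f hf).V p = (subdivProj κ f hf).V q ↔ ∃ k, (subdivAction κ k).V p = q := by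
  rcases p with p | c <;> rcases q with q | d
  · refine (Sum.inl_injective.eq_iff.trans (hV p q)).trans (exists_congr fun k => ?_)
    exact Sum.inl_injective.eq_iff.symm
  · exact iff_of_false (fun h => nomatch h) (fun ⟨k, h⟩ => nomatch h)
  · induction c using Quotient.inductionOn with
    | _ c => exact iff_of_false (fun h => nomatch h) (fun ⟨k, h⟩ => nomatch h)
  · induction c using Quotient.inductionOn with
    | _ c =>
    induction d using Quotient.inductionOn with
    | _ d =>
    have hc : Γ.rev (f.A c) = f.A c := (hf c).2 c.2
    constructor
    · intro h
      have h1 : f.A d = f.A c ∨ f.A d = Γ.rev (f.A c) :=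
        Quotient.exact (s := revSetoid Γ (selfRev Γ)) (Sum.inr_injective h)
      rw [hc, or_self] at h1
      obtain ⟨k, hk⟩ := (hA _ _).1 h1.symm
      exact ⟨k, congrArg Sum.inr (Quotient.sound (s := revSetoid Z (reversed κ)) (Or.inl hk.symm))⟩
    · rintro ⟨k, h⟩
      have h1 : (d : Z.A) = (κ k).A c ∨ (d : Z.A) = Z.rev ((κ k).A c) :=
        Quotient.exact (s := revSetoid Z (reversed κ)) (Sum.inr_injective h)
      have h2 : f.A ((κ k).A c) = f.A c := ((hA _ _).2 ⟨k, rfl⟩).symm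
      refine congrArg Sum.inr (Quotient.sound (s := revSetoid Γ (selfRev Γ)) (Or.inl ?_))
      show f.A d = f.A c
      rcases h1 with h1 | h1
      · rw [h1, h2]
      · rw [h1, f.map_rev, h2, hc]

theorem subdivProj_A_eq (hA : ∀ a b, f.A a = f.A b ↔ ∃ k, (κ k).A a = b) (a b : (actSubdiv κ).A) :
    (subdivProj κ f hf).A a = (subdivProj κ f hf).A b ↔ ∃ k, (subdivAction κ k).A a = b := by
  rcases a with ⟨a, ha⟩ | ⟨⟨c, hc⟩, i⟩ <;> rcases b with ⟨b, hb⟩ | ⟨⟨d, hd⟩, j⟩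
  · refine Iff.trans ⟨fun h => congrArg Subtype.val (Sum.inl_injective h),
      fun h => congrArg Sum.inl (Subtype.ext h)⟩ ((hA a b).trans (exists_congr fun k => ?_))
    exact ⟨fun h => congrArg Sum.inl (Subtype.ext h),
      fun h => congrArg Subtype.val (Sum.inl_injective h)⟩
  · exact iff_of_false (fun h => nomatch h) (fun ⟨k, h⟩ => nomatch h)
  · exact iff_of_false (fun h => nomatch h) (fun ⟨k, h⟩ => nomatch h)
  · constructor
    · intro h
      have h1 := Sum.inr_injective h
      obtain ⟨k, hk⟩ := (hA c d).1 (congrArg (fun z => (Prod.fst z).1) h1)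
      have h2 : i = j := congrArg Prod.snd h1
      exact ⟨k, congrArg Sum.inr (Prod.ext (Subtype.ext hk) h2)⟩
    · rintro ⟨k, h⟩
      have h1 := Sum.inr_injective h
      have h2 : (κ k).A c = d := congrArg (fun z => (Prod.fst z).1) h1
      have h3 : i = j := congrArg Prod.snd h1
      exact congrArg Sum.inr (Prod.ext (Subtype.ext ((hA c d).2 ⟨k, h2⟩)) h3)

theorem subdivProj_V_surjective (hV : Function.Surjective f.V) (hA : Function.Surjective f.A) :
    Function.Surjective (subdivProj κ f hf).V := by
  rintro (p | c)
  · obtain ⟨p, rfl⟩ := hV p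
    exact ⟨Sum.inl p, rfl⟩
  · induction c using Quotient.inductionOn with
    | _ c =>
    obtain ⟨c, hc⟩ := c
    obtain ⟨c, rfl⟩ := hA c
    exact ⟨Sum.inr (Quotient.mk _ ⟨c, (hf c).1 hc⟩), rfl⟩

theorem subdivProj_A_surjective (hA : Function.Surjective f.A) :
    Function.Surjective (subdivProj κ f hf).A := by
  rintro (⟨a, ha⟩ | ⟨⟨c, hc⟩, i⟩)
  · obtain ⟨a, rfl⟩ := hA a
    exact ⟨Sum.inl ⟨a, fun h => ha ((hf a).2 h)⟩, rfl⟩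
  · obtain ⟨c, rfl⟩ := hA c
    exact ⟨Sum.inr (⟨c, (hf c).1 hc⟩, i), rfl⟩

/-- If the action is free on arcs, then the stabilizer of a midpoint has order two. -/
theorem exists_hom_stabilizer_midpoint (hZ : Z.IsTree) (hfree : FreeOnArcs κ) (a : reversed κ) :
    ∃ ι : ULift.{x} (Multiplicative (ZMod 2)) →* K, Function.Injective ι ∧
      ∀ k, (∃ y, ι y = k) ↔
        (subdivAction κ k).V (Sum.inr (Quotient.mk _ a)) = Sum.inr (Quotient.mk _ a) := by
  obtain ⟨a, g, hg⟩ := a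
  have hg2 : g * g = 1 := hfree _ a (by
    rw [map_mul, Aut.mul_A, hg, (κ g).map_rev, hg, Z.rev_rev])
  have hg1 : g ≠ 1 := by
    rintro rfl
    rw [map_one, Aut.one_A] at hg
    exact hZ.rev_ne a hg.symm
  let θ : ZMod 2 → K := fun i => if i = 0 then 1 else g
  have h01 : ∀ i : ZMod 2, i = 0 ∨ i = 1 := by decide
  have hθ0 : θ 0 = 1 := if_pos rfl
  have hθ1 : θ 1 = g := if_neg (by decide)
  have hθ : ∀ i j, θ (i + j) = θ i * θ j := by
    intro i j
    rcases h01 i with rfl | rfl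
    · rw [zero_add, hθ0, one_mul]
    · rcases h01 j with rfl | rfl
      · rw [add_zero, hθ0, mul_one]
      · rw [show (1 : ZMod 2) + 1 = 0 by decide, hθ0, hθ1, hg2]
  have hinj : Function.Injective θ := by
    intro i j h
    rcases h01 i with rfl | rfl <;> rcases h01 j with rfl | rfl
    · rfl
    · rw [hθ0, hθ1] at h
      exact absurd h.symm hg1
    · rw [hθ0, hθ1] at h
      exact absurd h hg1
    · rfl
  refine ⟨⟨⟨fun y => θ y.down.toAdd, hθ0⟩, fun y z => hθ _ _⟩,
    fun y z h => congrArg (fun i : ZMod 2 => ULift.up (Multiplicative.ofAdd i)) (hinj h),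
    fun k => ?_⟩
  · constructor
    · rintro ⟨y, rfl⟩
      refine congrArg Sum.inr (Quotient.sound (s := revSetoid Z (reversed κ)) ?_)
      show a = (κ (θ y.down.toAdd)).A a ∨ a = Z.rev ((κ (θ y.down.toAdd)).A a)
      rcases h01 y.down.toAdd with h | h
      · exact Or.inl (by rw [h, hθ0]; simp)
      · exact Or.inr (by rw [h, hθ1, hg, Z.rev_rev])
    · intro h
      have h1 : a = (κ k).A a ∨ a = Z.rev ((κ k).A a) :=
        Quotient.exact (s := revSetoid Z (reversed κ)) (Sum.inr_injective h)
      rcases h1 with h1 | h1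
      · exact ⟨1, hθ0.trans (hfree k a h1.symm).symm⟩
      · refine ⟨⟨Multiplicative.ofAdd 1⟩, eq_of_free hfree (a := a) ?_⟩
        have : (κ k).A a = Z.rev a := by rw [h1, Z.rev_rev, ← h1]
        rw [this, ← hg]
        exact congrArg (fun x => (κ x).A a) hθ1

end SubdivAction

end TreeAction

/-! ### Vertex stabilizers and local actions -/

namespace TreeAction

variable {K : Type w} [Group K] {Z : RGraph.{u, v}}

/-- In a faithful action that is free on arcs, vertex stabilizers are isomorphic to the local
actions. -/
theorem exists_hom_stabilizer (hZ : Z.IsTree) {κ : K →* Aut Z} (hκ : Function.Injective κ)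
    (hfree : FreeOnArcs κ) (s : (quot κ).V → Z.V) (hs : ∀ p, (quotMap κ).V (s p) = p)
    {E : Diagram.{u', v', w'}} (e : DiagramIso (assocDiagram hZ κ s hs) E) (p : E.Γ.V) :
    ∃ z, e.graph.V ((quotMap κ).V z) = p ∧ ∃ ι : E.G p →* K, Function.Injective ι ∧
      ∀ k, (∃ y, ι y = k) ↔ (κ k).V z = z := by
  obtain ⟨p, rfl⟩ := e.graph.V.surjective p
  refine ⟨s p, congrArg e.graph.V (hs p), ?_⟩
  let col : {b : Z.A // Z.o b = s p} ≃ E.X (e.graph.V p) := e.colour p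
  let β : vStab κ (s p) →* E.G (e.graph.V p) :=
    (col.permCongrHom.toMonoidHom.comp (starHom κ (s p))).codRestrict _
      fun k => (e.map_group p _).1 (starHom_mem κ k)
  have hβ : Function.Bijective β := by
    constructor
    · rw [injective_iff_map_eq_one]
      intro k hk
      have h1 : starHom κ (s p) k = 1 := col.permCongrHom.injective
        ((congrArg Subtype.val hk).trans (map_one col.permCongrHom).symm)
      refine Subtype.ext ?_
      rcases isEmpty_or_nonempty Z.A with h' | h'
      · exact hκ (Iso.ext_of_arcs hZ.isConnected fun a => isEmptyElim a)
      · obtain ⟨b, hb⟩ := hZ.isConnected.exists_arc (s p)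
        exact hfree _ b (congrArg (fun σ : Perm {b : Z.A // Z.o b = s p} => (σ ⟨b, hb⟩ : Z.A)) h1)
    · rintro ⟨τ, hτ⟩
      have h1 : col.permCongr (col.permCongr.symm τ) = τ := Equiv.apply_symm_apply _ _
      obtain ⟨k, hk⟩ := (mem_localAction_iff_of_free hZ hfree).1
        ((e.map_group p (col.permCongr.symm τ)).2 (by rwa [← h1] at hτ))
      refine ⟨k, Subtype.ext ?_⟩
      show col.permCongr (starHom κ (s p) k) = τ
      rw [hk, h1]
  let Φ := MulEquiv.ofBijective β hβ
  refine ⟨(vStab κ (s p)).subtype.comp Φ.symm.toMonoidHom,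
    (Subgroup.subtype_injective _).comp Φ.symm.injective, fun k => ⟨?_, fun hk => ?_⟩⟩
  · rintro ⟨y, rfl⟩
    exact (Φ.symm y).2
  · exact ⟨Φ ⟨k, hk⟩, congrArg Subtype.val (Φ.symm_apply_apply ⟨k, hk⟩)⟩

/-- A faithful action whose local actions are semiregular is free on arcs: an element that fixes an
arc fixes all arcs that start at one of its end vertices. -/
theorem freeOnArcs_of_semiregular (hZ : Z.IsTree) {κ : K →* Aut Z} (hκ : Function.Injective κ)
    (s : (quot κ).V → Z.V) (hs : ∀ p, (quotMap κ).V (s p) = p)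
    (h : ∀ p, ∀ σ ∈ localAction κ (s p), ∀ c, σ c = c → σ = 1) : FreeOnArcs κ := by
  intro k a ha
  refine hκ (Iso.ext_of_arcs hZ.isConnected fun b => ?_)
  rw [map_one, Aut.one_A]
  refine hZ.isConnected.forall_arc (Q := fun b => (κ k).A b = b) ha
    (fun b hb => by rw [(κ k).map_rev, hb]) (fun b c hbc hb => ?_) b
  obtain ⟨g, hg⟩ := (quotMap_V_eq κ).1 (hs ((quotMap κ).V (Z.o b)))
  have hg' := map_inv_V_eq κ hg
  have hk : (κ k).V (Z.o b) = Z.o b := by rw [(κ k).map_o, hb]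
  have hmem : g⁻¹ * k * g ∈ vStab κ (s ((quotMap κ).V (Z.o b))) := by
    show (κ (g⁻¹ * k * g)).V _ = _
    rw [map_mul, map_mul, Aut.mul_V, Aut.mul_V, hg, hk, hg']
  have h1 := h _ _ (starHom_mem κ ⟨_, hmem⟩) ⟨(κ g⁻¹).A b, by rw [← (κ _).map_o, hg']⟩
    (Subtype.ext (by
      rw [starHom_apply]
      simp only [map_mul, Aut.mul_A, map_A_inv, hb]))
  have h2 := congrArg (fun σ : Perm {b : Z.A // Z.o b = s _} => (κ g).A
    (σ ⟨(κ g⁻¹).A c, by rw [← (κ _).map_o, ← hbc, hg']⟩ : Z.A)) h1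
  simpa only [starHom_apply, map_mul, Aut.mul_A, map_A_inv, Equiv.Perm.one_apply] using h2

theorem Diagram.star_isClosed (D : Diagram.{u, v, w}) : D.star.IsClosed := by
  intro p
  let _ := permTopology (D.star.X p)
  rw [← closure_eq_iff_isClosed, ← coe_permClosure]
  exact congrArg _ (permClosure_eq_of_semiregular fun σ hσ c hc => permStar_semiregular _ hσ hc)

theorem Diagram.star_regular (D : Diagram.{u, v, w}) (p : D.Γ.V) (c d : D.star.X p)
    (h : D.star.arc p c = D.star.arc p d) :
    ∃! g : D.star.G p, (g : Perm (D.star.X p)) c = d := by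
  obtain ⟨g, hg, rfl⟩ := (D.star.orbit p c d).2 h
  refine ⟨⟨g, hg⟩, rfl, ?_⟩
  rintro ⟨k, hk⟩ (h' : k c = g c)
  have h1 : g⁻¹ * k = 1 := permStar_semiregular (D.G p) (mul_mem (inv_mem hg) hk)
    (c := c) (show g⁻¹ (k c) = c from (congrArg _ h').trans (Equiv.symm_apply_apply g c))
  exact Subtype.ext (inv_mul_eq_one.1 h1).symm

/-- A faithful action whose closed local action diagram is of the form `Δ*` is determined by it.
Since the groups of `Δ*` act semiregularly, such an action is free on arcs and passing to the closed
diagram changes nothing, so P-closedness is not needed here. -/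
theorem nonempty_actionIso_of_star (hZ : Z.IsTree) {κ : K →* Aut Z} (hκ : Function.Injective κ)
    (s : (quot κ).V → Z.V) (hs : ∀ p, (quotMap κ).V (s p) = p)
    {D : Diagram.{u', v', w'}} (e : DiagramIso (assocDiagram hZ κ s hs) D.star)
    {K' : Type x} [Group K'] {Z' : RGraph.{u₁, v₁}} (hZ' : Z'.IsTree) {κ' : K' →* Aut Z'}
    (hκ' : Function.Injective κ') (s' : (quot κ').V → Z'.V)
    (hs' : ∀ p, (quotMap κ').V (s' p) = p)
    (e' : DiagramIso (assocDiagram hZ' κ' s' hs').closure D.star) :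
    Nonempty (ActionIso κ κ') := by
  have hsemi : ∀ p, ∀ σ ∈ localAction κ' (s' p), ∀ c, σ c = c → σ = 1 := by
    intro p σ hσ c hc
    let col : {b : Z'.A // Z'.o b = s' p} ≃ D.star.X (e'.graph.V p) := e'.colour p
    have h1 : col.permCongr σ ∈ D.star.G (e'.graph.V p) :=
      (e'.map_group p σ).1 fun F => ⟨σ, hσ, fun _ _ => rfl⟩
    have h3 : col.permCongr σ (col c) = col c :=
      (congrArg (fun y => col (σ y)) (col.symm_apply_apply c)).trans (congrArg col hc)
    have h2 : col.permCongr σ = 1 := permStar_semiregular (D.G _) h1 (c := col c) h3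
    exact col.permCongrHom.injective (h2.trans (map_one col.permCongrHom).symm)
  have hfree' := freeOnArcs_of_semiregular hZ' hκ' s' hs' hsemi
  exact nonempty_actionIso_of_diagramIso hZ hZ' hκ hκ' hfree' s hs s' hs'
    (e.trans (DiagramIso.ofClosure (fun p => permClosure_eq_of_semiregular (hsemi p)) e').symm)

end TreeAction

theorem mainTheorem8 {G : Type w} [Group G] {T : RGraph.{u, v}} (hT : T.IsTree) (ρ : G →* Aut T)
    (hρ : Function.Injective ρ ∨ Nonempty T.A)
    (s : (quot ρ).V → T.V) (hs : ∀ p, (quotMap ρ).V (s p) = p) :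
    let Δ : Diagram.{u, v, v} := assocDiagram hT ρ s hs
    -- `(G⁺ \ T, G / G⁺)` is a faithful P-closed action on a tree, free on arcs
    ∃ hT₁ : (plusQuot ρ).IsTree,
    Function.Injective (quotientAction ρ) ∧
    FreeOnArcs (quotientAction ρ) ∧
    IsPClosed (quotientAction ρ).range ∧
    -- it depends only on `Γ`, the `X_a` and the closures of the groups `G(v)`
    (∀ {G' : Type w'} [Group G'] {T' : RGraph.{u', v'}} (hT' : T'.IsTree) (ρ' : G' →* Aut T')
      (_ : Function.Injective ρ' ∨ Nonempty T'.A)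
      (s' : (quot ρ').V → T'.V) (hs' : ∀ p, (quotMap ρ').V (s' p) = p),
      Nonempty (DiagramIso Δ.closure (assocDiagram hT' ρ' s' hs').closure) →
      Nonempty (ActionIso (quotientAction ρ) (quotientAction ρ'))) ∧
    -- it is unchanged if `G` is replaced with its P-closure
    (∃ e : ActionIso (quotientAction ρ) (quotientAction (pClosure ρ.range).subtype),
      (∀ p, e.graph.V ((plusMap ρ).V p) = (plusMap (pClosure ρ.range).subtype).V p) ∧
      (∀ a, e.graph.A ((plusMap ρ).A a) = (plusMap (pClosure ρ.range).subtype).A a) ∧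
      (∀ g : G, e.group (QuotientGroup.mk g) =
        QuotientGroup.mk ⟨ρ g, le_pClosure ρ.range ⟨g, rfl⟩⟩)) ∧
    -- (i) `Δ*` is a local action diagram, `G*(v) = G(v) / G(v)⁺`, and the `X*_a` are regular
    Δ.star.IsClosed ∧
    (∀ p, (permStarHom (Δ.G p)).ker = permPlus (Δ.G p)) ∧
    (∀ (p : Δ.Γ.V) (c d : Δ.star.X p), Δ.star.arc p c = Δ.star.arc p d →
      ∃! g : Δ.star.G p, (g : Equiv.Perm (Δ.star.X p)) c = d) ∧
    -- passing from the groups `G(v)` to their closures does not change `Δ*`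
    (∃ e : DiagramIso Δ.closure.star Δ.star, (∀ p, e.graph.V p = p) ∧ (∀ a, e.graph.A a = a)) ∧
    -- the local action diagram of the quotient action is `Δ*`, over the natural map of graphs
    (∀ (s₁ : (quot (quotientAction ρ)).V → (plusQuot ρ).V)
      (hs₁ : ∀ p, (quotMap (quotientAction ρ)).V (s₁ p) = p),
      ∃ e : DiagramIso (assocDiagram hT₁ (quotientAction ρ) s₁ hs₁) Δ.star,
        (∀ p, e.graph.V ((quotMap (quotientAction ρ)).V p) = (plusToQuot ρ).V p) ∧
        (∀ a, e.graph.A ((quotMap (quotientAction ρ)).A a) = (plusToQuot ρ).A a)) ∧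
    -- and it is the unique P-closed action with this local action diagram
    (∀ {T' : RGraph.{u', v'}} (hT' : T'.IsTree) (K : Subgroup (Aut T')) (_ : IsPClosed K)
      (s' : (quot K.subtype).V → T'.V) (hs' : ∀ p, (quotMap K.subtype).V (s' p) = p),
      Nonempty (DiagramIso (assocDiagram hT' K.subtype s' hs').closure Δ.star) →
      Nonempty (ActionIso (quotientAction ρ) K.subtype)) ∧
    -- (ii) `Γⁱ` is the quotient of `Tⁱ` by `G`
    (∃ e : Iso (quot (subdivAction ρ)) (graphSubdiv (quot ρ)),
      (∀ p, e.V ((quotMap (subdivAction ρ)).V p) = (subdivQuotMap ρ).V p) ∧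
      (∀ a, e.A ((quotMap (subdivAction ρ)).A a) = (subdivQuotMap ρ).A a)) ∧
    -- and the action of `G / G⁺` on the reversal-free subdivision of `G⁺ \ T` is, over `Γⁱ`, that of
    -- the fundamental group of the graph of groups on its Bass–Serre tree
    (∃ S, IsMaximalSubtree (graphSubdiv (quot ρ)) S) ∧
    (∀ S : Set (graphSubdiv (quot ρ)).A, IsMaximalSubtree (graphSubdiv (quot ρ)) S →
      ∃ e : ActionIso (subdivAction (quotientAction ρ)) (Δ.star.graphOfGroups.bassSerreAction S),
        (∀ p, (Δ.star.graphOfGroups.bassSerreProj S).V (e.graph.V p) =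
          (subdivPlusToQuot ρ).V p) ∧
        (∀ a, (Δ.star.graphOfGroups.bassSerreProj S).A (e.graph.A a) =
          (subdivPlusToQuot ρ).A a)) := by
  intro Δ
  have hT₁ := plusQuot_isTree hT ρ
  have hinj := quotientAction_injective hT.isConnected ρ hρ
  have hfree := quotientAction_free ρ
  obtain ⟨e₁, he₁, -⟩ := exists_diagramIso_quotientAction hT ρ s hs hT₁ Quotient.out Quotient.out_eq
  refine ⟨hT₁, hinj, hfree, isPClosed_range_of_free hT₁ hfree, ?_,
    exists_actionIso_pClosure hT ρ hρ, Δ.star_isClosed, fun p => ker_permStarHom _,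
    Δ.star_regular, DiagramIso.exists_star_closure Δ, ?_, ?_, ?_, ?_, ?_⟩
  · rintro G' _ T' hT' ρ' hρ' s' hs' ⟨e⟩
    have hT₁' := plusQuot_isTree hT' ρ'
    obtain ⟨e₁', -⟩ := exists_diagramIso_quotientAction hT' ρ' s' hs' hT₁' Quotient.out
      Quotient.out_eq
    obtain ⟨c, -⟩ := DiagramIso.exists_star_closure Δ
    obtain ⟨c', -⟩ := DiagramIso.exists_star_closure (assocDiagram hT' ρ' s' hs')
    exact nonempty_actionIso_of_diagramIso hT₁ hT₁' hinj
      (quotientAction_injective hT'.isConnected ρ' hρ') (quotientAction_free ρ') _ _ _ _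
      (e₁.trans (c.symm.trans (e.star.trans (c'.trans e₁'.symm))))
  · exact fun s₁ hs₁ => exists_diagramIso_quotientAction hT ρ s hs hT₁ s₁ hs₁
  · rintro T' hT' K _ s' hs' ⟨e⟩
    exact nonempty_actionIso_of_star hT₁ hinj _ _ e₁ hT' (Subgroup.subtype_injective K)
      s' hs' e
  · exact ⟨quotIso (subdivAction ρ) (subdivQuotMap ρ)
      (subdivProj_V_eq ρ _ (quotMap_selfRev ρ) (fun _ _ => quotMap_V_eq ρ)
        fun _ _ => quotMap_A_eq ρ)
      (subdivProj_A_eq ρ _ (quotMap_selfRev ρ) fun _ _ => quotMap_A_eq ρ)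
      (subdivProj_V_surjective ρ _ (quotMap_selfRev ρ) (quotMap_V_surjective ρ)
        (quotMap_A_surjective ρ))
      (subdivProj_A_surjective ρ _ (quotMap_selfRev ρ) (quotMap_A_surjective ρ)),
      fun _ => rfl, fun _ => rfl⟩
  · exact exists_isMaximalSubtree (subdiv_isConnected (quot_connected ρ hT.isConnected))
  · intro S hS
    refine exists_actionIso_bassSerre (subdiv_isTree hT₁) _ (subdivAction_free _ hfree)
      (subdivPlusToQuot ρ)
      (subdivProj_V_eq _ _ (plusToQuot_selfRev ρ) (plusToQuot_V_eq ρ) (plusToQuot_A_eq ρ))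
      (subdivProj_A_eq _ _ (plusToQuot_selfRev ρ) (plusToQuot_A_eq ρ))
      (subdivProj_V_surjective _ _ (plusToQuot_selfRev ρ) (plusToQuot_V_surjective ρ)
        (plusToQuot_A_surjective ρ))
      (subdivProj_A_surjective _ _ (plusToQuot_selfRev ρ) (plusToQuot_A_surjective ρ))
      Δ.star.graphOfGroups (fun _ => inferInstanceAs (Subsingleton PUnit)) ?_ S hS
    rintro (p | c)
    · obtain ⟨z, hz, ι, h1, h2⟩ := exists_hom_stabilizer hT₁ hinj hfree _ _ e₁ p
      refine ⟨Sum.inl z, congrArg Sum.inl ((he₁ z).symm.trans hz), ι, h1, fun k => ?_⟩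
      exact (h2 k).trans Sum.inl_injective.eq_iff.symm
    · induction c using Quotient.inductionOn with
      | _ c =>
      obtain ⟨c, hc⟩ := c
      obtain ⟨a, rfl⟩ := plusToQuot_A_surjective ρ c
      exact ⟨Sum.inr (Quotient.mk _ ⟨a, (plusToQuot_selfRev ρ a).1 hc⟩), rfl,
        exists_hom_stabilizer_midpoint (quotientAction ρ) hT₁ hfree _⟩
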